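/- **Setting.** Plant $\dot x=A(t)x+B(t)w$, $x(0)=x_0\in\mathbb R^n$; nodes $i=1,\dots,N$ with measurements $y_i=C_i(t)x+D_i(t)v_i$; node $i$ receives $c_{ij}=W_{ij}\hat x_j+H_{ij}v_{ij}$ from its neighbours $j\in\mathbf N_i$ ($i\notin \mathbf N_i$). The controlled observers, subject to attack inputs $f_i$ and corrected by the detector outputs $\varphi_i$, are $$\dot{\hat x}_i=A\hat x_i+L_i^r\zeta_i+\sum_{j\in\mathbf N_i}K_{ij}^r\zeta_{ij}+F_if_i-F_i\varphi_i,\quad \hat x_i(0)=\xi_i,\qquad \zeta_i=y_i-C_i\hat x_i,\quad \zeta_{ij}=c_{ij}-W_{ij}\hat x_i,$$ and the attack detectors are, with $\hat e_i(0)=0$, $\hat\epsilon_i(0)=0$, $\varphi_i=\Upsilon_i\hat\epsilon_i$, $$\dot{\hat e}_i=\Big(A-L_i^rC_i-\sum_{j\in\mathbf N_i}K_{ij}^rW_{ij}\Big)\hat e_i+\sum_{j\in\mathbf N_i}K_{ij}^rW_{ij}\hat e_j+\bar L_i^r(\zeta_i-C_i\hat e_i)+\sum_{j\in\mathbf N_i}\bar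 K_{ij}^r\big(\zeta_{ij}-W_{ij}(\hat e_i-\hat e_j)\big),$$ $$\dot{\hat\epsilon}_i=\Omega_i\hat\epsilon_i+\check L_i^r(\zeta_i-C_i\hat e_i)+\sum_{j\in\mathbf N_i}\check K_{ij}^r\big(\zeta_{ij}-W_{ij}(\hat e_i-\hat e_j)\big).$$ **Attacks.** An attack input $f_i$ is admissible if $f_i=f_{i1}+f_{i2}$ on $[0,\infty)$, where $f_{i2}\in L_2[0,\infty)$ and the Laplace transform $f_{i1}(s)$ converges absolutely for $\mathrm{Re}\,s>0$ with $\sup_{\mathrm{Re}\,s>0}\|s f_{i1}(s)\|<\infty$. For each $i$ a proper rational transfer function $G_i(s)$ is given for which the feedback loop $\hat f_i=\frac1sG_i(s)(f_i-\hat f_i)$ is internally stable, and $\dot\epsilon_i=\Omega_i\epsilon_i+\Gamma_i\nu_i$, $\epsilon_i(0)=0$, $\hat f_i=\Upsilon_i\epsilon_i$, with $\nu_i=\hat f_i-f_i$, is a minimal realization of the block $\frac1sG_i(s)$ of this loop (the input of the block being $f_i-\hat f_i=-\nu_i$). **Notation.** For $j_1,\dots,j_{q_i}$ the elements of $\mathbf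 N_i$ and symmetric weights $Z=(Z_{ij})$, put $$\mathbf A_i=\begin{bmatrix}A&-F_i\Upsilon_i\\0&\Omega_i\end{bmatrix},\ \mathbf B_i=\begin{bmatrix}B&F_i\\0&\Gamma_i\end{bmatrix},\ \mathbf B_{1,i}=[B\ \ F_i],\ \mathbf C_{1,i}=[C_i'\ W_{ij_1}'\ \cdots\ W_{ij_{q_i}}']',\ \mathbf C_i=[\mathbf C_{1,i}\ \ 0],$$ $$\mathbf D_i=\begin{bmatrix}D_i&0&0\\0&\mathrm{diag}_j H_{ij}&\mathrm{diag}_jZ_{ij}^{1/2}\end{bmatrix},\quad \mathbf E_i=\mathbf D_i\mathbf D_i',\quad U_{ij}=H_{ij}H_{ij}'+Z_{ij},\quad \Delta_i=\sum_{j\in\mathbf N_i}W_{ij}'U_{ij}^{-1}Z_{ij}U_{ij}^{-1}W_{ij},$$ $\Delta=\mathrm{diag}[\Delta_1,\dots,\Delta_N]$, and let $\Phi$ be the block matrix with $\Phi_{ii}=\Delta_i$, $\Phi_{ij}=-W_{ij}'U_{ij}^{-1}W_{ij}$ for $j\in\mathbf N_i$, and $\Phi_{ij}=0$ otherwise. Let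 $P=P'\ge0$ be a given $nN\times nN$ matrix. **Conditions (detectors).** There are $\gamma>0$ and symmetric $R_i\ge0$, $\check R_i\ge0$, $X_i>0$, $\check X_i>0$, $Z_{ij}>0$ such that, with $R=\mathrm{diag}[R_1,\dots,R_N]$, $\mathbf R_i=\mathrm{diag}[R_i,\check R_i]$, $\mathbf X_i=\mathrm{diag}[X_i,\check X_i]$: $\mathbf E_i(t)>0$ for all $t\ge 0$; $R+\gamma^2(\Phi+\Phi'-\Delta)>0$; $\check R_i>\Upsilon_i'\Upsilon_i$; and $$\dot{\mathbf Y}_i=\mathbf A_i\mathbf Y_i+\mathbf Y_i\mathbf A_i'-\mathbf Y_i\big(\mathbf C_i'\mathbf E_i^{-1}\mathbf C_i-\gamma^{-2}\mathbf R_i\big)\mathbf Y_i+\mathbf B_i\mathbf B_i',\quad \mathbf Y_i(0)=\mathbf X_i,$$ has a symmetric solution with $\alpha_1I<\mathbf Y_i(t)<\alpha_2I$ for all $t\ge0$, for some $\alpha_1,\alpha_2>0$. **Conditions (observers).** There are $\bar\gamma>0$ and symmetric $\bar R_i\ge0$, $\bar X_i>0$ and weights $\bar Z_{ij}>0$ (equal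 to $Z_{ij}$ or not) such that, with $\bar R=\mathrm{diag}[\bar R_1,\dots,\bar R_N]$ and with $\Phi,\Delta,\mathbf E_i$ formed from $\bar Z_{ij}$: $\mathbf E_i(t)>0$ for all $t\ge0$; $\bar R+\bar\gamma^2(\Phi+\Phi'-\Delta)>P$; and $$\dot Y_i=AY_i+Y_iA'-Y_i\big(\mathbf C_{1,i}'\mathbf E_i^{-1}\mathbf C_{1,i}-\bar\gamma^{-2}\bar R_i\big)Y_i+\mathbf B_{1,i}\mathbf B_{1,i}',\quad Y_i(0)=\bar X_i,$$ has a symmetric solution with $\bar\alpha_1I<Y_i(t)<\bar\alpha_2I$ for all $t\ge0$, for some $\bar\alpha_1,\bar\alpha_2>0$. **Gains.** $\begin{bmatrix}\hat L_i^r&\hat K_{ij_1}^r&\cdots&\hat K_{ij_{q_i}}^r\\\check L_i^r&\check K_{ij_1}^r&\cdots&\check K_{ij_{q_i}}^r\end{bmatrix}=\mathbf Y_i\mathbf C_i'\mathbf E_i^{-1}$ (with $\mathbf E_i$ formed from $Z_{ij}$), $[L_i^r\ K_{ij_1}^r\cdots K_{ij_{q_i}}^r]=Y_i\mathbf C_{1,i}'\mathbf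 E_i^{-1}$ (with $\mathbf E_i$ formed from $\bar Z_{ij}$), $\bar L_i^r=\hat L_i^r-L_i^r$, $\bar K_{ij}^r=\hat K_{ij}^r-K_{ij}^r$. **Theorem 1.** Under these conditions, the errors $e_i=x-\hat x_i$, $\mathbf e=[e_1'\ \dots\ e_N']'$, of the network of observers and detectors satisfy: (i) If $w=0$, $v_i=0$, $v_{ij}=0$, $f_i=0$, then $e_i\to0$ exponentially: there are $M,r>0$, independent of the initial conditions, with $\|x(t)-\hat x_i(t)\|\le Me^{-rt}\sum_j\|x_0-\xi_j\|$ for all $i$ and $t\ge0$. (ii) If $w,v_i,v_{ij}\in L_2[0,\infty)$ and all $f_i$ are admissible, then $\nu_i\in L_2[0,\infty)$, $x-\hat x_i\in L_2[0,\infty)$ for all $i$, $$\int_0^\infty\mathbf e'P\mathbf e\,dt\le\bar\gamma^2\sum_{i=1}^N\Big((x_0-\xi_i)'(\bar X_i^{-1}+2\gamma^2X_i^{-1})(x_0-\xi_i)+(1+2\gamma^2)\int_0^\infty\big(\|w\|^2+\|v_i\|^2+\sum_{j\in\mathbf N_i}\|v_{ij}\|^2\big)dt\Big)+2\bar\gamma^2(1+\gamma^2)\sum_{i=1}^N\int_0^\infty\|\nu_i\|^2dt,$$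 and the detector outputs track the attacks: $\varphi_i-f_i\in L_2[0,\infty)$ for all $i$. -/

import Mathlib

open MeasureTheory Set
open scoped Matrix MatrixOrder

namespace ResilientObserver

noncomputable section

/-! ### Signals, integral solutions of differential equations -/

/-- Euclidean norm `(x'x)^{1/2}` of a real vector. -/
def eNorm {ι : Type*} [Fintype ι] (x : ι → ℝ) : ℝ := Real.sqrt (x ⬝ᵥ x)

/-- `u ∈ L₂[0,∞)`: `u` is measurable on `[0,∞)` and `∫₀^∞ u'u dt < ∞`. -/
def IsL2 {ι : Type*} [Fintype ι] (u : ℝ → ι → ℝ) : Prop :=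
  AEStronglyMeasurable u (volume.restrict (Ici (0 : ℝ))) ∧
    IntegrableOn (fun t => u t ⬝ᵥ u t) (Ici (0 : ℝ))

/-- `y` is a (Caratheodory) solution on `[0,∞)` of `dy/dt = g(t)`, `y(0) = y₀`: `g` is locally
integrable and `y` is its integral. Equivalently, `y` is locally absolutely continuous and
`dy/dt = g` almost everywhere. -/
def Solves (y : ℝ → ℝ) (y₀ : ℝ) (g : ℝ → ℝ) : Prop :=
  ∀ t : ℝ, 0 ≤ t → IntervalIntegrable g volume 0 t ∧ y t = y₀ + ∫ s in (0 : ℝ)..t, g s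

/-- Vector differential equation `dx/dt = g(t)`, `x(0) = x₀`. -/
def SolvesVec {ι : Type*} (x : ℝ → ι → ℝ) (x₀ : ι → ℝ) (g : ℝ → ι → ℝ) : Prop :=
  ∀ a, Solves (fun t => x t a) (x₀ a) (fun t => g t a)

/-- Matrix differential equation `dY/dt = g(t)`, `Y(0) = Y₀`. -/
def SolvesMat {ι κ : Type*} (Y : ℝ → Matrix ι κ ℝ) (Y₀ : Matrix ι κ ℝ)
    (g : ℝ → Matrix ι κ ℝ) : Prop :=
  ∀ a b, Solves (fun t => Y t a b) (Y₀ a b) (fun t => g t a b)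

/-! ### Biasing attack inputs -/

/-- Laplace transform of a real signal on `[0,∞)`. -/
def laplace (g : ℝ → ℝ) (s : ℂ) : ℂ :=
  ∫ t in Ici (0 : ℝ), Complex.exp (-s * (t : ℂ)) * (g t : ℂ)

/-- Admissible attack inputs `f = f₁ + f₂`: the Laplace transform of `f₁` converges in the open
right half-plane and `s f₁(s)` is bounded there (so that `ω f₁(jω)` is bounded on the
imaginary axis), and `f₂ ∈ L₂[0,∞)`. -/
def IsAdmissibleAttack {k : ℕ} (f : ℝ → Fin k → ℝ) : Prop :=
  ∃ f₁ f₂ : ℝ → Fin k → ℝ,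
    (∀ t, 0 ≤ t → f t = f₁ t + f₂ t) ∧
    (∀ σ : ℝ, 0 < σ → ∀ a, IntegrableOn (fun t => Real.exp (-σ * t) * f₁ t a) (Ici (0 : ℝ))) ∧
    (∃ M : ℝ, ∀ s : ℂ, 0 < s.re → ∀ a, ‖s * laplace (fun t => f₁ t a) s‖ ≤ M) ∧
    IsL2 f₂

/-- All complex eigenvalues lie in the open left half-plane. -/
def IsHurwitz {ι : Type*} [Fintype ι] [DecidableEq ι] (M : Matrix ι ι ℝ) : Prop :=
  ∀ z ∈ spectrum ℂ (M.map (fun r : ℝ => (r : ℂ))), z.re < 0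

/-- `C (s I - A)⁻¹ B` at a complex number `s`. -/
def transfer {d k l : ℕ} (A : Matrix (Fin d) (Fin d) ℝ) (B : Matrix (Fin d) (Fin k) ℝ)
    (C : Matrix (Fin l) (Fin d) ℝ) (s : ℂ) : Matrix (Fin l) (Fin k) ℂ :=
  C.map (fun r : ℝ => (r : ℂ)) *
    (s • (1 : Matrix (Fin d) (Fin d) ℂ) - A.map (fun r : ℝ => (r : ℂ)))⁻¹ *
    B.map (fun r : ℝ => (r : ℂ))

/-- A proper `k × k` real rational transfer function `G(s) = Dg + Cg (s I - Ag)⁻¹ Bg`, given by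
a state-space realization. -/
structure ProperTransfer (k : ℕ) where
  order : ℕ
  Ag : Matrix (Fin order) (Fin order) ℝ
  Bg : Matrix (Fin order) (Fin k) ℝ
  Cg : Matrix (Fin k) (Fin order) ℝ
  Dg : Matrix (Fin k) (Fin k) ℝ

/-- The value `G(s)`. -/
def ProperTransfer.eval {k : ℕ} (G : ProperTransfer k) (s : ℂ) : Matrix (Fin k) (Fin k) ℂ :=
  G.Dg.map (fun r : ℝ => (r : ℂ)) + transfer G.Ag G.Bg G.Cg s

/-- (Internal) stability of the unity negative feedback loop `f̂ = (1/s) G(s) (f - f̂)`: with `q`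
the state of `G` and the integrator output `f̂`, the loop is
`dq/dt = Ag q + Bg (f - f̂)`, `df̂/dt = Cg q + Dg (f - f̂)`. -/
def ProperTransfer.LoopStable {k : ℕ} (G : ProperTransfer k) : Prop :=
  IsHurwitz (Matrix.fromBlocks G.Ag (-G.Bg) G.Cg (-G.Dg))

/-- `(Ω, Γ, Υ)` with input `ν = f̂ - f` and output `f̂` is a minimal (controllable and observable)
realization of the block `(1/s) G(s)`, whose input is `f - f̂ = -ν`; hence the minus sign. -/
def IsTrackerRealization {d k : ℕ} (G : ProperTransfer k) (Ω : Matrix (Fin d) (Fin d) ℝ)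
    (Γ : Matrix (Fin d) (Fin k) ℝ) (Υ : Matrix (Fin k) (Fin d) ℝ) : Prop :=
  (∀ s : ℂ, s ≠ 0 → s ∉ spectrum ℂ (Ω.map (fun r : ℝ => (r : ℂ))) →
      s ∉ spectrum ℂ (G.Ag.map (fun r : ℝ => (r : ℂ))) →
      transfer Ω (-Γ) Υ s = s⁻¹ • G.eval s) ∧
  (Submodule.span ℝ (Set.range fun a : ℕ × Fin k => (Ω ^ a.1 * Γ).col a.2) = ⊤) ∧
  (∀ x : Fin d → ℝ, (∀ l : ℕ, (Υ * Ω ^ l) *ᵥ x = 0) → x = 0)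

/-! ### Plant, sensors, communication network, attack model -/

/-- Data of the estimation problem with `N` nodes, plant state dimension `n` and plant
disturbance dimension `m`. -/
structure Network (N n m : ℕ) where
  /-- dimension of the measurement `y_i` -/
  p : Fin N → ℕ
  /-- dimension of the measurement disturbance `v_i` -/
  q : Fin N → ℕ
  /-- dimension of the communicated signal `c_ij` -/
  pc : Fin N → Fin N → ℕ
  /-- dimension of the channel disturbance `v_ij` -/
  qc : Fin N → Fin N → ℕ
  /-- dimension of the attack input `f_i` -/
  nf : Fin N → ℕ
  /-- dimension of the state `ε_i` of the attack model -/
  ne : Fin N → ℕ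
  /-- neighbourhood of a node -/
  nbr : Fin N → Finset (Fin N)
  not_mem_nbr : ∀ i, i ∉ nbr i
  A : ℝ → Matrix (Fin n) (Fin n) ℝ
  B : ℝ → Matrix (Fin n) (Fin m) ℝ
  C : ∀ i, ℝ → Matrix (Fin (p i)) (Fin n) ℝ
  D : ∀ i, ℝ → Matrix (Fin (p i)) (Fin (q i)) ℝ
  W : ∀ i j, Matrix (Fin (pc i j)) (Fin n) ℝ
  H : ∀ i j, Matrix (Fin (pc i j)) (Fin (qc i j)) ℝ
  F : ∀ i, Matrix (Fin n) (Fin (nf i)) ℝ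
  Ω : ∀ i, Matrix (Fin (ne i)) (Fin (ne i)) ℝ
  Γ : ∀ i, Matrix (Fin (ne i)) (Fin (nf i)) ℝ
  Υ : ∀ i, Matrix (Fin (nf i)) (Fin (ne i)) ℝ

namespace Network

variable {N n m : ℕ} (S : Network N n m)

/-- Index set of the stacked output `(y_i, c_{ij_1}, …, c_{ij_{q_i}})` of node `i`. -/
abbrev Out (i : Fin N) : Type := Fin (S.p i) ⊕ (Σ j : S.nbr i, Fin (S.pc i j))

/-- Index set of the stacked disturbance at the output of node `i`. -/
abbrev Noise (i : Fin N) : Type :=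
  Fin (S.q i) ⊕ ((Σ j : S.nbr i, Fin (S.qc i j)) ⊕ (Σ j : S.nbr i, Fin (S.pc i j)))

/-- Index set of the extended state `(e_i, ε_i)` of node `i`. -/
abbrev Ext (i : Fin N) : Type := Fin n ⊕ Fin (S.ne i)

/-- Weight matrices `Z_ij` on the edges of the network. -/
abbrev EdgeWeights : Type := ∀ i j, Matrix (Fin (S.pc i j)) (Fin (S.pc i j)) ℝ

/-- Stacked output matrix `C_{1,i} = [C_i; W_{ij_1}; …; W_{ij_{q_i}}]`. -/
def bC1 (i : Fin N) (t : ℝ) : Matrix (S.Out i) (Fin n) ℝ :=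
  Matrix.of fun a b => Sum.elim (fun k => S.C i t k b) (fun jk => S.W i jk.1 jk.2 b) a

/-- `[C_{1,i}  0]`. -/
def bC (i : Fin N) (t : ℝ) : Matrix (S.Out i) (S.Ext i) ℝ :=
  Matrix.fromCols (S.bC1 i t) 0

/-- The block matrix `[A, -F_i Υ_i; 0, Ω_i]`. -/
def bA (i : Fin N) (t : ℝ) : Matrix (S.Ext i) (S.Ext i) ℝ :=
  Matrix.fromBlocks (S.A t) (-(S.F i * S.Υ i)) 0 (S.Ω i)

/-- The block matrix `[B, F_i; 0, Γ_i]`. -/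
def bB (i : Fin N) (t : ℝ) : Matrix (S.Ext i) (Fin m ⊕ Fin (S.nf i)) ℝ :=
  Matrix.fromBlocks (S.B t) (S.F i) 0 (S.Γ i)

/-- The block matrix `[B, F_i]`. -/
def bB1 (i : Fin N) (t : ℝ) : Matrix (Fin n) (Fin m ⊕ Fin (S.nf i)) ℝ :=
  Matrix.fromCols (S.B t) (S.F i)

/-- The block matrix
`[D_i, 0, 0; 0, diag_j H_ij, diag_j Z_ij^{1/2}]`. -/
def bD (Z : S.EdgeWeights) (i : Fin N) (t : ℝ) : Matrix (S.Out i) (S.Noise i) ℝ :=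
  Matrix.fromBlocks (S.D i t) 0 0
    (Matrix.fromCols (Matrix.blockDiagonal' fun j : S.nbr i => S.H i j)
      (Matrix.blockDiagonal' fun j : S.nbr i => CFC.sqrt (Z i j)))

/-- `E_i = D_i D_i'` for the block matrix `bD`. -/
def bE (Z : S.EdgeWeights) (i : Fin N) (t : ℝ) : Matrix (S.Out i) (S.Out i) ℝ :=
  S.bD Z i t * (S.bD Z i t)ᵀ

/-- `U_ij = H_ij H_ij' + Z_ij`. -/
def U (Z : S.EdgeWeights) (i j : Fin N) : Matrix (Fin (S.pc i j)) (Fin (S.pc i j)) ℝ :=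
  S.H i j * (S.H i j)ᵀ + Z i j

/-- `Δ_i = ∑_{j ∈ N_i} W_ij' U_ij⁻¹ Z_ij U_ij⁻¹ W_ij`. -/
def Δ (Z : S.EdgeWeights) (i : Fin N) : Matrix (Fin n) (Fin n) ℝ :=
  ∑ j ∈ S.nbr i, (S.W i j)ᵀ * (S.U Z i j)⁻¹ * Z i j * (S.U Z i j)⁻¹ * S.W i j

/-- The `nN × nN` matrix with the given `n × n` blocks. -/
def ofBlocks (M : Matrix (Fin N) (Fin N) (Matrix (Fin n) (Fin n) ℝ)) :
    Matrix (Fin N × Fin n) (Fin N × Fin n) ℝ :=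
  Matrix.of fun a b => M a.1 b.1 a.2 b.2

/-- The `nN × nN` matrix `Φ`. -/
def Φ (Z : S.EdgeWeights) : Matrix (Fin N × Fin n) (Fin N × Fin n) ℝ :=
  ofBlocks <| Matrix.of fun i j =>
    if i = j then S.Δ Z i
    else if j ∈ S.nbr i then -((S.W i j)ᵀ * (S.U Z i j)⁻¹ * S.W i j)
    else 0

/-- The matrix `diag[R_1, …, R_N] + γ² (Φ + Φ' - Δ)`. -/
def lmi (Z : S.EdgeWeights) (γ : ℝ) (R : Fin N → Matrix (Fin n) (Fin n) ℝ) :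
    Matrix (Fin N × Fin n) (Fin N × Fin n) ℝ :=
  ofBlocks (Matrix.diagonal R) +
    γ ^ 2 • (S.Φ Z + (S.Φ Z)ᵀ - ofBlocks (Matrix.diagonal (S.Δ Z)))

/-- `α₁ I < Y(t) < α₂ I` on `[0,∞)` for some `α₁, α₂ > 0`. -/
def _root_.ResilientObserver.UniformlyPosDef {ι : Type*} [Fintype ι] [DecidableEq ι]
    (Y : ℝ → Matrix ι ι ℝ) : Prop :=
  ∃ α₁ α₂ : ℝ, 0 < α₁ ∧ 0 < α₂ ∧ ∀ t, 0 ≤ t →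
    (Y t - α₁ • (1 : Matrix ι ι ℝ)).PosDef ∧ (α₂ • (1 : Matrix ι ι ℝ) - Y t).PosDef

/-- LMI and Riccati conditions for the attack detectors. -/
structure DetectorConditions (Z : S.EdgeWeights) (γ : ℝ)
    (R : Fin N → Matrix (Fin n) (Fin n) ℝ)
    (Rc : ∀ i, Matrix (Fin (S.ne i)) (Fin (S.ne i)) ℝ)
    (X : Fin N → Matrix (Fin n) (Fin n) ℝ)
    (Xc : ∀ i, Matrix (Fin (S.ne i)) (Fin (S.ne i)) ℝ)
    (Y : ∀ i, ℝ → Matrix (S.Ext i) (S.Ext i) ℝ) : Prop where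
  gamma_pos : 0 < γ
  Z_pos : ∀ i, ∀ j ∈ S.nbr i, (Z i j).PosDef
  R_nonneg : ∀ i, (R i).PosSemidef
  Rc_nonneg : ∀ i, (Rc i).PosSemidef
  X_pos : ∀ i, (X i).PosDef
  Xc_pos : ∀ i, (Xc i).PosDef
  E_pos : ∀ i t, 0 ≤ t → (S.bE Z i t).PosDef
  lmi_pos : (S.lmi Z γ R).PosDef
  lmi_pos' : ∀ i, (Rc i - (S.Υ i)ᵀ * S.Υ i).PosDef
  riccati : ∀ i, SolvesMat (Y i) (Matrix.fromBlocks (X i) 0 0 (Xc i)) fun t =>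
    S.bA i t * Y i t + Y i t * (S.bA i t)ᵀ
      - Y i t * ((S.bC i t)ᵀ * (S.bE Z i t)⁻¹ * S.bC i t
          - (1 / γ ^ 2) • Matrix.fromBlocks (R i) 0 0 (Rc i)) * Y i t
      + S.bB i t * (S.bB i t)ᵀ
  bounded : ∀ i, UniformlyPosDef (Y i)

/-- LMI and Riccati conditions for the controlled observers. -/
structure ObserverConditions (P : Matrix (Fin N × Fin n) (Fin N × Fin n) ℝ)
    (Z : S.EdgeWeights) (γ : ℝ)
    (R X : Fin N → Matrix (Fin n) (Fin n) ℝ)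
    (Y : Fin N → ℝ → Matrix (Fin n) (Fin n) ℝ) : Prop where
  gamma_pos : 0 < γ
  Z_pos : ∀ i, ∀ j ∈ S.nbr i, (Z i j).PosDef
  R_nonneg : ∀ i, (R i).PosSemidef
  X_pos : ∀ i, (X i).PosDef
  E_pos : ∀ i t, 0 ≤ t → (S.bE Z i t).PosDef
  lmi_pos : (S.lmi Z γ R - P).PosDef
  riccati : ∀ i, SolvesMat (Y i) (X i) fun t =>
    S.A t * Y i t + Y i t * (S.A t)ᵀ
      - Y i t * ((S.bC1 i t)ᵀ * (S.bE Z i t)⁻¹ * S.bC1 i t - (1 / γ ^ 2) • R i) * Y i t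
      + S.bB1 i t * (S.bB1 i t)ᵀ
  bounded : ∀ i, UniformlyPosDef (Y i)

/-! ### Gains, interconnected system -/

/-- Gains of the observers (`L, K`) and of the detectors (`barL, barK, checkL, checkK`). -/
structure Gains where
  L : ∀ i, ℝ → Matrix (Fin n) (Fin (S.p i)) ℝ
  K : ∀ i, ∀ j : S.nbr i, ℝ → Matrix (Fin n) (Fin (S.pc i j)) ℝ
  barL : ∀ i, ℝ → Matrix (Fin n) (Fin (S.p i)) ℝ
  barK : ∀ i, ∀ j : S.nbr i, ℝ → Matrix (Fin n) (Fin (S.pc i j)) ℝ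
  checkL : ∀ i, ℝ → Matrix (Fin (S.ne i)) (Fin (S.p i)) ℝ
  checkK : ∀ i, ∀ j : S.nbr i, ℝ → Matrix (Fin (S.ne i)) (Fin (S.pc i j)) ℝ

/-- `Y_i C_i' E_i⁻¹ = [L̂_i, K̂_{ij_1}, …; Ľ_i, Ǩ_{ij_1}, …]`. -/
def detectorGain (Z : S.EdgeWeights) (Y : ∀ i, ℝ → Matrix (S.Ext i) (S.Ext i) ℝ)
    (i : Fin N) (t : ℝ) : Matrix (S.Ext i) (S.Out i) ℝ :=
  Y i t * (S.bC i t)ᵀ * (S.bE Z i t)⁻¹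

/-- `Y_i C_{1,i}' E_i⁻¹ = [L_i, K_{ij_1}, …]`. -/
def observerGain (Z : S.EdgeWeights) (Y : Fin N → ℝ → Matrix (Fin n) (Fin n) ℝ)
    (i : Fin N) (t : ℝ) : Matrix (Fin n) (S.Out i) ℝ :=
  Y i t * (S.bC1 i t)ᵀ * (S.bE Z i t)⁻¹

/-- Gains obtained from the solutions `Y` (detectors) and `Yb` (observers) of the Riccati
equations: `L, K` and `Ľ, Ǩ` are blocks of the above matrices and `L̄ = L̂ - L`, `K̄ = K̂ - K`. -/
def designGains (Z Zb : S.EdgeWeights) (Y : ∀ i, ℝ → Matrix (S.Ext i) (S.Ext i) ℝ)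
    (Yb : Fin N → ℝ → Matrix (Fin n) (Fin n) ℝ) : S.Gains where
  L i t := Matrix.of fun a b => S.observerGain Zb Yb i t a (Sum.inl b)
  K i j t := Matrix.of fun a b => S.observerGain Zb Yb i t a (Sum.inr ⟨j, b⟩)
  barL i t := Matrix.of fun a b =>
    S.detectorGain Z Y i t (Sum.inl a) (Sum.inl b) - S.observerGain Zb Yb i t a (Sum.inl b)
  barK i j t := Matrix.of fun a b =>
    S.detectorGain Z Y i t (Sum.inl a) (Sum.inr ⟨j, b⟩)
      - S.observerGain Zb Yb i t a (Sum.inr ⟨j, b⟩)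
  checkL i t := Matrix.of fun a b => S.detectorGain Z Y i t (Sum.inr a) (Sum.inl b)
  checkK i j t := Matrix.of fun a b => S.detectorGain Z Y i t (Sum.inr a) (Sum.inr ⟨j, b⟩)

/-- External signals: plant disturbance `w`, measurement disturbances `v_i`, channel
disturbances `v_ij`, attack inputs `f_i`. -/
structure Inputs where
  w : ℝ → Fin m → ℝ
  v : ∀ i, ℝ → Fin (S.q i) → ℝ
  vc : ∀ i j, ℝ → Fin (S.qc i j) → ℝ
  f : ∀ i, ℝ → Fin (S.nf i) → ℝ

/-- State signals: plant state `x`, estimates `x̂_i`, detector states `ê_i`, `ε̂_i`, and the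
states `ε_i` of the attack models. -/
structure States where
  x : ℝ → Fin n → ℝ
  xhat : Fin N → ℝ → Fin n → ℝ
  ehat : Fin N → ℝ → Fin n → ℝ
  epshat : ∀ i, ℝ → Fin (S.ne i) → ℝ
  eps : ∀ i, ℝ → Fin (S.ne i) → ℝ

variable {S}

/-- Estimation error `e_i = x - x̂_i`. -/
def States.err (σ : S.States) (i : Fin N) (t : ℝ) : Fin n → ℝ := σ.x t - σ.xhat i t

/-- Stacked estimation error `e = [e_1' … e_N']'`. -/
def States.stackedErr (σ : S.States) (t : ℝ) : Fin N × Fin n → ℝ := fun a => σ.err a.1 t a.2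

/-- Detector output `φ_i = Υ_i ε̂_i`. -/
def States.φ (σ : S.States) (i : Fin N) (t : ℝ) : Fin (S.nf i) → ℝ := S.Υ i *ᵥ σ.epshat i t

/-- Mismatch `ν_i = f̂_i - f_i`, `f̂_i = Υ_i ε_i`, between the output of the attack model and the
attack. -/
def States.ν (σ : S.States) (u : S.Inputs) (i : Fin N) (t : ℝ) : Fin (S.nf i) → ℝ :=
  S.Υ i *ᵥ σ.eps i t - u.f i t

/-- Innovation `ζ_i = y_i - C_i x̂_i` with `y_i = C_i x + D_i v_i`. -/
def States.ζ (σ : S.States) (u : S.Inputs) (i : Fin N) (t : ℝ) : Fin (S.p i) → ℝ :=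
  (S.C i t *ᵥ σ.x t + S.D i t *ᵥ u.v i t) - S.C i t *ᵥ σ.xhat i t

/-- Innovation `ζ_ij = c_ij - W_ij x̂_i` with `c_ij = W_ij x̂_j + H_ij v_ij`. -/
def States.ζc (σ : S.States) (u : S.Inputs) (i j : Fin N) (t : ℝ) : Fin (S.pc i j) → ℝ :=
  (S.W i j *ᵥ σ.xhat j t + S.H i j *ᵥ u.vc i j t) - S.W i j *ᵥ σ.xhat i t

/-- The signals `σ` form a solution on `[0,∞)` of the plant, the controlled observers with
`u_i = -F_i φ_i`, the attack detectors and the attack models, for the external signals `u`, the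
gains `g`, and the initial conditions `x(0) = x₀`, `x̂_i(0) = ξ_i`, zero otherwise. -/
structure IsTrajectory (g : S.Gains) (u : S.Inputs) (x₀ : Fin n → ℝ) (ξ : Fin N → Fin n → ℝ)
    (σ : S.States) : Prop where
  plant : SolvesVec σ.x x₀ fun t => S.A t *ᵥ σ.x t + S.B t *ᵥ u.w t
  observer : ∀ i, SolvesVec (σ.xhat i) (ξ i) fun t =>
    S.A t *ᵥ σ.xhat i t + g.L i t *ᵥ σ.ζ u i t
      + ∑ j : S.nbr i, g.K i j t *ᵥ σ.ζc u i j t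
      + S.F i *ᵥ u.f i t - S.F i *ᵥ σ.φ i t
  detector : ∀ i, SolvesVec (σ.ehat i) 0 fun t =>
    (S.A t - g.L i t * S.C i t - ∑ j : S.nbr i, g.K i j t * S.W i j) *ᵥ σ.ehat i t
      + ∑ j : S.nbr i, (g.K i j t * S.W i j) *ᵥ σ.ehat j t
      + g.barL i t *ᵥ (σ.ζ u i t - S.C i t *ᵥ σ.ehat i t)
      + ∑ j : S.nbr i, g.barK i j t *ᵥ
          (σ.ζc u i j t - S.W i j *ᵥ (σ.ehat i t - σ.ehat j t))
  detector' : ∀ i, SolvesVec (σ.epshat i) 0 fun t =>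
    S.Ω i *ᵥ σ.epshat i t
      + g.checkL i t *ᵥ (σ.ζ u i t - S.C i t *ᵥ σ.ehat i t)
      + ∑ j : S.nbr i, g.checkK i j t *ᵥ
          (σ.ζc u i j t - S.W i j *ᵥ (σ.ehat i t - σ.ehat j t))
  attackModel : ∀ i, SolvesVec (σ.eps i) 0 fun t =>
    S.Ω i *ᵥ σ.eps i t + S.Γ i *ᵥ σ.ν u i t

/-- No disturbances and no attacks. -/
def Inputs.IsZero (u : S.Inputs) : Prop :=
  ∀ t, 0 ≤ t → u.w t = 0 ∧ (∀ i, u.v i t = 0) ∧ (∀ i, ∀ j ∈ S.nbr i, u.vc i j t = 0) ∧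
    ∀ i, u.f i t = 0

/-- `L₂` disturbances and admissible biasing attacks. -/
structure Inputs.IsAdmissible (u : S.Inputs) : Prop where
  w : IsL2 u.w
  v : ∀ i, IsL2 (u.v i)
  vc : ∀ i, ∀ j ∈ S.nbr i, IsL2 (u.vc i j)
  f : ∀ i, IsAdmissibleAttack (u.f i)

end Network

end

end ResilientObserver

namespace ResilientObserver

/-! ### Calculus of absolutely continuous functions on `[0,∞)` -/

/-! The theorem is a dissipation argument with the storage functions `V = ∑ᵢ zᵢ'Yᵢ⁻¹zᵢ` built from
the Riccati solutions. It is run once for the detector errors `(eᵢ - êᵢ, εᵢ - ε̂ᵢ)`, driven by `w`,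
`vᵢ`, `vᵢⱼ` and `νᵢ`, and once for the observer errors `eᵢ`, driven by the same disturbances and by
`φᵢ - fᵢ`. At a single node the Riccati equation cancels the drift, and completing squares absorbs
the disturbances (`riccati_dissipation`, `output_dissipation`). This leaves cross terms
`eᵢ'Wᵢⱼ'Uᵢⱼ⁻¹Wᵢⱼeⱼ` of indefinite sign between neighbours. Summed over all nodes they are part of
the quadratic form of `Φ + Φ' - Δ` (`lmi_quadForm`), so the matrix inequalities make the total
dissipation definite although no single node need be dissipative. The two error systems are linked
by `φᵢ - fᵢ = νᵢ - Υᵢ(εᵢ - ε̂ᵢ)`.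

For (i), `νᵢ = 0` and the detector storage decays exponentially, hence so does `φᵢ`. The observer
storage then satisfies `V' ≤ -sV` plus a decaying term, and Gronwall's inequality applies. For (ii),
the inequalities are integrated over `[0,∞)`: `Řᵢ > Υᵢ'Υᵢ` bounds `Υᵢ(εᵢ - ε̂ᵢ)` in `L₂`, the link
gives `φᵢ - fᵢ ∈ L₂`, and this signal enters the observer inequality as one more disturbance.

The other ingredient of (ii) is `νᵢ ∈ L₂` (`IsTrackerRealization.isL2_mismatch`). Subtracting from
`f₁` its low-pass response `y` leaves a signal with transform `s f₁(s)/(s+1)`, which Plancherel's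
theorem places in `L₂`. Hence `f = y + r` with `y'` and `r` in `L₂`. The tracking loop is stable and
contains an integrator, so it follows such a `y` with an `L₂` error. Its stability is given for a
realization that need not be minimal, and is transferred to `(Ω, Γ, Υ)` through the Markov
parameters (`closedLoop_of_markov_eq`).

Coefficients and inputs are not assumed continuous, so all trajectories and Riccati solutions are
merely absolutely continuous, and derivatives are used almost everywhere. -/

/-- `y` is absolutely continuous on every interval `[0,T]`. -/
def IsLocallyAC (y : ℝ → ℝ) : Prop := ∀ T : ℝ, 0 ≤ T → AbsolutelyContinuousOnInterval y 0 T

/-- Solutions are prescribed only for `t ≥ 0`, so functions have to be exchanged when they agree on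
the interval alone. -/
theorem _root_.AbsolutelyContinuousOnInterval.congr_on {f g : ℝ → ℝ} {a b : ℝ}
    (hf : AbsolutelyContinuousOnInterval f a b) (h : ∀ x ∈ uIcc a b, f x = g x) :
    AbsolutelyContinuousOnInterval g a b := by
  rw [absolutelyContinuousOnInterval_iff] at hf ⊢
  intro ε hε
  obtain ⟨δ, hδ, H⟩ := hf ε hε
  refine ⟨δ, hδ, fun E hE hl => ?_⟩
  have := H E hE hl
  refine lt_of_eq_of_lt (Finset.sum_congr rfl fun i hi => ?_) this
  rw [h _ (hE.1 i hi).1, h _ (hE.1 i hi).2]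

theorem _root_.AbsolutelyContinuousOnInterval.of_dist_le {f g : ℝ → ℝ} {a b C : ℝ}
    (hf : AbsolutelyContinuousOnInterval f a b)
    (h : ∀ s ∈ uIcc a b, ∀ t ∈ uIcc a b, dist (g s) (g t) ≤ C * dist (f s) (f t)) :
    AbsolutelyContinuousOnInterval g a b := by
  refine squeeze_zero' (Filter.Eventually.of_forall fun _ => Finset.sum_nonneg fun _ _ =>
    dist_nonneg) ?_ (by simpa using Filter.Tendsto.const_mul C hf)
  rw [Filter.eventually_inf_principal]
  filter_upwards with E hE
  rw [Finset.mul_sum]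
  exact Finset.sum_le_sum fun i hi => h _ (hE.1 i hi).1 _ (hE.1 i hi).2

theorem Solves.initial {y g : ℝ → ℝ} {y₀ : ℝ} (h : Solves y y₀ g) : y 0 = y₀ := by
  simpa using (h 0 le_rfl).2

theorem Solves.isLocallyAC {y g : ℝ → ℝ} {y₀ : ℝ} (h : Solves y y₀ g) : IsLocallyAC y := by
  intro T hT
  have h1 := (h T hT).1.absolutelyContinuousOnInterval_intervalIntegral (c := 0) (by simp)
  have h2 : AbsolutelyContinuousOnInterval (fun _ : ℝ => y₀) 0 T :=
    ((LipschitzWith.const y₀).lipschitzOnWith).absolutelyContinuousOnInterval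
  refine (h2.add h1).congr_on fun x hx => ?_
  rw [uIcc_of_le hT] at hx
  rw [(h x hx.1).2]
  rfl

theorem ae_of_forall_Ioo_nat {p : ℝ → Prop} (h : ∀ k : ℕ, ∀ᵐ t, t ∈ Ioo (0 : ℝ) k → p t) :
    ∀ᵐ t, 0 < t → p t := by
  filter_upwards [ae_all_iff.2 h] with t ht h0
  obtain ⟨k, hk⟩ := exists_nat_gt t
  exact ht k ⟨h0, hk⟩

theorem Solves.ae_hasDerivAt {y g : ℝ → ℝ} {y₀ : ℝ} (h : Solves y y₀ g) :
    ∀ᵐ t, 0 < t → HasDerivAt y (g t) t := by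
  refine ae_of_forall_Ioo_nat fun k => ?_
  have hk : (0 : ℝ) ≤ k := Nat.cast_nonneg k
  filter_upwards [(h k hk).1.ae_hasDerivAt_integral] with t ht hmem
  have h1 := (ht (by rw [uIcc_of_le hk]; exact Ioo_subset_Icc_self hmem) 0 (by simp)).const_add y₀
  refine h1.congr_of_eventuallyEq ?_
  filter_upwards [lt_mem_nhds hmem.1] with x hx
  rw [(h x hx.le).2]

theorem IsLocallyAC.solves {y g : ℝ → ℝ} (h : IsLocallyAC y)
    (hd : ∀ᵐ t, 0 < t → HasDerivAt y (g t) t) : Solves y (y 0) g := by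
  intro T hT
  have hae : ∀ᵐ t, t ∈ uIoc 0 T → deriv y t = g t := by
    filter_upwards [hd] with t ht hmem
    rw [uIoc_of_le hT] at hmem
    exact (ht hmem.1).deriv
  refine ⟨(h T hT).intervalIntegrable_deriv.congr_ae ?_, ?_⟩
  · rw [Filter.EventuallyEq, ae_restrict_iff' measurableSet_uIoc]
    exact hae
  · rw [← intervalIntegral.integral_congr_ae hae, (h T hT).integral_deriv_eq_sub]
    ring

/-- `IsLocallyAC.solves` above and `Solves.ae_hasDerivAt` make `Solves` equivalent to absolute
continuity plus an almost everywhere derivative; product and inverse rules are then checked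
pointwise. -/
theorem isLocallyAC_const (c : ℝ) : IsLocallyAC fun _ => c := fun _ _ =>
  ((LipschitzWith.const c).lipschitzOnWith).absolutelyContinuousOnInterval

namespace IsLocallyAC

variable {f g : ℝ → ℝ}

theorem add (hf : IsLocallyAC f) (hg : IsLocallyAC g) : IsLocallyAC fun t => f t + g t :=
  fun T hT => (hf T hT).fun_add (hg T hT)

theorem mul (hf : IsLocallyAC f) (hg : IsLocallyAC g) : IsLocallyAC fun t => f t * g t :=
  fun T hT => (hf T hT).fun_mul (hg T hT)

theorem sum {ι : Type*} (s : Finset ι) {f : ι → ℝ → ℝ} (hf : ∀ i ∈ s, IsLocallyAC (f i)) :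
    IsLocallyAC fun t => ∑ i ∈ s, f i t := by
  classical
  induction s using Finset.induction_on with
  | empty => simpa using isLocallyAC_const 0
  | insert a s ha ih =>
    simp_rw [Finset.sum_insert ha]
    exact (hf _ (Finset.mem_insert_self _ _)).add
      (ih fun i hi => hf i (Finset.mem_insert_of_mem hi))

theorem prod {ι : Type*} (s : Finset ι) {f : ι → ℝ → ℝ} (hf : ∀ i ∈ s, IsLocallyAC (f i)) :
    IsLocallyAC fun t => ∏ i ∈ s, f i t := by
  classical
  induction s using Finset.induction_on with
  | empty => simpa using isLocallyAC_const 1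
  | insert a s ha ih =>
    simp_rw [Finset.prod_insert ha]
    exact (hf _ (Finset.mem_insert_self _ _)).mul
      (ih fun i hi => hf i (Finset.mem_insert_of_mem hi))

theorem continuousOn (hf : IsLocallyAC f) : ContinuousOn f (Ici 0) := by
  intro t ht
  have ht : (0 : ℝ) ≤ t := ht
  have h1 : ContinuousOn f (Icc 0 (t + 1)) := by
    have := (hf (t + 1) (by linarith)).continuousOn
    rwa [uIcc_of_le (by linarith)] at this
  refine (h1 t ⟨ht, by linarith⟩).mono_of_mem_nhdsWithin ?_
  rw [← Ici_inter_Iic]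
  exact Filter.inter_mem self_mem_nhdsWithin
    (mem_nhdsWithin_of_mem_nhds (Iic_mem_nhds (by linarith)))

theorem inv (hf : IsLocallyAC f) (h0 : ∀ t, 0 ≤ t → f t ≠ 0) : IsLocallyAC fun t => (f t)⁻¹ := by
  intro T hT
  have hc : ContinuousOn (fun t => (f t)⁻¹) (uIcc 0 T) := by
    refine (hf T hT).continuousOn.inv₀ fun t ht => h0 t ?_
    rw [uIcc_of_le hT] at ht
    exact ht.1
  obtain ⟨C, hC⟩ := isCompact_uIcc.exists_bound_of_continuousOn hc
  -- On the compact interval `|1/f| ≤ C`, and `1/f(s) - 1/f(t) = (f(t) - f(s))/(f(s)f(t))`.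
  refine (hf T hT).of_dist_le (C := C * C) fun s hs t ht => ?_
  have hs' : 0 ≤ s := by rw [uIcc_of_le hT] at hs; exact hs.1
  have ht' : 0 ≤ t := by rw [uIcc_of_le hT] at ht; exact ht.1
  have h1 : (f s)⁻¹ - (f t)⁻¹ = (f s)⁻¹ * (f t)⁻¹ * (f t - f s) := by
    field_simp [h0 s hs', h0 t ht']
  rw [Real.dist_eq, Real.dist_eq, h1, abs_mul, abs_mul, abs_sub_comm (f s)]
  gcongr
  · exact (abs_nonneg _).trans (hC s hs)
  · exact hC s hs
  · exact hC t ht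

end IsLocallyAC

namespace Solves

variable {y z g k : ℝ → ℝ} {y₀ z₀ : ℝ}

theorem congr (h : Solves y y₀ g) (hk : ∀ t, 0 ≤ t → g t = k t) : Solves y y₀ k := by
  intro t ht
  have h1 : ∀ s ∈ uIoc 0 t, g s = k s := fun s hs => by
    rw [uIoc_of_le ht] at hs
    exact hk s hs.1.le
  refine ⟨((h t ht).1.congr_ae (ae_restrict_of_forall_mem measurableSet_uIoc h1)), ?_⟩
  rw [(h t ht).2]
  congr 1
  exact intervalIntegral.integral_congr_ae (Filter.Eventually.of_forall h1)

theorem add (hy : Solves y y₀ g) (hz : Solves z z₀ k) :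
    Solves (fun t => y t + z t) (y₀ + z₀) fun t => g t + k t := fun t ht => by
  refine ⟨(hy t ht).1.add (hz t ht).1, ?_⟩
  beta_reduce
  rw [intervalIntegral.integral_add (hy t ht).1 (hz t ht).1, (hy t ht).2, (hz t ht).2]
  ring

theorem const_mul (c : ℝ) (hy : Solves y y₀ g) :
    Solves (fun t => c * y t) (c * y₀) fun t => c * g t := fun t ht => by
  refine ⟨(hy t ht).1.const_mul c, ?_⟩
  beta_reduce
  rw [intervalIntegral.integral_const_mul, (hy t ht).2]
  ring

theorem sub (hy : Solves y y₀ g) (hz : Solves z z₀ k) :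
    Solves (fun t => y t - z t) (y₀ - z₀) fun t => g t - k t := by
  simpa [sub_eq_add_neg] using hy.add (hz.const_mul (-1))

theorem sum {ι : Type*} (s : Finset ι) {y g : ι → ℝ → ℝ} {y₀ : ι → ℝ}
    (h : ∀ i ∈ s, Solves (y i) (y₀ i) (g i)) :
    Solves (fun t => ∑ i ∈ s, y i t) (∑ i ∈ s, y₀ i) fun t => ∑ i ∈ s, g i t := by
  classical
  induction s using Finset.induction_on with
  | empty => simp [Solves]
  | insert a s ha ih =>
    simp_rw [Finset.sum_insert ha]
    exact (h _ (Finset.mem_insert_self _ _)).add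
      (ih fun i hi => h i (Finset.mem_insert_of_mem hi))

theorem mul (hy : Solves y y₀ g) (hz : Solves z z₀ k) :
    Solves (fun t => y t * z t) (y₀ * z₀) fun t => g t * z t + y t * k t := by
  have h := (hy.isLocallyAC.mul hz.isLocallyAC).solves (g := fun t => g t * z t + y t * k t) (by
    filter_upwards [hy.ae_hasDerivAt, hz.ae_hasDerivAt] with t h1 h2 h0
    exact (h1 h0).mul (h2 h0))
  simpa [hy.initial, hz.initial] using h

theorem continuousOn (hy : Solves y y₀ g) : ContinuousOn y (Ici 0) := hy.isLocallyAC.continuousOn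

end Solves

/-! ### Vector and matrix differential equations -/

variable {ι κ : Type*}

theorem SolvesVec.sub {y z : ℝ → ι → ℝ} {g k : ℝ → ι → ℝ} {y₀ z₀ : ι → ℝ}
    (hy : SolvesVec y y₀ g) (hz : SolvesVec z z₀ k) :
    SolvesVec (fun t => y t - z t) (y₀ - z₀) fun t => g t - k t := fun a => (hy a).sub (hz a)

theorem SolvesVec.congr {y : ℝ → ι → ℝ} {g k : ℝ → ι → ℝ} {y₀ : ι → ℝ}
    (hy : SolvesVec y y₀ g) (h : ∀ t, 0 ≤ t → g t = k t) : SolvesVec y y₀ k :=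
  fun a => (hy a).congr fun t ht => congrFun (h t ht) a

theorem SolvesVec.initial {y : ℝ → ι → ℝ} {g : ℝ → ι → ℝ} {y₀ : ι → ℝ}
    (hy : SolvesVec y y₀ g) : y 0 = y₀ := funext fun a => (hy a).initial

theorem SolvesVec.mulVec [Fintype ι] (M : Matrix κ ι ℝ) {y g : ℝ → ι → ℝ} {y₀ : ι → ℝ}
    (hy : SolvesVec y y₀ g) :
    SolvesVec (fun t => M *ᵥ y t) (M *ᵥ y₀) fun t => M *ᵥ g t := fun a =>
  Solves.sum Finset.univ fun b _ => (hy b).const_mul (M a b)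

theorem SolvesVec.dotProduct [Fintype ι] {y z : ℝ → ι → ℝ} {g k : ℝ → ι → ℝ} {y₀ z₀ : ι → ℝ}
    (hy : SolvesVec y y₀ g) (hz : SolvesVec z z₀ k) :
    Solves (fun t => y t ⬝ᵥ z t) (y₀ ⬝ᵥ z₀) fun t => g t ⬝ᵥ z t + y t ⬝ᵥ k t := by
  have h := Solves.sum Finset.univ fun b _ => (hy b).mul (hz b)
  simp_rw [Finset.sum_add_distrib] at h
  exact h

theorem SolvesVec.continuousOn [Fintype ι] {y g : ℝ → ι → ℝ} {y₀ : ι → ℝ}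
    (hy : SolvesVec y y₀ g) : ContinuousOn y (Ici 0) :=
  continuousOn_pi.2 fun a => (hy a).continuousOn

theorem IsLocallyAC.det [Fintype ι] [DecidableEq ι] {Y : ℝ → Matrix ι ι ℝ}
    (h : ∀ a b, IsLocallyAC fun t => Y t a b) : IsLocallyAC fun t => (Y t).det := by
  simp_rw [Matrix.det_apply']
  exact IsLocallyAC.sum _ fun σ _ =>
    (isLocallyAC_const _).mul (IsLocallyAC.prod _ fun i _ => h _ _)

/-- Cramer's rule: an entry of the inverse is a quotient of determinants, each a polynomial in
entries of `Y` and constants. -/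
theorem IsLocallyAC.matrix_inv [Fintype ι] [DecidableEq ι] {Y : ℝ → Matrix ι ι ℝ}
    (h : ∀ a b, IsLocallyAC fun t => Y t a b) (hdet : ∀ t, 0 ≤ t → (Y t).det ≠ 0) (a b : ι) :
    IsLocallyAC fun t => (Y t)⁻¹ a b := by
  simp_rw [Matrix.inv_def, Matrix.smul_apply, Ring.inverse_eq_inv', smul_eq_mul,
    Matrix.adjugate_apply]
  refine ((IsLocallyAC.det h).inv hdet).mul (IsLocallyAC.det fun c d => ?_)
  by_cases hc : c = b
  · subst hc
    simpa using isLocallyAC_const _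
  · simpa [Matrix.updateRow_ne hc] using h c d

/-- Derivative of the quadratic form `z' Y⁻¹ z` along solutions of `dz/dt = g`, `dY/dt = k`. -/
theorem SolvesVec.quadForm_inv [Fintype ι] [DecidableEq ι] {z g : ℝ → ι → ℝ} {z₀ : ι → ℝ}
    {Y k : ℝ → Matrix ι ι ℝ} {Y₀ : Matrix ι ι ℝ} (hz : SolvesVec z z₀ g) (hY : SolvesMat Y Y₀ k)
    (hpos : ∀ t, 0 ≤ t → (Y t).PosDef) :
    Solves (fun t => z t ⬝ᵥ ((Y t)⁻¹ *ᵥ z t)) (z₀ ⬝ᵥ (Y₀⁻¹ *ᵥ z₀)) fun t =>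
      2 * (((Y t)⁻¹ *ᵥ z t) ⬝ᵥ g t)
        - ((Y t)⁻¹ *ᵥ z t) ⬝ᵥ (k t *ᵥ ((Y t)⁻¹ *ᵥ z t)) := by
  have hYac : ∀ a b, IsLocallyAC fun t => Y t a b := fun a b => (hY a b).isLocallyAC
  have hdet : ∀ t, 0 ≤ t → (Y t).det ≠ 0 := fun t ht => (hpos t ht).det_pos.ne'
  have hp : ∀ a, IsLocallyAC fun t => ((Y t)⁻¹ *ᵥ z t) a := fun a =>
    IsLocallyAC.sum _ fun b _ => (IsLocallyAC.matrix_inv hYac hdet a b).mul (hz b).isLocallyAC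
  set p : ℝ → ι → ℝ := fun t => (Y t)⁻¹ *ᵥ z t with hpdef
  have hpd : ∀ᵐ t, 0 < t → ∀ a, DifferentiableAt ℝ (fun s => p s a) t := by
    refine ae_of_forall_Ioo_nat fun n => ?_
    have := ae_all_iff.2 fun a => (hp a n (Nat.cast_nonneg n)).ae_differentiableAt
    filter_upwards [this] with t ht hmem a
    exact ht a (by rw [uIcc_of_le (Nat.cast_nonneg n)]; exact Ioo_subset_Icc_self hmem)
  have hpsol : SolvesVec p (p 0) fun t a => deriv (fun s => p s a) t := fun a =>
    (hp a).solves (by filter_upwards [hpd] with t ht h0 using (ht h0 a).hasDerivAt)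
  -- No formula for the derivative of `Y⁻¹` is needed: with `p = Y⁻¹z`, differentiating `z = Y p`
  -- gives `g = k p + Y p'`, which determines `Y p'`.
  have hzp : ∀ t, 0 ≤ t → z t = Y t *ᵥ p t := fun t ht => by
    simp only [hpdef, Matrix.mulVec_mulVec]
    rw [Matrix.mul_nonsing_inv _ (isUnit_iff_ne_zero.2 (hdet t ht)), Matrix.one_mulVec]
  have hYp : ∀ᵐ t, 0 < t → g t = k t *ᵥ p t + Y t *ᵥ fun a => deriv (fun s => p s a) t := by
    have h1 := ae_all_iff.2 fun a => (hz a).ae_hasDerivAt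
    have h2 := ae_all_iff.2 fun a => ae_all_iff.2 fun b => (hY a b).ae_hasDerivAt
    filter_upwards [hpd, h1, h2] with t hp' h1 h2 h0
    funext a
    have h3 : HasDerivAt (fun s => (Y s *ᵥ p s) a)
        (∑ b, (k t a b * p t b + Y t a b * deriv (fun s => p s b) t)) t := by
      refine HasDerivAt.fun_sum fun b _ => (h2 a b h0).mul (hp' h0 b).hasDerivAt
    have h4 := h3.unique ((h1 a h0).congr_of_eventuallyEq (f₁ := fun s => (Y s *ᵥ p s) a) (by
      filter_upwards [lt_mem_nhds h0] with s hs
      rw [hzp s (le_of_lt hs)]))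
    rw [← h4, Finset.sum_add_distrib]
    rfl
  -- `V = z'p` has derivative `g'p + z'p'`, and by symmetry of `Y`, `z'p' = p'(Y p')` with the first
  -- factor the transpose of `p`; the previous identity turns this into `p'(g - k p)`.
  have hV := hz.dotProduct hpsol
  have hV' := hV.isLocallyAC.solves (g := fun t => 2 * (p t ⬝ᵥ g t) - p t ⬝ᵥ (k t *ᵥ p t)) (by
    filter_upwards [hV.ae_hasDerivAt, hYp] with t h1 h2 h0
    convert h1 h0 using 1
    have hsym : (Y t)ᵀ = Y t := (hpos t h0.le).1
    have : z t ⬝ᵥ (fun a => deriv (fun s => p s a) t)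
        = p t ⬝ᵥ (Y t *ᵥ fun a => deriv (fun s => p s a) t) := by
      rw [Matrix.dotProduct_mulVec, ← Matrix.mulVec_transpose, hsym, hzp t h0.le]
    rw [this, dotProduct_comm (g t), h2 h0, dotProduct_add]
    ring)
  have h0 : Y 0 = Y₀ := by ext a b; exact (hY a b).initial
  simpa [hpdef, hz.initial, h0] using hV'

end ResilientObserver

namespace ResilientObserver

/-! ### Integral estimates -/

theorem Solves.le_initial {V g : ℝ → ℝ} {V₀ : ℝ} (h : Solves V V₀ g) (hg : ∀ t, 0 ≤ t → g t ≤ 0)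
    {T : ℝ} (hT : 0 ≤ T) : V T ≤ V₀ := by
  rw [(h T hT).2]
  have := intervalIntegral.integral_nonneg (f := fun t => -g t) (μ := volume) hT
    fun t ht => neg_nonneg.2 (hg t ht.1)
  rw [intervalIntegral.integral_neg] at this
  linarith

theorem solves_of_hasDerivAt {f f' : ℝ → ℝ} (h : ∀ t, HasDerivAt f (f' t) t)
    (hc : Continuous f') : Solves f (f 0) f' := fun t _ => by
  refine ⟨hc.intervalIntegrable _ _, ?_⟩
  rw [intervalIntegral.integral_eq_sub_of_hasDerivAt (fun x _ => h x) (hc.intervalIntegrable _ _)]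
  ring

theorem solves_exp (c : ℝ) :
    Solves (fun t => Real.exp (c * t)) 1 fun t => c * Real.exp (c * t) := by
  have h := solves_of_hasDerivAt (f := fun t => Real.exp (c * t))
    (f' := fun t => c * Real.exp (c * t)) (fun t => by
      have := ((hasDerivAt_id t).const_mul c).exp
      simpa [mul_comm] using this) (by fun_prop)
  simpa using h

/-- Gronwall's inequality with an exponentially decaying forcing term. -/
theorem Solves.gronwall {V g : ℝ → ℝ} {V₀ c a K : ℝ} (h : Solves V V₀ g) (hac : a < c)
    (hK : 0 ≤ K) (hV₀ : 0 ≤ V₀)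
    (hg : ∀ t, 0 ≤ t → g t ≤ -c * V t + K * Real.exp (-a * t)) {T : ℝ} (hT : 0 ≤ T) :
    V T ≤ (V₀ + K / (c - a)) * Real.exp (-a * T) := by
  have hca : 0 < c - a := sub_pos.2 hac
  -- The function `e^{ct}V - K/(c-a) e^{(c-a)t}` is nonincreasing. The sign of `c` plays no role,
  -- which `SolvesVec.eq_zero` exploits.
  have h1 := ((solves_exp c).mul h).sub ((solves_exp (c - a)).const_mul (K / (c - a)))
  have h2 := h1.le_initial (fun t ht => by
    have h3 := mul_le_mul_of_nonneg_left (hg t ht) (Real.exp_pos (c * t)).le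
    have h4 : Real.exp (c * t) * (K * Real.exp (-a * t))
        = K / (c - a) * ((c - a) * Real.exp ((c - a) * t)) := by
      have : Real.exp ((c - a) * t) = Real.exp (c * t) * Real.exp (-a * t) := by
        rw [← Real.exp_add]; ring_nf
      rw [this]; field_simp
    nlinarith) hT
  have h5 : Real.exp (c * T) = Real.exp ((c - a) * T) * Real.exp (a * T) := by
    rw [← Real.exp_add]; ring_nf
  have hneg : Real.exp (-a * T) * Real.exp (a * T) = 1 := by
    rw [← Real.exp_add]; simp
  have hD : 0 ≤ K / (c - a) := div_nonneg hK hca.le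
  have hE1 : 1 ≤ Real.exp ((c - a) * T) := Real.one_le_exp (by positivity)
  have h6 : Real.exp ((c - a) * T) * (V T * Real.exp (a * T))
      ≤ Real.exp ((c - a) * T) * (V₀ + K / (c - a)) := by
    rw [h5] at h2
    nlinarith
  have h7 := le_of_mul_le_mul_left h6 (Real.exp_pos _)
  calc V T = V T * Real.exp (a * T) * Real.exp (-a * T) := by
        rw [mul_assoc, mul_comm (Real.exp (a * T)), hneg, mul_one]
    _ ≤ _ := mul_le_mul_of_nonneg_right h7 (Real.exp_pos _).le

/-- Integration of a dissipation inequality `dV/dt ≤ h - q`. -/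
theorem Solves.dissipation {V g q h : ℝ → ℝ} {V₀ : ℝ} (hV : Solves V V₀ g)
    (hVpos : ∀ t, 0 ≤ t → 0 ≤ V t) (hq : ContinuousOn q (Ici 0)) (hq0 : ∀ t, 0 ≤ t → 0 ≤ q t)
    (hh : IntegrableOn h (Ici 0)) (hg : ∀ t, 0 ≤ t → g t ≤ h t - q t) :
    IntegrableOn q (Ici 0) ∧ ∫ t in Ici (0 : ℝ), q t ≤ V₀ + ∫ t in Ici (0 : ℝ), h t := by
  have hqi : ∀ T, 0 ≤ T → IntervalIntegrable q volume 0 T := fun T hT => by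
    refine (hq.mono ?_).intervalIntegrable
    rw [uIcc_of_le hT]
    exact Icc_subset_Ici_self
  have hhi : ∀ T, 0 ≤ T → IntervalIntegrable h volume 0 T := fun T hT => by
    rw [intervalIntegrable_iff_integrableOn_Ioc_of_le hT]
    exact hh.mono_set fun x hx => hx.1.le
  have hle : ∀ T, 0 ≤ T → ∫ t in (0 : ℝ)..T, q t ≤ V₀ + ∫ t in (0 : ℝ)..T, h t := fun T hT => by
    have h1 : ∫ t in (0 : ℝ)..T, g t ≤ ∫ t in (0 : ℝ)..T, (h t - q t) :=
      intervalIntegral.integral_mono_on hT (hV T hT).1 ((hhi T hT).sub (hqi T hT))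
        fun t ht => hg t ht.1
    rw [intervalIntegral.integral_sub (hhi T hT) (hqi T hT)] at h1
    have := hVpos T hT
    rw [(hV T hT).2] at this
    linarith
  have htend : Filter.Tendsto (fun T => V₀ + ∫ t in (0 : ℝ)..T, h t) Filter.atTop
      (nhds (V₀ + ∫ t in Ici (0 : ℝ), h t)) := by
    rw [integral_Ici_eq_integral_Ioi]
    exact (intervalIntegral_tendsto_integral_Ioi 0 (hh.mono_set Ioi_subset_Ici_self)
      Filter.tendsto_id).const_add _
  -- Since `V ≥ 0`, the partial integrals of `q` are at most `V₀ + ∫|h|`. As `q ≥ 0`, boundedness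
  -- already yields integrability; the sharp bound follows by passing to the limit.
  obtain ⟨B, hB⟩ : ∃ B, ∀ T, 0 ≤ T → ∫ t in (0 : ℝ)..T, q t ≤ B := by
    refine ⟨V₀ + ∫ t in Ici (0 : ℝ), |h t|, fun T hT => (hle T hT).trans ?_⟩
    gcongr
    rw [intervalIntegral.integral_of_le hT]
    refine (setIntegral_mono_on (hh.mono_set fun x hx => hx.1.le)
      (IntegrableOn.mono_set (t := Ici 0) hh.norm fun x hx => hx.1.le) measurableSet_Ioc fun t _ => le_abs_self _).trans ?_
    exact setIntegral_mono_set hh.norm (Filter.Eventually.of_forall fun _ => abs_nonneg _)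
      (Filter.Eventually.of_forall fun x hx => hx.1.le)
  have hint : IntegrableOn q (Ioi 0) := by
    refine integrableOn_Ioi_of_intervalIntegral_norm_bounded (b := fun T : ℝ => T) B 0
      (fun T => ?_) Filter.tendsto_id ?_
    · refine (hq.mono fun x hx => ?_).integrableOn_Icc.mono_set (t := Icc 0 T) Ioc_subset_Icc_self
      exact hx.1
    · filter_upwards [Filter.eventually_ge_atTop 0] with T hT
      refine le_trans (le_of_eq (intervalIntegral.integral_congr fun t ht => ?_)) (hB T hT)
      rw [uIcc_of_le hT] at ht
      exact Real.norm_of_nonneg (hq0 t ht.1)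
  refine ⟨(integrableOn_Ici_iff_integrableOn_Ioi).2 hint, ?_⟩
  rw [integral_Ici_eq_integral_Ioi]
  refine le_of_tendsto_of_tendsto
    (intervalIntegral_tendsto_integral_Ioi 0 hint Filter.tendsto_id) htend ?_
  filter_upwards [Filter.eventually_ge_atTop 0] with T hT using hle T hT

/-! ### Square integrable signals -/

theorem isL2_iff {ι : Type*} [Fintype ι] {u : ℝ → ι → ℝ} :
    IsL2 u ↔ ∀ a, MemLp (fun t => u t a) 2 (volume.restrict (Ici (0 : ℝ))) := by
  constructor
  · rintro ⟨h1, h2⟩ a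
    have hm : ∀ b, AEStronglyMeasurable (fun t => u t b) (volume.restrict (Ici (0 : ℝ))) :=
      fun b => (continuous_apply b).comp_aestronglyMeasurable h1
    rw [memLp_two_iff_integrable_sq (hm a)]
    refine Integrable.mono h2 ((hm a).pow 2) (Filter.Eventually.of_forall fun t => ?_)
    have h3 : 0 ≤ u t ⬝ᵥ u t := Finset.sum_nonneg fun i _ => mul_self_nonneg _
    rw [Real.norm_of_nonneg (sq_nonneg _), Real.norm_of_nonneg h3, sq]
    exact Finset.single_le_sum (f := fun i => u t i * u t i) (fun i _ => mul_self_nonneg _)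
      (Finset.mem_univ a)
  · intro h
    refine ⟨(aemeasurable_pi_lambda _ fun a => (h a).1.aemeasurable).aestronglyMeasurable, ?_⟩
    refine integrable_finsetSum _ fun a _ => ?_
    simpa [sq] using (h a).integrable_sq

namespace IsL2

variable {ι κ : Type*} [Fintype ι] [Fintype κ] {u v : ℝ → ι → ℝ}

theorem congr (hu : IsL2 u) (h : ∀ t, 0 ≤ t → u t = v t) : IsL2 v := by
  have h1 : u =ᵐ[volume.restrict (Ici (0 : ℝ))] v :=
    ae_restrict_of_forall_mem measurableSet_Ici h
  exact ⟨hu.1.congr h1, hu.2.congr_fun_ae (h1.mono fun t ht => by simp only [ht])⟩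

theorem add (hu : IsL2 u) (hv : IsL2 v) : IsL2 fun t => u t + v t :=
  isL2_iff.2 fun a => (isL2_iff.1 hu a).add (isL2_iff.1 hv a)

theorem sub (hu : IsL2 u) (hv : IsL2 v) : IsL2 fun t => u t - v t :=
  isL2_iff.2 fun a => (isL2_iff.1 hu a).sub (isL2_iff.1 hv a)

theorem mulVec (M : Matrix κ ι ℝ) (hu : IsL2 u) : IsL2 fun t => M *ᵥ u t :=
  isL2_iff.2 fun a => memLp_finsetSum _ fun b _ => (isL2_iff.1 hu b).const_mul (M a b)

end IsL2

/-! ### Exponentially stable linear systems -/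

/-- Complex-valued version of `Solves`. -/
def CSolves (z g : ℝ → ℂ) : Prop :=
  Solves (fun t => (z t).re) (z 0).re (fun t => (g t).re) ∧
    Solves (fun t => (z t).im) (z 0).im (fun t => (g t).im)

namespace CSolves

variable {z g k : ℝ → ℂ}

theorem const_mul (c : ℂ) (hz : CSolves z g) : CSolves (fun t => c * z t) fun t => c * g t := by
  constructor
  · simpa using (hz.1.const_mul c.re).sub (hz.2.const_mul c.im)
  · simpa using (hz.2.const_mul c.re).add (hz.1.const_mul c.im)

theorem sum {ι : Type*} (s : Finset ι) {z g : ι → ℝ → ℂ} (h : ∀ i ∈ s, CSolves (z i) (g i)) :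
    CSolves (fun t => ∑ i ∈ s, z i t) fun t => ∑ i ∈ s, g i t := by
  constructor
  · simpa using Solves.sum s fun i hi => (h i hi).1
  · simpa using Solves.sum s fun i hi => (h i hi).2

theorem congr (hz : CSolves z g) (h : ∀ t, 0 ≤ t → g t = k t) : CSolves z k :=
  ⟨hz.1.congr fun t ht => by rw [h t ht], hz.2.congr fun t ht => by rw [h t ht]⟩

/-- Young's inequality gives `d|z|²/dt ≤ Re λ |z|² + |r|²/(-Re λ)`, half of the damping being spent
on the cross term; integration over `[0,∞)` concludes. -/
theorem memLp_of_re_neg {lam : ℂ} {r : ℝ → ℂ} (hlam : lam.re < 0)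
    (hz : CSolves z fun t => lam * z t + r t)
    (hr : MemLp r 2 (volume.restrict (Ici (0 : ℝ)))) :
    MemLp z 2 (volume.restrict (Ici (0 : ℝ))) := by
  have hV := (hz.1.mul hz.1).add (hz.2.mul hz.2)
  have hzc : ContinuousOn z (Ici 0) := by
    have := (Complex.continuous_ofReal.comp_continuousOn hz.1.continuousOn).add
      ((Complex.continuous_ofReal.comp_continuousOn hz.2.continuousOn).mul
        (continuousOn_const (c := Complex.I)))
    exact this.congr fun t _ => (Complex.re_add_im (z t)).symm
  have hd := hV.dissipation (q := fun t => -lam.re * ‖z t‖ ^ 2)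
    (h := fun t => 1 / (-lam.re) * ‖r t‖ ^ 2) (fun t _ => add_nonneg (mul_self_nonneg _) (mul_self_nonneg _))
    (continuousOn_const.mul (hzc.norm.pow 2))
    (fun t _ => mul_nonneg (by linarith) (sq_nonneg _))
    ((hr.integrable_norm_pow (p := 2) (by norm_num)).const_mul (1 / (-lam.re))) (fun t _ => by
      have h1 : ∀ x y : ℝ, 2 * (x * y) ≤ -lam.re * x ^ 2 + 1 / (-lam.re) * y ^ 2 := fun x y => by
        have hp : 0 < -lam.re := by linarith
        have h2 : -lam.re * x ^ 2 + 1 / (-lam.re) * y ^ 2 - 2 * (x * y)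
            = 1 / (-lam.re) * (-lam.re * x - y) ^ 2 := by
          have hne : lam.re ≠ 0 := hlam.ne
          field_simp
          ring
        have : 0 ≤ 1 / (-lam.re) * (-lam.re * x - y) ^ 2 := by positivity
        linarith
      have h3 := h1 (z t).re (r t).re
      have h4 := h1 (z t).im (r t).im
      simp only [← Complex.normSq_eq_norm_sq, Complex.normSq_apply, Complex.add_re,
        Complex.add_im, Complex.mul_re, Complex.mul_im] at *
      nlinarith)
  refine (memLp_two_iff_integrable_sq_norm
    (hzc.aestronglyMeasurable measurableSet_Ici)).2 ?_
  have := hd.1.const_mul (1 / (-lam.re))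
  refine this.congr (Filter.Eventually.of_forall fun t => ?_)
  have : lam.re ≠ 0 := hlam.ne
  field_simp

end CSolves

/-- The linear factors are peeled off one at a time, which avoids matrix exponentials and Jordan
forms. With `Q = M - z`, the signal `Q e` solves the same equation with input `Q u` and is
annihilated by the shorter product, so it is in `L₂`. Then `e' = z e + (Q e + u)` decouples into
scalar stable equations with `L₂` input. -/
theorem memLp_of_aeval_prod_eq_zero {ι : Type*} [Fintype ι] [DecidableEq ι] (M : Matrix ι ι ℂ)
    (l : List ℂ) (hl : ∀ z ∈ l, z.re < 0) (e u : ℝ → ι → ℂ)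
    (he : ∀ a, CSolves (fun t => e t a) fun t => (M *ᵥ e t + u t) a)
    (hu : ∀ a, MemLp (fun t => u t a) 2 (volume.restrict (Ici (0 : ℝ))))
    (h0 : ∀ t, 0 ≤ t →
      Polynomial.aeval M (l.map fun z => Polynomial.X - Polynomial.C z).prod *ᵥ e t = 0) (a : ι) :
    MemLp (fun t => e t a) 2 (volume.restrict (Ici (0 : ℝ))) := by
  induction l generalizing e u a with
  | nil =>
    refine (MemLp.zero (ε := ℂ)).ae_eq (ae_restrict_of_forall_mem measurableSet_Ici fun t ht => ?_)
    have := congrFun (h0 t ht) a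
    simpa using this.symm
  | cons z l ih =>
    set Q : Matrix ι ι ℂ := M - z • 1 with hQ
    have hQx : ∀ x : ι → ℂ, Q *ᵥ x = M *ᵥ x - z • x := fun x => by
      rw [hQ, Matrix.sub_mulVec, Matrix.smul_mulVec, Matrix.one_mulVec]
    have hQM : Q * M = M * Q := by simp [hQ, sub_mul, mul_sub]
    have haev : Polynomial.aeval M (Polynomial.X - Polynomial.C z) = Q := by
      simp [hQ, Algebra.algebraMap_eq_smul_one]
    have h1 : ∀ b, MemLp (fun t => (Q *ᵥ e t) b) 2 (volume.restrict (Ici (0 : ℝ))) := by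
      refine ih (fun w hw => hl w (List.mem_cons_of_mem _ hw)) (fun t => Q *ᵥ e t)
        (fun t => Q *ᵥ u t) (fun b => ?_) (fun b => ?_) (fun t ht => ?_)
      · refine (CSolves.sum Finset.univ fun c _ => (he c).const_mul (Q b c)).congr fun t _ => ?_
        change (Q *ᵥ (M *ᵥ e t + u t)) b = _
        rw [Matrix.mulVec_add, Matrix.mulVec_mulVec, Matrix.mulVec_mulVec, hQM]
      · exact memLp_finsetSum _ fun c _ => (hu c).const_mul (Q b c)
      · have := h0 t ht
        rw [List.map_cons, List.prod_cons, mul_comm, map_mul, haev, ← Matrix.mulVec_mulVec] at this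
        exact this
    refine CSolves.memLp_of_re_neg (lam := z) (r := fun t => (Q *ᵥ e t) a + u t a)
      (hl z List.mem_cons_self) ((he a).congr fun t _ => ?_) ((h1 a).add (hu a))
    rw [hQx]
    simp only [Pi.add_apply, Pi.sub_apply, Pi.smul_apply, smul_eq_mul]
    ring

/-- If a monic polynomial with all complex roots in the open left half-plane annihilates `M`, then
the states of `de/dt = M e + u` with `u ∈ L₂` are in `L₂`. -/
theorem SolvesVec.isL2_of_aeval_eq_zero {ι : Type*} [Fintype ι] [DecidableEq ι]
    {M : Matrix ι ι ℝ} {p : Polynomial ℝ} (hp : p.Monic)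
    (hroots : ∀ z : ℂ, Polynomial.aeval z p = 0 → z.re < 0) (hM : Polynomial.aeval M p = 0)
    {e u : ℝ → ι → ℝ} {e₀ : ι → ℝ} (he : SolvesVec e e₀ fun t => M *ᵥ e t + u t) (hu : IsL2 u) :
    IsL2 e := by
  rw [isL2_iff] at hu ⊢
  intro a
  set q := p.map (algebraMap ℝ ℂ) with hq
  have hqm : q.Monic := hp.map _
  -- Over `ℂ` the polynomial splits; its roots with multiplicity form the list of factors to be
  -- peeled off.
  have hprod : q = (q.roots.toList.map fun z => Polynomial.X - Polynomial.C z).prod := by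
    conv_lhs => rw [(IsAlgClosed.splits q).eq_prod_roots_of_monic hqm]
    conv_lhs => rw [← Multiset.coe_toList q.roots]
    rw [Multiset.map_coe, Multiset.prod_coe]
  have hMq : Polynomial.aeval (M.map (algebraMap ℝ ℂ)) q = 0 := by
    have h2 : Polynomial.aeval (M.map (algebraMap ℝ ℂ)) p = 0 := by
      have := Polynomial.aeval_algHom_apply ((Algebra.ofId ℝ ℂ).mapMatrix (m := ι)) M p
      rw [hM, map_zero] at this
      exact this
    rw [hq, Polynomial.aeval_map_algebraMap, h2]
  have key := memLp_of_aeval_prod_eq_zero (M.map (algebraMap ℝ ℂ)) q.roots.toList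
    (fun z hz => hroots z (by
      rw [Multiset.mem_toList, Polynomial.mem_roots hqm.ne_zero, Polynomial.IsRoot.def,
        hq, Polynomial.eval_map_algebraMap] at hz
      exact hz))
    (fun t b => (e t b : ℂ)) (fun t b => (u t b : ℂ)) (fun b => ?_)
    (fun b => (hu b).ofReal) (fun t _ => ?_) a
  · simpa using key.re
  · have h3 : ∀ t, ((M.map (algebraMap ℝ ℂ) *ᵥ fun b => (e t b : ℂ)) + fun b => (u t b : ℂ)) b
        = (((M *ᵥ e t + u t) b : ℝ) : ℂ) := fun t => by
      change ∑ c, ((M b c : ℝ) : ℂ) * (e t c : ℂ) + (u t b : ℂ)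
        = ((∑ c, M b c * e t c + u t b : ℝ) : ℂ)
      push_cast
      rfl
    constructor
    · simp only [h3, Complex.ofReal_re, (he b).initial]
      exact he b
    · simp only [Complex.ofReal_im]
      refine Solves.congr (g := fun _ => 0) (fun t _ => by simp) fun t _ => ?_
      have := h3 t
      simp only [Complex.coe_algebraMap, Pi.add_apply] at this ⊢
      rw [this, Complex.ofReal_im]
  · rw [← hprod, hMq, Matrix.zero_mulVec]

end ResilientObserver

namespace ResilientObserver

/-! ### Signals with bounded `s f(s)` -/

open scoped FourierTransform SchwartzMap in
/-- Plancherel's theorem for an integrable function whose Fourier transform is in `L₂`. -/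
theorem memLp_two_of_fourier {k : ℝ → ℂ} (hk : Integrable k) (hF : MemLp (𝓕 k) 2) :
    MemLp k 2 ∧ eLpNorm k 2 = eLpNorm (𝓕 k) 2 := by
  set Gh : Lp ℂ 2 (volume : Measure ℝ) := hF.toLp (𝓕 k) with hGh
  set g : Lp ℂ 2 (volume : Measure ℝ) := 𝓕⁻ Gh with hg
  have hFg : 𝓕 g = Gh := FourierTransform.fourier_fourierInv_eq Gh
  have hnorm : ‖g‖ = ‖Gh‖ := by rw [← hFg, Lp.norm_fourier_eq]
  -- The `L₂` function `g` with transform `𝓕 k` is identified with `k` by testing against smooth `ψ`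
  -- of compact support: with `φ = 𝓕⁻ψ`, both `∫ ψ g` and `∫ ψ k` equal `∫ φ 𝓕k`, the first by
  -- duality for tempered distributions and the second by Fubini for integrable functions.
  have hkg : ∀ᵐ x, k x = g x := by
    refine ae_eq_of_integral_contDiff_smul_eq hk.locallyIntegrable
      ((Lp.memLp g).locallyIntegrable (by norm_num)) fun ψ hψ1 hψ2 => ?_
    have h1 : HasCompactSupport (Complex.ofRealCLM ∘ ψ) := hψ2.comp_left rfl
    have h2 : ContDiff ℝ ((⊤ : ℕ∞) : WithTop ℕ∞) (Complex.ofRealCLM ∘ ψ) := by fun_prop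
    set Ψ : 𝓢(ℝ, ℂ) := h1.toSchwartzMap h2 with hΨ
    set φ : 𝓢(ℝ, ℂ) := 𝓕⁻ Ψ with hφ
    have hφΨ : 𝓕 φ = Ψ := FourierTransform.fourier_fourierInv_eq Ψ
    have hval : ∀ x, Ψ x = (ψ x : ℂ) := fun x => rfl
    have e1 : ∫ x, ψ x • g x = ∫ x, φ x • Gh x := by
      have h3 := congrArg (fun D => D φ) (Lp.fourier_toTemperedDistribution_eq g)
      simp only [TemperedDistribution.fourier_apply, hφΨ, hFg,
        Lp.toTemperedDistribution_apply] at h3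
      rw [← h3]
      simp only [hval, Complex.real_smul, smul_eq_mul]
    have e2 : ∫ x, φ x • Gh x = ∫ x, 𝓕 k x * φ x := by
      refine integral_congr_ae ?_
      filter_upwards [hF.coeFn_toLp] with x hx
      rw [hGh, hx, smul_eq_mul, mul_comm]
    have e3 : ∫ x, 𝓕 k x * φ x = ∫ x, k x * 𝓕 (φ : ℝ → ℂ) x := by
      have := VectorFourier.integral_fourierIntegral_smul_eq_flip (L := innerₗ ℝ)
        (μ := (volume : Measure ℝ)) (ν := (volume : Measure ℝ)) (f := k) (g := (φ : ℝ → ℂ))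
        Real.continuous_fourierChar continuous_inner hk φ.integrable
      rw [flip_innerₗ] at this
      exact this
    rw [e1, e2, e3, ← SchwartzMap.fourier_coe, hφΨ]
    refine integral_congr_ae (Filter.Eventually.of_forall fun x => ?_)
    simp only [hval, Complex.real_smul, mul_comm]
  have hm : MemLp k 2 := (memLp_congr_ae hkg).2 (Lp.memLp g)
  refine ⟨hm, ?_⟩
  rw [eLpNorm_congr_ae hkg, ← Lp.enorm_def, ← eLpNorm_congr_ae hF.coeFn_toLp, ← Lp.enorm_def,
    ← ofReal_norm, ← ofReal_norm, hnorm]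

/-- The signal `e^{-σt} f(t)`, extended by zero to negative times. -/
noncomputable def dampedSignal (σ : ℝ) (f : ℝ → ℝ) : ℝ → ℂ :=
  (Ici (0 : ℝ)).indicator fun t => ((Real.exp (-σ * t) * f t : ℝ) : ℂ)

theorem integrable_dampedSignal {σ : ℝ} {f : ℝ → ℝ}
    (hf : IntegrableOn (fun t => Real.exp (-σ * t) * f t) (Ici 0)) :
    Integrable (dampedSignal σ f) :=
  (integrable_indicator_iff measurableSet_Ici).2 hf.ofReal

open scoped FourierTransform in
theorem fourier_dampedSignal (σ : ℝ) (f : ℝ → ℝ) (ξ : ℝ) :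
    𝓕 (dampedSignal σ f) ξ = laplace f (σ + 2 * Real.pi * ξ * Complex.I) := by
  rw [Real.fourier_real_eq_integral_exp_smul, laplace, ← integral_indicator measurableSet_Ici]
  congr 1
  funext t
  by_cases ht : t ∈ Ici (0 : ℝ)
  · simp only [dampedSignal, indicator_of_mem ht, smul_eq_mul]
    push_cast
    rw [← mul_assoc, ← Complex.exp_add]
    congr 2
    ring
  · simp [dampedSignal, indicator_of_notMem ht]

theorem laplace_exp_neg {s : ℂ} (hs : 0 < s.re) :
    laplace (fun t => Real.exp (-t)) s = (s + 1)⁻¹ := by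
  rw [laplace, integral_Ici_eq_integral_Ioi]
  have h := integral_exp_mul_complex_Ioi (a := -(s + 1)) (by simp; linarith) 0
  have h2 : ∀ t : ℝ, Complex.exp (-s * t) * ((Real.exp (-t) : ℝ) : ℂ)
      = Complex.exp (-(s + 1) * t) := fun t => by
    push_cast
    rw [← Complex.exp_add]
    congr 1
    ring
  simp_rw [h2, h]
  rw [Complex.ofReal_zero, mul_zero, Complex.exp_zero, neg_div_neg_eq, one_div]

/-- The response `∫₀ᵗ e^{-(t-τ)} f(τ) dτ` of the low-pass filter `dy/dt = -y + f`, `y(0) = 0`. -/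
noncomputable def lowPass (f : ℝ → ℝ) (t : ℝ) : ℝ :=
  Real.exp (-t) * ∫ τ in (0 : ℝ)..t, Real.exp τ * f τ

theorem intervalIntegrable_of_damped {σ : ℝ} {f : ℝ → ℝ}
    (hf : IntegrableOn (fun t => Real.exp (-σ * t) * f t) (Ici 0)) {T : ℝ} (hT : 0 ≤ T) :
    IntervalIntegrable f volume 0 T := by
  have h1 : IntervalIntegrable (fun t => Real.exp (-σ * t) * f t) volume 0 T := by
    rw [intervalIntegrable_iff_integrableOn_Ioc_of_le hT]
    exact hf.mono_set fun x hx => hx.1.le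
  have h2 := h1.continuousOn_mul (f := fun t => Real.exp (-σ * t) * f t)
    (g := fun t => Real.exp (σ * t)) (by fun_prop)
  refine h2.congr fun t _ => ?_
  change Real.exp (σ * t) * (Real.exp (-σ * t) * f t) = f t
  rw [← mul_assoc, ← Real.exp_add]
  simp

theorem solves_lowPass {f : ℝ → ℝ} (hf : ∀ T, 0 ≤ T → IntervalIntegrable f volume 0 T) :
    Solves (lowPass f) 0 fun t => f t - lowPass f t := by
  have h1 : Solves (fun t => ∫ τ in (0 : ℝ)..t, Real.exp τ * f τ) 0 fun t => Real.exp t * f t :=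
    fun T hT => ⟨(hf T hT).continuousOn_mul (by fun_prop), by simp⟩
  have h2 := ((solves_exp (-1)).mul h1).congr (k := fun t => f t - lowPass f t) fun t _ => by
    have : Real.exp (-1 * t) * Real.exp t = 1 := by rw [← Real.exp_add]; simp
    rw [← mul_assoc, this, lowPass]
    ring_nf
  have h3 : lowPass f = fun t => Real.exp (-1 * t) * ∫ τ in (0 : ℝ)..t, Real.exp τ * f τ := by
    funext t
    rw [lowPass, neg_one_mul]
  rw [mul_zero, ← h3] at h2
  exact h2

open scoped Convolution in
-- Multiplication by `e^{-σt}` commutes with convolution because `e^{-στ}e^{-σ(t-τ)} = e^{-σt}`.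
-- Both factors vanish for negative times, so the convolution reduces to an integral over `[0,t]`.
theorem dampedSignal_convolution (σ : ℝ) (f : ℝ → ℝ) :
    (dampedSignal σ f ⋆[ContinuousLinearMap.mul ℂ ℂ, volume]
      dampedSignal σ fun t => Real.exp (-t)) = dampedSignal σ (lowPass f) := by
  funext t
  rw [convolution_def]
  by_cases ht : 0 ≤ t
  · have h1 : ∀ τ, (ContinuousLinearMap.mul ℂ ℂ) (dampedSignal σ f τ)
        (dampedSignal σ (fun t => Real.exp (-t)) (t - τ))
        = (Icc 0 t).indicator (fun τ =>
          ((Real.exp (-σ * t) * Real.exp (-t) * (Real.exp τ * f τ) : ℝ) : ℂ)) τ := fun τ => by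
      by_cases h0 : 0 ≤ τ
      · by_cases h2 : τ ≤ t
        · have h3 : (0 : ℝ) ≤ t - τ := sub_nonneg.2 h2
          rw [indicator_of_mem (show τ ∈ Icc 0 t from ⟨h0, h2⟩), ContinuousLinearMap.mul_apply',
            dampedSignal, dampedSignal, indicator_of_mem (mem_Ici.2 h0),
            indicator_of_mem (mem_Ici.2 h3), ← Complex.ofReal_mul]
          congr 1
          have : Real.exp (-σ * t) * Real.exp (-t) * Real.exp τ
              = Real.exp (-σ * τ) * (Real.exp (-σ * (t - τ)) * Real.exp (-(t - τ))) := by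
            simp only [← Real.exp_add]
            congr 1
            ring
          rw [← mul_assoc (Real.exp (-σ * t) * Real.exp (-t)), this]
          ring
        · rw [indicator_of_notMem (fun h => h2 h.2), ContinuousLinearMap.mul_apply',
            dampedSignal, dampedSignal, indicator_of_notMem
              (s := Ici (0 : ℝ)) (a := t - τ) (fun h => h2 (sub_nonneg.1 h)), mul_zero]
      · rw [indicator_of_notMem (fun h => h0 h.1), ContinuousLinearMap.mul_apply', dampedSignal,
          indicator_of_notMem (s := Ici (0 : ℝ)) (a := τ) h0, zero_mul]
    simp_rw [h1]
    rw [integral_indicator measurableSet_Icc, integral_complex_ofReal, dampedSignal,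
      indicator_of_mem (mem_Ici.2 ht), integral_const_mul, lowPass,
      intervalIntegral.integral_of_le ht, integral_Icc_eq_integral_Ioc]
    push_cast
    ring
  · rw [dampedSignal, dampedSignal, dampedSignal,
      indicator_of_notMem (s := Ici (0 : ℝ)) (a := t) ht]
    refine integral_eq_zero_of_ae (Filter.Eventually.of_forall fun τ => ?_)
    by_cases h0 : 0 ≤ τ
    · have : ¬ 0 ≤ t - τ := fun h => ht (h0.trans (sub_nonneg.1 h))
      simp [indicator_of_notMem (s := Ici (0 : ℝ)) (a := t - τ) this]
    · simp [indicator_of_notMem (s := Ici (0 : ℝ)) (a := τ) h0]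

theorem memLp_inv_one_add (M : ℝ) :
    MemLp (fun ξ : ℝ => M * ‖(1 + 2 * Real.pi * ξ * Complex.I : ℂ)‖⁻¹) 2 := by
  refine MemLp.const_mul ?_ M
  have hn : ∀ ξ : ℝ, ‖(1 + 2 * Real.pi * ξ * Complex.I : ℂ)‖ ^ 2 = 1 + (ξ * (2 * Real.pi)) ^ 2 :=
    fun ξ => by
      rw [← Complex.normSq_eq_norm_sq, Complex.normSq_apply]
      simp
      ring
  have hc : AEStronglyMeasurable
      (fun ξ : ℝ => ‖(1 + 2 * Real.pi * ξ * Complex.I : ℂ)‖⁻¹) volume :=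
    Measurable.aestronglyMeasurable (by fun_prop)
  rw [memLp_two_iff_integrable_sq hc]
  simp_rw [inv_pow, hn]
  exact (integrable_inv_one_add_sq).comp_mul_right' (g := fun x : ℝ => (1 + x ^ 2)⁻¹)
    (by positivity)

open scoped FourierTransform in
/-- If `s f(s)` is bounded in the open right half-plane, then the high-pass part of `f` is in
`L₂[0,∞)`. -/
theorem memLp_sub_lowPass {f : ℝ → ℝ} {M : ℝ}
    (hf : ∀ σ : ℝ, 0 < σ → IntegrableOn (fun t => Real.exp (-σ * t) * f t) (Ici 0))
    (hM : ∀ s : ℂ, 0 < s.re → ‖s * laplace f s‖ ≤ M) :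
    MemLp (fun t => f t - lowPass f t) 2 (volume.restrict (Ici (0 : ℝ))) := by
  set z : ℝ → ℝ := fun t => f t - lowPass f t with hz
  have hM0 : 0 ≤ M := (norm_nonneg _).trans (hM 1 (by simp))
  set B := eLpNorm (fun ξ : ℝ => M * ‖(1 + 2 * Real.pi * ξ * Complex.I : ℂ)‖⁻¹) 2 volume with hB
  have hBtop : B < ⊤ := (memLp_inv_one_add M).2
  -- The bound `B` is independent of `σ`, which permits the passage `σ → 0` below.
  have key : ∀ σ : ℝ, 0 < σ → MemLp (dampedSignal σ z) 2 ∧ eLpNorm (dampedSignal σ z) 2 ≤ B := by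
    intro σ hσ
    have h1 := integrable_dampedSignal (hf σ hσ)
    have h2 : Integrable (dampedSignal σ fun t => Real.exp (-t)) := by
      refine integrable_dampedSignal ?_
      rw [integrableOn_Ici_iff_integrableOn_Ioi]
      refine (integrableOn_exp_mul_Ioi (a := -(σ + 1)) (by linarith) 0).congr_fun
        (fun t _ => ?_) measurableSet_Ioi
      rw [← Real.exp_add]
      ring_nf
    have hconv := dampedSignal_convolution σ f
    have h3 : Integrable (dampedSignal σ (lowPass f)) := by
      rw [← hconv]
      exact h1.integrable_convolution _ h2
    have hsub : dampedSignal σ z = dampedSignal σ f - dampedSignal σ (lowPass f) := by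
      funext t
      by_cases ht : t ∈ Ici (0 : ℝ)
      · simp only [dampedSignal, Pi.sub_apply, indicator_of_mem ht, hz, mul_sub,
          Complex.ofReal_sub]
      · simp only [dampedSignal, Pi.sub_apply, indicator_of_notMem ht, sub_zero]
    have h4 : Integrable (dampedSignal σ z) := hsub ▸ h1.sub h3
    have hF : ∀ ξ : ℝ, ‖𝓕 (dampedSignal σ z) ξ‖
        ≤ M * ‖(1 + 2 * Real.pi * ξ * Complex.I : ℂ)‖⁻¹ := fun ξ => by
      set s : ℂ := σ + 2 * Real.pi * ξ * Complex.I with hs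
      have hre : s.re = σ := by simp [hs]
      have him : s.im = 2 * Real.pi * ξ := by simp [hs]
      have e1 : 𝓕 (dampedSignal σ z) ξ = laplace f s - laplace f s * (s + 1)⁻¹ := by
        have : 𝓕 (dampedSignal σ z) ξ
            = 𝓕 (dampedSignal σ f) ξ - 𝓕 (dampedSignal σ (lowPass f)) ξ := by
          rw [hsub]
          simp only [Real.fourier_eq]
          rw [← integral_sub ((Real.fourierIntegral_convergent_iff ξ).2 h1)
            ((Real.fourierIntegral_convergent_iff ξ).2 h3)]
          simp [smul_sub]
        rw [this, ← hconv, Real.fourier_mul_convolution_eq h1 h2, fourier_dampedSignal,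
          fourier_dampedSignal, ← hs, laplace_exp_neg (by rw [hre]; exact hσ)]
      have hne : s + 1 ≠ 0 := fun h => by
        have := congrArg Complex.re h
        simp [hre] at this
        linarith
      -- The low-pass filter multiplies the transform by `1/(s+1)`, so its complement multiplies it
      -- by `s/(s+1)`; this is where boundedness of `s f(s)` enters.
      have e2 : 𝓕 (dampedSignal σ z) ξ = (s * laplace f s) * (s + 1)⁻¹ := by
        rw [e1]
        field_simp
        ring
      -- Since `Re s = σ > 0`, replacing `|s+1|` by its value at `σ = 0` only enlarges the bound and
      -- removes `σ` from it.
      have e3 : ‖(1 + 2 * Real.pi * ξ * Complex.I : ℂ)‖ ≤ ‖s + 1‖ := by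
        rw [Complex.norm_def, Complex.norm_def]
        refine Real.sqrt_le_sqrt ?_
        rw [Complex.normSq_apply, Complex.normSq_apply]
        simp [hre, him]
        nlinarith
      have e4 : 0 < ‖(1 + 2 * Real.pi * ξ * Complex.I : ℂ)‖ := by
        refine norm_pos_iff.2 fun h => ?_
        have := congrArg Complex.re h
        simp at this
      rw [e2, norm_mul, norm_inv]
      gcongr
      exact hM s (by rw [hre]; exact hσ)
    have hFm : MemLp (𝓕 (dampedSignal σ z)) 2 := by
      refine (memLp_inv_one_add M).mono ?_ (Filter.Eventually.of_forall fun ξ =>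
        (hF ξ).trans (le_abs_self _))
      exact (VectorFourier.fourierIntegral_continuous Real.continuous_fourierChar
        continuous_inner h4).aestronglyMeasurable
    obtain ⟨h5, h6⟩ := memLp_two_of_fourier h4 hFm
    refine ⟨h5, ?_⟩
    rw [h6, hB]
    refine eLpNorm_mono_ae (Filter.Eventually.of_forall fun ξ => ?_)
    exact (hF ξ).trans (le_abs_self _)
  have hlim : ∀ᵐ t : ℝ, Filter.Tendsto (fun n : ℕ => dampedSignal (1 / (n + 1)) z t) Filter.atTop
      (nhds (dampedSignal 0 z t)) := by
    refine Filter.Eventually.of_forall fun t => ?_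
    by_cases ht : t ∈ Ici (0 : ℝ)
    · simp only [dampedSignal, indicator_of_mem ht]
      refine (Complex.continuous_ofReal.tendsto _).comp ?_
      refine Filter.Tendsto.mul_const _ ((Real.continuous_exp.tendsto _).comp ?_)
      exact (tendsto_one_div_add_atTop_nhds_zero_nat.neg).mul_const t
    · simp only [dampedSignal, indicator_of_notMem ht]
      exact tendsto_const_nhds
  have hmeas : ∀ n : ℕ, AEStronglyMeasurable (dampedSignal (1 / ((n : ℝ) + 1)) z) volume :=
    fun n => (key _ (by positivity)).1.1
  -- Fatou's lemma along `σ = 1/(n+1)`: the undamped signal inherits the uniform bound.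
  have hle := Lp.eLpNorm_lim_le_liminf_eLpNorm (p := 2) hmeas (dampedSignal 0 z) hlim
  have h0 : MemLp (dampedSignal 0 z) 2 := by
    refine ⟨aestronglyMeasurable_of_tendsto_ae Filter.atTop hmeas hlim, lt_of_le_of_lt hle ?_⟩
    refine lt_of_le_of_lt (Filter.liminf_le_of_frequently_le'
      (Filter.Frequently.of_forall fun n => (key _ (by positivity)).2)) hBtop
  have h7 := (h0.restrict (Ici 0)).re
  refine h7.ae_eq (ae_restrict_of_forall_mem measurableSet_Ici fun t ht => ?_)
  simp [dampedSignal, indicator_of_mem ht]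

/-- An admissible attack is the sum of an absolutely continuous signal with zero initial value
and square integrable derivative, and of a square integrable signal. -/
theorem IsAdmissibleAttack.decomposition {k : ℕ} {f : ℝ → Fin k → ℝ}
    (hf : IsAdmissibleAttack f) :
    ∃ y h r : ℝ → Fin k → ℝ, SolvesVec y 0 h ∧ IsL2 h ∧ IsL2 r ∧ ∀ t, 0 ≤ t → f t = y t + r t := by
  obtain ⟨f₁, f₂, h1, h2, ⟨M, hM⟩, h3⟩ := hf
  have hh : IsL2 fun t a => f₁ t a - lowPass (fun t => f₁ t a) t :=
    isL2_iff.2 fun a => memLp_sub_lowPass (fun σ hσ => h2 σ hσ a) fun s hs => hM s hs a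
  -- The derivative of the filter output is its input minus itself, so the same `L₂` signal `f₁ - y`
  -- serves as `y'` and as part of the remainder.
  refine ⟨fun t a => lowPass (fun t => f₁ t a) t, fun t a => f₁ t a - lowPass (fun t => f₁ t a) t,
    fun t => (fun a => f₁ t a - lowPass (fun t => f₁ t a) t) + f₂ t, fun a => ?_, hh, hh.add h3,
    fun t ht => ?_⟩
  · exact solves_lowPass fun T hT => intervalIntegrable_of_damped (h2 1 one_pos a) hT
  · rw [h1 t ht]
    funext a
    simp only [Pi.add_apply]
    ring

end ResilientObserver

namespace ResilientObserver

/-! ### Realizations of the tracking loop -/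

theorem tendsto_ofReal_atTop_cobounded :
    Filter.Tendsto (fun s : ℝ => (s : ℂ)) Filter.atTop (Bornology.cobounded ℂ) := by
  rw [← tendsto_norm_atTop_iff_cobounded]
  simpa using Filter.tendsto_abs_atTop_atTop

open scoped Matrix.Norms.Operator in
theorem tendsto_resolvent_real {ι : Type*} [Fintype ι] [DecidableEq ι] (A : Matrix ι ι ℂ) :
    Filter.Tendsto (fun s : ℝ => ((s : ℂ) • (1 : Matrix ι ι ℂ) - A)⁻¹) Filter.atTop (nhds 0) := by
  have h := (spectrum.resolvent_tendsto_cobounded (𝕜 := ℂ) A).comp tendsto_ofReal_atTop_cobounded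
  refine h.congr fun s => ?_
  simp [resolvent, Matrix.nonsing_inv_eq_ringInverse, Algebra.algebraMap_eq_smul_one]

open scoped Matrix.Norms.Operator in
theorem eventually_notMem_spectrum {ι : Type*} [Fintype ι] [DecidableEq ι] (A : Matrix ι ι ℂ) :
    ∀ᶠ s : ℝ in Filter.atTop, (s : ℂ) ∉ spectrum ℂ A :=
  tendsto_ofReal_atTop_cobounded.eventually
    (spectrum.isBounded (𝕜 := ℂ) A : Bornology.IsBounded _)

theorem smul_resolvent {ι : Type*} [Fintype ι] [DecidableEq ι] {A : Matrix ι ι ℂ} {s : ℂ}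
    (hs : s ∉ spectrum ℂ A) :
    s • (s • (1 : Matrix ι ι ℂ) - A)⁻¹ = A * (s • (1 : Matrix ι ι ℂ) - A)⁻¹ + 1 := by
  have hu : IsUnit (s • (1 : Matrix ι ι ℂ) - A) := by
    have := spectrum.notMem_iff.1 hs
    rwa [Algebra.algebraMap_eq_smul_one] at this
  have h := Matrix.mul_nonsing_inv _ ((Matrix.isUnit_iff_isUnit_det _).1 hu)
  rwa [sub_mul, Matrix.smul_mul, Matrix.one_mul, sub_eq_iff_eq_add'] at h

theorem tendsto_const_matrix_mul {ι α β : Type*} [Fintype ι] (Q : Matrix β ι ℂ)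
    {X : ℝ → Matrix ι α ℂ} (hX : Filter.Tendsto X Filter.atTop (nhds 0)) :
    Filter.Tendsto (fun s => Q * X s) Filter.atTop (nhds 0) := by
  have hc : Continuous fun Z : Matrix ι α ℂ => Q * Z := continuous_const.matrix_mul continuous_id
  have h := (hc.tendsto 0).comp hX
  rwa [Matrix.mul_zero] at h

/-- Realizations with the same transfer function have the same Markov parameters. -/
theorem markov_eq_of_transfer_eq {ι κ α β : Type*} [Fintype ι] [Fintype κ] [DecidableEq ι]
    [DecidableEq κ] {A : Matrix ι ι ℂ} {A' : Matrix κ κ ℂ} {B : Matrix ι α ℂ} {B' : Matrix κ α ℂ}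
    {X : ℝ → Matrix ι α ℂ} {X' : ℝ → Matrix κ α ℂ}
    (hX : ∀ᶠ s : ℝ in Filter.atTop, (s : ℂ) • X s = A * X s + B)
    (hX' : ∀ᶠ s : ℝ in Filter.atTop, (s : ℂ) • X' s = A' * X' s + B')
    (hX0 : Filter.Tendsto X Filter.atTop (nhds 0))
    (hX0' : Filter.Tendsto X' Filter.atTop (nhds 0)) (C : Matrix β ι ℂ) (C' : Matrix β κ ℂ)
    (h : ∀ᶠ s : ℝ in Filter.atTop, C * X s = C' * X' s) (j : ℕ) :
    C * A ^ j * B = C' * A' ^ j * B' := by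
  have step : ∀ (C : Matrix β ι ℂ) (C' : Matrix β κ ℂ),
      (∀ᶠ s : ℝ in Filter.atTop, C * X s = C' * X' s) →
      C * B = C' * B' ∧ ∀ᶠ s : ℝ in Filter.atTop, C * A * X s = C' * A' * X' s := by
    intro C C' h
    -- Multiplying the equal outputs by `s` and expanding both sides shows that this difference is
    -- constant in `s`; it also tends to zero. Hence the leading parameters agree, and the shifted
    -- outputs agree again, which drives the induction on `j`.
    have h1 : ∀ᶠ s : ℝ in Filter.atTop, C' * A' * X' s - C * A * X s = C * B - C' * B' := by
      filter_upwards [hX, hX', h] with s e1 e2 e3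
      have e4 : (s : ℂ) • (C * X s) = C * A * X s + C * B := by
        rw [← Matrix.mul_smul, e1, Matrix.mul_add, Matrix.mul_assoc]
      have e5 : (s : ℂ) • (C' * X' s) = C' * A' * X' s + C' * B' := by
        rw [← Matrix.mul_smul, e2, Matrix.mul_add, Matrix.mul_assoc]
      rw [e3, e5] at e4
      rw [sub_eq_sub_iff_add_eq_add, e4]
      abel
    have h2 : C * B - C' * B' = 0 := by
      have t1 := (tendsto_const_matrix_mul (C' * A') hX0').sub
        (tendsto_const_matrix_mul (C * A) hX0)
      rw [sub_zero] at t1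
      exact tendsto_nhds_unique (tendsto_const_nhds.congr' (h1.mono fun _ e => e.symm)) t1
    refine ⟨sub_eq_zero.1 h2, ?_⟩
    filter_upwards [h1] with s e
    rw [h2] at e
    exact (sub_eq_zero.1 e).symm
  induction j generalizing C C' with
  | zero => simpa using (step C C' h).1
  | succ j ih =>
    have := ih (C * A) (C' * A') (step C C' h).2
    rwa [pow_succ', pow_succ', ← Matrix.mul_assoc C, ← Matrix.mul_assoc C']

/-- A minimal realization inherits closed-loop polynomial identities from any realization with
the same Markov parameters. -/
theorem closedLoop_of_markov_eq {ι κ α : Type*} [Fintype ι] [Fintype κ] [Fintype α]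
    [DecidableEq ι] [DecidableEq κ] [DecidableEq α]
    {A : Matrix ι ι ℝ} {B : Matrix ι α ℝ} {C : Matrix α ι ℝ}
    {A' : Matrix κ κ ℝ} {B' : Matrix κ α ℝ} {C' : Matrix α κ ℝ}
    (hm : ∀ j : ℕ, C * A ^ j * B = C' * A' ^ j * B')
    (hctrl : Submodule.span ℝ (Set.range fun a : ℕ × α => (A ^ a.1 * B).col a.2) = ⊤)
    (hobs : ∀ x : ι → ℝ, (∀ l : ℕ, (C * A ^ l) *ᵥ x = 0) → x = 0) (p : Polynomial ℝ) :
    (Polynomial.aeval (A' - B' * C') p = 0 → Polynomial.aeval (A - B * C) p = 0) ∧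
      C * Polynomial.aeval (A - B * C) p * B = C' * Polynomial.aeval (A' - B' * C') p * B' := by
  -- `W` pairs the states that the two realizations reach under the same inputs. It is invariant
  -- under `(A', A)`, contains the range of `(B', B)`, and equality of Markov parameters says that
  -- paired states have equal outputs. Therefore output feedback preserves `W` as well.
  set W : Submodule ℝ ((κ → ℝ) × (ι → ℝ)) := Submodule.span ℝ
    (Set.range fun a : ℕ × α => ((A' ^ a.1 * B').col a.2, (A ^ a.1 * B).col a.2)) with hW
  have hA : ∀ x ∈ W, (A' *ᵥ x.1, A *ᵥ x.2) ∈ W := by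
    intro x hx
    induction hx using Submodule.span_induction with
    | mem x hx =>
      obtain ⟨⟨j, b⟩, rfl⟩ := hx
      refine Submodule.subset_span ⟨(j + 1, b), ?_⟩
      simp only [pow_succ', Matrix.mul_assoc]
      rfl
    | zero =>
      rw [Prod.fst_zero, Prod.snd_zero, Matrix.mulVec_zero, Matrix.mulVec_zero]
      exact W.zero_mem
    | add x y _ _ hx hy =>
      simpa [Matrix.mulVec_add] using W.add_mem hx hy
    | smul c x _ hx => simpa [Matrix.mulVec_smul] using W.smul_mem c hx
  have hC : ∀ l : ℕ, ∀ x ∈ W, (C' * A' ^ l) *ᵥ x.1 = (C * A ^ l) *ᵥ x.2 := by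
    intro l x hx
    induction hx using Submodule.span_induction with
    | mem x hx =>
      obtain ⟨⟨j, b⟩, rfl⟩ := hx
      have h1 : C' * A' ^ l * (A' ^ j * B') = C * A ^ l * (A ^ j * B) := by
        have := hm (l + j)
        rw [pow_add, pow_add] at this
        simpa only [Matrix.mul_assoc] using this.symm
      exact congrArg (fun Q : Matrix α α ℝ => Q.col b) h1
    | zero => simp
    | add x y _ _ hx hy => simp [Matrix.mulVec_add, hx, hy]
    | smul c x _ hx => simp [Matrix.mulVec_smul, hx]
  have hC0 : ∀ x ∈ W, C' *ᵥ x.1 = C *ᵥ x.2 := fun x hx => by simpa using hC 0 x hx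
  have hB : ∀ u : α → ℝ, (B' *ᵥ u, B *ᵥ u) ∈ W := by
    intro u
    have h1 : (B' *ᵥ u, B *ᵥ u) = ∑ b, u b • (B'.col b, B.col b) := by
      refine Prod.ext ?_ ?_
      · rw [Prod.fst_sum]
        funext i
        simp [Matrix.mulVec, dotProduct, mul_comm]
      · rw [Prod.snd_sum]
        funext i
        simp [Matrix.mulVec, dotProduct, mul_comm]
    rw [h1]
    exact W.sum_mem fun b _ => W.smul_mem _ (Submodule.subset_span ⟨(0, b), by simp⟩)
  have hcl : ∀ x ∈ W, ((A' - B' * C') *ᵥ x.1, (A - B * C) *ᵥ x.2) ∈ W := by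
    intro x hx
    have h1 := W.sub_mem (hA x hx) (hB (C *ᵥ x.2))
    rw [Prod.mk_sub_mk] at h1
    nth_rw 1 [← hC0 x hx] at h1
    simpa only [Matrix.sub_mulVec, Matrix.mulVec_mulVec] using h1
  have hpoly : ∀ q : Polynomial ℝ, ∀ x ∈ W, (Polynomial.aeval (A' - B' * C') q *ᵥ x.1,
      Polynomial.aeval (A - B * C) q *ᵥ x.2) ∈ W := by
    intro q
    induction q using Polynomial.induction_on' with
    | add q r hq hr =>
      intro x hx
      simpa [Matrix.add_mulVec] using W.add_mem (hq x hx) (hr x hx)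
    | monomial j c =>
      intro x hx
      have h1 : ∀ j : ℕ, ((A' - B' * C') ^ j *ᵥ x.1, (A - B * C) ^ j *ᵥ x.2) ∈ W := by
        intro j
        induction j with
        | zero => simpa using hx
        | succ j ih => simpa [pow_succ', Matrix.mulVec_mulVec] using hcl _ ih
      have h2 := W.smul_mem c (h1 j)
      simpa [Polynomial.aeval_monomial, Algebra.algebraMap_eq_smul_one, Matrix.smul_mulVec]
        using h2
  constructor
  · intro hp
    -- Controllability pairs every state `x` with some `x'`. If `p` annihilates the primed loop,
    -- then `(0, p(A-BC)x)` lies in `W`, so its second component produces zero output and vanishes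
    -- by observability. The primed realization need not be minimal.
    have hsurj : ∀ x : ι → ℝ, ∃ x', (x', x) ∈ W := by
      intro x
      have h1 : x ∈ W.map (LinearMap.snd ℝ (κ → ℝ) (ι → ℝ)) := by
        have : W.map (LinearMap.snd ℝ (κ → ℝ) (ι → ℝ)) = ⊤ := by
          rw [hW, Submodule.map_span, ← Set.range_comp]
          exact hctrl
        rw [this]
        trivial
      obtain ⟨⟨a, b⟩, hy, rfl⟩ := h1
      exact ⟨a, hy⟩
    refine Matrix.ext_of_mulVec_single fun i => ?_
    obtain ⟨x', hx'⟩ := hsurj (Pi.single i 1)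
    have h2 := hpoly p _ hx'
    rw [hp] at h2
    rw [Matrix.zero_mulVec]
    refine hobs _ fun l => ?_
    have := hC l _ h2
    simpa using this.symm
  · refine Matrix.ext_of_mulVec_single fun i => ?_
    have h1 := hC0 _ (hpoly p _ (hB (Pi.single i 1)))
    simpa only [Matrix.mulVec_mulVec, Matrix.mul_assoc] using h1.symm

/-! ### The tracking loop in state-space form -/

/-- State matrix of the realization of `(1/s) G(s)` with state `(q, f̂)`. -/
def ProperTransfer.blockA {k : ℕ} (G : ProperTransfer k) :
    Matrix (Fin G.order ⊕ Fin k) (Fin G.order ⊕ Fin k) ℝ :=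
  Matrix.fromBlocks G.Ag 0 G.Cg 0

/-- Input matrix of the realization of `(1/s) G(s)` with state `(q, f̂)`. -/
def ProperTransfer.blockB {k : ℕ} (G : ProperTransfer k) :
    Matrix (Fin G.order ⊕ Fin k) (Fin k) ℝ :=
  Matrix.fromRows G.Bg G.Dg

/-- Output matrix of the realization of `(1/s) G(s)` with state `(q, f̂)`. -/
def ProperTransfer.blockC {k : ℕ} (G : ProperTransfer k) :
    Matrix (Fin k) (Fin G.order ⊕ Fin k) ℝ :=
  Matrix.fromCols 0 1

theorem ProperTransfer.markov_eq {d k : ℕ} {G : ProperTransfer k} {Ω : Matrix (Fin d) (Fin d) ℝ}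
    {Γ : Matrix (Fin d) (Fin k) ℝ} {Υ : Matrix (Fin k) (Fin d) ℝ}
    (h : ∀ s : ℂ, s ≠ 0 → s ∉ spectrum ℂ (Ω.map (fun r : ℝ => (r : ℂ))) →
      s ∉ spectrum ℂ (G.Ag.map (fun r : ℝ => (r : ℂ))) →
      transfer Ω (-Γ) Υ s = s⁻¹ • G.eval s) (j : ℕ) :
    Υ * Ω ^ j * (-Γ) = G.blockC * G.blockA ^ j * G.blockB := by
  let f : ℝ →+* ℂ := Complex.ofRealHom
  let RΩ : ℝ → Matrix (Fin d) (Fin d) ℂ := fun s => ((s : ℂ) • 1 - Ω.map f)⁻¹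
  let RG : ℝ → Matrix (Fin G.order) (Fin G.order) ℂ := fun s => ((s : ℂ) • 1 - G.Ag.map f)⁻¹
  let X : ℝ → Matrix (Fin d) (Fin k) ℂ := fun s => RΩ s * (-Γ).map f
  let Q : ℝ → Matrix (Fin G.order) (Fin k) ℂ := fun s => RG s * G.Bg.map f
  -- This is the resolvent of `blockA` applied to `blockB`, written explicitly so that the block
  -- matrix need not be inverted.
  let X' : ℝ → Matrix (Fin G.order ⊕ Fin k) (Fin k) ℂ := fun s =>
    Matrix.fromRows (Q s) ((s : ℂ)⁻¹ • (G.Cg.map f * Q s + G.Dg.map f))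
  have hevΩ := eventually_notMem_spectrum (Ω.map f)
  have hevG := eventually_notMem_spectrum (G.Ag.map f)
  have hev0 := Filter.eventually_gt_atTop (0 : ℝ)
  have hRQ : Filter.Tendsto Q Filter.atTop (nhds 0) := by
    have hc : Continuous fun Z : Matrix (Fin G.order) (Fin G.order) ℂ => Z * G.Bg.map f :=
      continuous_id.matrix_mul continuous_const
    have h := (hc.tendsto 0).comp (tendsto_resolvent_real (G.Ag.map f))
    rwa [Matrix.zero_mul] at h
  have hRX : Filter.Tendsto X Filter.atTop (nhds 0) := by
    have hc : Continuous fun Z : Matrix (Fin d) (Fin d) ℂ => Z * (-Γ).map f :=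
      continuous_id.matrix_mul continuous_const
    have h := (hc.tendsto 0).comp (tendsto_resolvent_real (Ω.map f))
    rwa [Matrix.zero_mul] at h
  have hRX' : Filter.Tendsto X' Filter.atTop (nhds 0) := by
    have h1 : Filter.Tendsto (fun s : ℝ => (s : ℂ)⁻¹) Filter.atTop (nhds 0) :=
      Filter.tendsto_inv₀_cobounded.comp tendsto_ofReal_atTop_cobounded
    have h2 := h1.smul ((tendsto_const_matrix_mul (G.Cg.map f) hRQ).add_const (G.Dg.map f))
    rw [zero_smul] at h2
    refine tendsto_pi_nhds.2 fun a => tendsto_pi_nhds.2 fun b => ?_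
    rcases a with a | a
    · exact (tendsto_pi_nhds.1 (tendsto_pi_nhds.1 hRQ a) b)
    · exact (tendsto_pi_nhds.1 (tendsto_pi_nhds.1 h2 a) b)
  have hX : ∀ᶠ s : ℝ in Filter.atTop, (s : ℂ) • X s = Ω.map f * X s + (-Γ).map f := by
    filter_upwards [hevΩ] with s hs
    simp only [X, RΩ]
    rw [← Matrix.smul_mul, smul_resolvent hs, Matrix.add_mul, Matrix.one_mul, Matrix.mul_assoc]
  have hX' : ∀ᶠ s : ℝ in Filter.atTop, (s : ℂ) • X' s
      = G.blockA.map f * X' s + G.blockB.map f := by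
    filter_upwards [hevG, hev0] with s hs h0
    have hs0 : (s : ℂ) ≠ 0 := by exact_mod_cast h0.ne'
    have h1 : (s : ℂ) • Q s = G.Ag.map f * Q s + G.Bg.map f := by
      simp only [Q, RG]
      rw [← Matrix.smul_mul, smul_resolvent hs, Matrix.add_mul, Matrix.one_mul, Matrix.mul_assoc]
    have h2 : G.blockA.map f * X' s = Matrix.fromRows (G.Ag.map f * Q s) (G.Cg.map f * Q s) := by
      simp only [X', ProperTransfer.blockA, Matrix.fromBlocks_map, Matrix.fromBlocks_mul_fromRows]
      simp
    rw [h2]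
    ext a b
    rcases a with a | a
    · simpa [X', ProperTransfer.blockB] using congrFun (congrFun h1 a) b
    · simp [X', ProperTransfer.blockB]
      field_simp
  have hCX : ∀ᶠ s : ℝ in Filter.atTop, Υ.map f * X s = G.blockC.map f * X' s := by
    filter_upwards [hevΩ, hevG, hev0] with s h1 h2 h0
    have hs0 : (s : ℂ) ≠ 0 := by exact_mod_cast h0.ne'
    have h3 := h s hs0 h1 h2
    have h4 : G.blockC.map f * X' s = (s : ℂ)⁻¹ • (G.Cg.map f * Q s + G.Dg.map f) := by
      have : G.blockC.map f = Matrix.fromCols 0 1 := by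
        ext a b
        rcases b with b | b <;> simp [ProperTransfer.blockC, Matrix.one_apply, apply_ite f]
      simp only [this, X', Matrix.fromCols_mul_fromRows]
      simp
    simp only [ProperTransfer.eval, transfer, Matrix.mul_assoc] at h3
    rw [h4, add_comm (G.Cg.map f * Q s)]
    exact h3
  have key := markov_eq_of_transfer_eq hX hX' hRX hRX' (Υ.map f) (G.blockC.map f) hCX j
  have hinj : Function.Injective fun M : Matrix (Fin k) (Fin k) ℝ => M.map f :=
    Matrix.map_injective Complex.ofReal_injective
  apply hinj
  simpa only [Matrix.map_mul, Matrix.map_pow] using key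

/-- The closed tracking loop: `Ω + Γ Υ` is exponentially stable, and the loop tracks constants. -/
theorem IsTrackerRealization.closedLoop {d k : ℕ} {G : ProperTransfer k}
    {Ω : Matrix (Fin d) (Fin d) ℝ} {Γ : Matrix (Fin d) (Fin k) ℝ} {Υ : Matrix (Fin k) (Fin d) ℝ}
    (h : IsTrackerRealization G Ω Γ Υ) (hG : G.LoopStable) :
    (∃ p : Polynomial ℝ, p.Monic ∧ (∀ z : ℂ, Polynomial.aeval z p = 0 → z.re < 0) ∧
      Polynomial.aeval (Ω + Γ * Υ) p = 0) ∧
    ∃ θ : Matrix (Fin d) (Fin k) ℝ, (Ω + Γ * Υ) * θ = Γ ∧ Υ * θ = 1 := by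
  have hctrl : Submodule.span ℝ (Set.range fun a : ℕ × Fin k => (Ω ^ a.1 * -Γ).col a.2) = ⊤ := by
    rw [← h.2.1, ← Submodule.span_neg]
    congr 1
    ext x
    simp only [Set.mem_neg, Set.mem_range]
    refine exists_congr fun a => ?_
    have : (Ω ^ a.1 * -Γ).col a.2 = -(Ω ^ a.1 * Γ).col a.2 := by
      rw [Matrix.mul_neg]
      rfl
    rw [this, neg_inj]
  have hcl := closedLoop_of_markov_eq (ProperTransfer.markov_eq h.1) hctrl h.2.2
  have hM : G.blockA - G.blockB * G.blockC = Matrix.fromBlocks G.Ag (-G.Bg) G.Cg (-G.Dg) := by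
    simp only [ProperTransfer.blockA, ProperTransfer.blockB, ProperTransfer.blockC,
      Matrix.fromRows_mul_fromCols]
    ext a b
    rcases a with a | a <;> rcases b with b | b <;> simp
  have hΩ : Ω - -Γ * Υ = Ω + Γ * Υ := by rw [Matrix.neg_mul, sub_neg_eq_add]
  simp only [hM, hΩ] at hcl
  set M := Matrix.fromBlocks G.Ag (-G.Bg) G.Cg (-G.Dg) with hMdef
  have hroots : ∀ z : ℂ, Polynomial.aeval z M.charpoly = 0 → z.re < 0 := fun z hz => by
    refine hG z ?_
    rw [Matrix.mem_spectrum_iff_isRoot_charpoly]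
    have : (M.map fun r : ℝ => (r : ℂ)).charpoly = M.charpoly.map (algebraMap ℝ ℂ) :=
      Matrix.charpoly_map M (algebraMap ℝ ℂ)
    rw [← hMdef, this, Polynomial.IsRoot.def, Polynomial.eval_map_algebraMap]
    exact hz
  have hp0 := (hcl M.charpoly).1 (Matrix.aeval_self_charpoly M)
  refine ⟨⟨M.charpoly, M.charpoly_monic, hroots, hp0⟩, ?_⟩
  set c := M.charpoly.coeff 0 with hc
  -- The point `0` is not in the open left half-plane, hence not a root.
  have hc0 : c ≠ 0 := fun h0 => by
    have := hroots 0 (by simp [Polynomial.aeval_def, ← hc, h0])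
    simp at this
  -- By construction `X q = 1 - charpoly / c`, so `q(Q) = Q⁻¹` for every `Q` annihilated by the
  -- characteristic polynomial. Expressing the inverse as a polynomial allows it to be transferred
  -- between realizations.
  set q : Polynomial ℝ := Polynomial.C (-c⁻¹) * M.charpoly.divX with hq
  have hXq : ∀ {ι : Type} [Fintype ι] [DecidableEq ι] (Q : Matrix ι ι ℝ),
      Polynomial.aeval Q M.charpoly = 0 → Q * Polynomial.aeval Q q = 1 := by
    intro ι _ _ Q hQ
    have h1 : Polynomial.X * q = Polynomial.C (-c⁻¹) * M.charpoly + 1 := by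
      conv_rhs => rw [← Polynomial.X_mul_divX_add M.charpoly]
      rw [hq, mul_add, ← hc, ← Polynomial.C_mul, neg_mul, inv_mul_cancel₀ hc0]
      simp
      ring
    have h2 := congrArg (Polynomial.aeval Q) h1
    simpa [hQ] using h2
  refine ⟨Polynomial.aeval (Ω + Γ * Υ) q * Γ, ?_, ?_⟩
  · rw [← Matrix.mul_assoc, hXq _ hp0, Matrix.one_mul]
  · have h1 := (hcl q).2
    set E : Matrix (Fin G.order ⊕ Fin k) (Fin k) ℝ := Matrix.fromRows 0 1 with hE
    -- The integrator makes the last block column of `blockA` zero, so `M E` contains only the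
    -- feedback part. Hence `M⁻¹ blockB = -E`, and the loop has unit gain at zero frequency.
    have h2 : M * E = -G.blockB := by
      simp only [hMdef, hE, Matrix.fromBlocks_mul_fromRows, ProperTransfer.blockB]
      ext a b
      rcases a with a | a <;> simp
    have h3 : Polynomial.aeval M q * M = 1 :=
      mul_eq_one_comm.1 (hXq M (Matrix.aeval_self_charpoly M))
    have h4 : Polynomial.aeval M q * G.blockB = -E := by
      rw [← neg_neg G.blockB, ← h2, Matrix.mul_neg, ← Matrix.mul_assoc, h3, Matrix.one_mul]
    have h5 : G.blockC * E = 1 := by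
      simp only [ProperTransfer.blockC, hE, Matrix.fromCols_mul_fromRows]
      simp
    rw [Matrix.mul_neg, Matrix.mul_assoc G.blockC, h4, Matrix.mul_neg, neg_inj, h5] at h1
    rw [← Matrix.mul_assoc, h1]

end ResilientObserver

namespace ResilientObserver

/-! ### Tracking errors of the attack models -/

section

variable {ι : Type*} [Fintype ι]

theorem dotProduct_self_nonneg_real (x : ι → ℝ) : 0 ≤ x ⬝ᵥ x :=
  Finset.sum_nonneg fun _ _ => mul_self_nonneg _

theorem exists_quadForm_le (M : Matrix ι ι ℝ) :
    ∃ K : ℝ, 0 < K ∧ ∀ x : ι → ℝ, x ⬝ᵥ (M *ᵥ x) ≤ K * (x ⬝ᵥ x) := by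
  -- The summand `1` keeps the constant positive when the matrix is zero or the index type is empty.
  refine ⟨(∑ i, ∑ j, |M i j|) + 1, by positivity, fun x => ?_⟩
  have h1 : x ⬝ᵥ (M *ᵥ x) = ∑ i, ∑ j, x i * (M i j * x j) := by
    simp only [dotProduct, Matrix.mulVec, Finset.mul_sum]
  have h2 : ∀ i, x i ^ 2 ≤ x ⬝ᵥ x := fun i => by
    rw [sq]
    exact Finset.single_le_sum (f := fun i => x i * x i) (fun i _ => mul_self_nonneg _)
      (Finset.mem_univ i)
  have h3 : ∀ i j, x i * (M i j * x j) ≤ |M i j| * (x ⬝ᵥ x) := fun i j => by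
    have h4 : |x i * x j| ≤ x ⬝ᵥ x := by
      rw [abs_le]
      constructor <;> nlinarith [h2 i, h2 j, sq_nonneg (x i - x j), sq_nonneg (x i + x j)]
    calc x i * (M i j * x j) ≤ |x i * (M i j * x j)| := le_abs_self _
      _ = |M i j| * |x i * x j| := by rw [← abs_mul]; ring_nf
      _ ≤ _ := by gcongr
  rw [h1]
  calc _ ≤ ∑ i, ∑ j, |M i j| * (x ⬝ᵥ x) :=
        Finset.sum_le_sum fun i _ => Finset.sum_le_sum fun j _ => h3 i j
    _ = (∑ i, ∑ j, |M i j|) * (x ⬝ᵥ x) := by simp_rw [Finset.sum_mul]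
    _ ≤ _ := by nlinarith [dotProduct_self_nonneg_real x]

/-- Gronwall's inequality for `e'e` with zero initial value, where `c = -2K` is a growth rate; any
`a < c` serves because the forcing term is zero. -/
theorem SolvesVec.eq_zero {M : Matrix ι ι ℝ} {e : ℝ → ι → ℝ}
    (he : SolvesVec e 0 fun t => M *ᵥ e t) {t : ℝ} (ht : 0 ≤ t) : e t = 0 := by
  obtain ⟨K, hK, hM⟩ := exists_quadForm_le M
  have hV := he.dotProduct he
  have h1 := hV.gronwall (c := -(2 * K)) (a := -(2 * K) - 1) (K := 0) (by linarith) le_rfl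
    (by simp) (fun t _ => by
      have := hM (e t)
      rw [dotProduct_comm (M *ᵥ e t)]
      linarith) ht
  have h2 : e t ⬝ᵥ e t ≤ 0 := by simpa using h1
  exact dotProduct_self_eq_zero.1 (le_antisymm h2 (dotProduct_self_nonneg_real _))

end

/-- For a constant attack `y` the loop state settles at `θ y`, up to the stable transient. For `f =
y + r` the deviation `ε - θ y` solves the stable closed-loop equation with the `L₂` input `-Γ r - θ
y'`, and `Υ θ = 1` gives `ν = Υ(ε - θ y) - r`. -/
theorem IsTrackerRealization.isL2_mismatch {d k : ℕ} {G : ProperTransfer k}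
    {Ω : Matrix (Fin d) (Fin d) ℝ} {Γ : Matrix (Fin d) (Fin k) ℝ} {Υ : Matrix (Fin k) (Fin d) ℝ}
    (h : IsTrackerRealization G Ω Γ Υ) (hG : G.LoopStable) {f : ℝ → Fin k → ℝ}
    (hf : IsAdmissibleAttack f) {ε : ℝ → Fin d → ℝ}
    (hε : SolvesVec ε 0 fun t => Ω *ᵥ ε t + Γ *ᵥ (Υ *ᵥ ε t - f t)) :
    IsL2 fun t => Υ *ᵥ ε t - f t := by
  obtain ⟨⟨p, hp, hroots, hp0⟩, θ, hθ1, hθ2⟩ := h.closedLoop hG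
  obtain ⟨y, g, r, hy, hg, hr, hfy⟩ := hf.decomposition
  have he := (hε.sub (hy.mulVec θ)).congr
    (k := fun t => (Ω + Γ * Υ) *ᵥ (ε t - θ *ᵥ y t) + (-(Γ *ᵥ r t) - θ *ᵥ g t)) fun t ht => by
      rw [Matrix.mulVec_sub (Ω + Γ * Υ), Matrix.mulVec_mulVec, hθ1, hfy t ht, Matrix.mulVec_sub,
        Matrix.mulVec_add, Matrix.add_mulVec, Matrix.mulVec_mulVec]
      abel
  have hu : IsL2 fun t => -(Γ *ᵥ r t) - θ *ᵥ g t := by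
    have := (hr.mulVec (-Γ)).sub (hg.mulVec θ)
    simpa only [Matrix.neg_mulVec] using this
  refine (((he.isL2_of_aeval_eq_zero hp hroots hp0 hu).mulVec Υ).sub hr).congr fun t ht => ?_
  rw [Matrix.mulVec_sub, Matrix.mulVec_mulVec, hθ2, Matrix.one_mulVec, hfy t ht]
  abel

end ResilientObserver

namespace ResilientObserver

/-! ### Dissipation inequalities -/

section

variable {κ ο ω : Type*} [Fintype κ] [Fintype ο] [Fintype ω]

theorem dotProduct_mulVec_transpose (M : Matrix κ ο ℝ) (x : κ → ℝ) (y : ο → ℝ) :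
    x ⬝ᵥ (M *ᵥ y) = (Mᵀ *ᵥ x) ⬝ᵥ y := by
  rw [Matrix.dotProduct_mulVec, Matrix.mulVec_transpose]

theorem two_mul_dotProduct_le (x y : κ → ℝ) : 2 * (x ⬝ᵥ y) ≤ x ⬝ᵥ x + y ⬝ᵥ y := by
  have h := dotProduct_self_nonneg_real (x - y)
  rw [sub_dotProduct, dotProduct_sub, dotProduct_sub, dotProduct_comm y x] at h
  linarith

variable [DecidableEq κ] [DecidableEq ο]

/-- Dissipation inequality for one node of a network of `H_∞` filters. -/
theorem riccati_dissipation (A R Y : Matrix κ κ ℝ) (B : Matrix κ ω ℝ) (C : Matrix ο κ ℝ)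
    (E : Matrix ο ο ℝ) (a : ℝ) (z : κ → ℝ) (w : ω → ℝ) (η : ο → ℝ) (hY : Y.PosDef)
    (hE : E.PosDef) :
    2 * ((Y⁻¹ *ᵥ z) ⬝ᵥ (A *ᵥ z + B *ᵥ w - (Y * Cᵀ * E⁻¹) *ᵥ (C *ᵥ z + η)))
      - (Y⁻¹ *ᵥ z) ⬝ᵥ ((A * Y + Y * Aᵀ - Y * (Cᵀ * E⁻¹ * C - a • R) * Y + B * Bᵀ) *ᵥ (Y⁻¹ *ᵥ z))
      ≤ w ⬝ᵥ w - a * (z ⬝ᵥ (R *ᵥ z)) - (C *ᵥ z) ⬝ᵥ (E⁻¹ *ᵥ (C *ᵥ z))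
        - 2 * ((E⁻¹ *ᵥ (C *ᵥ z)) ⬝ᵥ η) := by
  have hYs : Yᵀ = Y := hY.1
  have hEs : (E⁻¹)ᵀ = E⁻¹ := hE.inv.1
  -- In terms of `p` the two drift contributions cancel, the gain term and the quadratic Riccati
  -- term combine to a single `-(Cz)'E⁻¹(Cz)`, and `2(B'p)'w - |B'p|² ≤ |w|²`.
  set p := Y⁻¹ *ᵥ z with hp
  have hz : Y *ᵥ p = z := by
    rw [hp, Matrix.mulVec_mulVec, Matrix.mul_nonsing_inv _ (isUnit_iff_ne_zero.2 hY.det_pos.ne'),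
      Matrix.one_mulVec]
  have hpY : ∀ x, p ⬝ᵥ (Y *ᵥ x) = z ⬝ᵥ x := fun x => by
    rw [dotProduct_mulVec_transpose, hYs, hz]
  have e1 : p ⬝ᵥ ((Y * Cᵀ * E⁻¹) *ᵥ (C *ᵥ z + η))
      = (C *ᵥ z) ⬝ᵥ (E⁻¹ *ᵥ (C *ᵥ z)) + (E⁻¹ *ᵥ (C *ᵥ z)) ⬝ᵥ η := by
    rw [← Matrix.mulVec_mulVec, ← Matrix.mulVec_mulVec, hpY, dotProduct_mulVec_transpose,
      Matrix.transpose_transpose, Matrix.mulVec_add, dotProduct_add,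
      dotProduct_mulVec_transpose _ _ η, hEs]
  have e2 : p ⬝ᵥ ((A * Y) *ᵥ p) = p ⬝ᵥ (A *ᵥ z) := by rw [← Matrix.mulVec_mulVec, hz]
  have e3 : p ⬝ᵥ ((Y * Aᵀ) *ᵥ p) = p ⬝ᵥ (A *ᵥ z) := by
    rw [← Matrix.mulVec_mulVec, hpY, dotProduct_mulVec_transpose, Matrix.transpose_transpose,
      dotProduct_comm]
  have e4 : p ⬝ᵥ ((Y * (Cᵀ * E⁻¹ * C - a • R) * Y) *ᵥ p)
      = (C *ᵥ z) ⬝ᵥ (E⁻¹ *ᵥ (C *ᵥ z)) - a * (z ⬝ᵥ (R *ᵥ z)) := by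
    rw [← Matrix.mulVec_mulVec, hz, ← Matrix.mulVec_mulVec, hpY, Matrix.sub_mulVec,
      dotProduct_sub, ← Matrix.mulVec_mulVec, ← Matrix.mulVec_mulVec, dotProduct_mulVec_transpose,
      Matrix.transpose_transpose, Matrix.smul_mulVec, dotProduct_smul, smul_eq_mul]
  have e5 : p ⬝ᵥ ((B * Bᵀ) *ᵥ p) = (Bᵀ *ᵥ p) ⬝ᵥ (Bᵀ *ᵥ p) := by
    rw [← Matrix.mulVec_mulVec, dotProduct_mulVec_transpose]
  have e6 : p ⬝ᵥ (B *ᵥ w) = (Bᵀ *ᵥ p) ⬝ᵥ w := dotProduct_mulVec_transpose _ _ _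
  have e7 := two_mul_dotProduct_le (Bᵀ *ᵥ p) w
  rw [dotProduct_sub, dotProduct_add, e1, e6, Matrix.add_mulVec, Matrix.sub_mulVec,
    Matrix.add_mulVec, dotProduct_add, dotProduct_sub, dotProduct_add, e2, e3, e4, e5]
  linarith

end

/-! ### Output blocks of a node and the quadratic form of the network -/

namespace Network

variable {N n m : ℕ} (S : Network N n m)

theorem U_posDef {Z : S.EdgeWeights} {i j : Fin N} (hZ : (Z i j).PosDef) : (S.U Z i j).PosDef := by
  have h := Matrix.posSemidef_self_mul_conjTranspose (S.H i j)
  exact hZ.posSemidef_add h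

/-- The measurement and the channels decouple in the weight, so its inverse can be studied
blockwise. The square root enters only through its product with its transpose. -/
theorem bE_eq_fromBlocks {Z : S.EdgeWeights} {i : Fin N} (hZ : ∀ j ∈ S.nbr i, (Z i j).PosDef)
    (t : ℝ) :
    S.bE Z i t = Matrix.fromBlocks (S.D i t * (S.D i t)ᵀ) 0 0
      (Matrix.blockDiagonal' fun j : S.nbr i => S.U Z i j) := by
  have hsq : ∀ j : S.nbr i, CFC.sqrt (Z i j) * (CFC.sqrt (Z i j))ᵀ = Z i j := fun j => by
    have h0 : 0 ≤ Z i j := (hZ j j.2).posSemidef.nonneg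
    have h1 : (CFC.sqrt (Z i j))ᵀ = CFC.sqrt (Z i j) :=
      (Matrix.nonneg_iff_posSemidef.1 (CFC.sqrt_nonneg (Z i j))).1
    rw [h1]
    exact CFC.sqrt_mul_sqrt_self _ h0
  rw [bE, bD, Matrix.fromBlocks_transpose, Matrix.fromBlocks_multiply]
  have hH : (Matrix.blockDiagonal' fun j : S.nbr i => S.H i j)
      * (Matrix.blockDiagonal' fun j : S.nbr i => S.H i j)ᵀ
      = Matrix.blockDiagonal' fun j : S.nbr i => S.H i j * (S.H i j)ᵀ := by
    rw [Matrix.blockDiagonal'_transpose, ← Matrix.blockDiagonal'_mul]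
  have hW : (Matrix.blockDiagonal' fun j : S.nbr i => CFC.sqrt (Z i j))
      * (Matrix.blockDiagonal' fun j : S.nbr i => CFC.sqrt (Z i j))ᵀ
      = Matrix.blockDiagonal' fun j : S.nbr i => Z i j := by
    rw [Matrix.blockDiagonal'_transpose, ← Matrix.blockDiagonal'_mul]
    simp only [hsq]
  simp only [Matrix.transpose_zero, Matrix.mul_zero, Matrix.zero_mul, add_zero, zero_add,
    Matrix.transpose_fromCols, Matrix.fromCols_mul_fromRows, hH, hW]
  rw [← Matrix.blockDiagonal'_add]
  rfl

/-- The output disturbance of node `i` in the error system with errors `δ`. -/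
def outputDist (i : Fin N) (t : ℝ) (v : Fin (S.q i) → ℝ) (vc : ∀ j, Fin (S.qc i j) → ℝ)
    (δ : Fin N → Fin n → ℝ) : S.Out i → ℝ :=
  Sum.elim (S.D i t *ᵥ v) fun jk => (S.H i jk.1 *ᵥ vc jk.1 - S.W i jk.1 *ᵥ δ jk.1) jk.2

theorem dotProduct_out {i : Fin N} (x y : S.Out i → ℝ) :
    x ⬝ᵥ y = (fun a => x (Sum.inl a)) ⬝ᵥ (fun a => y (Sum.inl a))
      + ∑ j : S.nbr i, (fun b => x (Sum.inr ⟨j, b⟩)) ⬝ᵥ (fun b => y (Sum.inr ⟨j, b⟩)) := by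
  simp only [dotProduct, Fintype.sum_sum_type, Fintype.sum_sigma]

/-- With `g = E⁻¹C₁δᵢ`, the channel block is `gⱼ = Uᵢⱼ⁻¹Wᵢⱼδᵢ`. Its square is `gⱼ'Uᵢⱼgⱼ = |Hᵢⱼ'gⱼ|²
+ gⱼ'Zᵢⱼgⱼ`. The first part absorbs the channel noise, and the second is kept and sums to the form
of `Δᵢ`. The neighbours' errors enter through the output disturbance and give the coupling terms. -/
theorem output_dissipation {Z : S.EdgeWeights} {i : Fin N} {t : ℝ}
    (hZ : ∀ j ∈ S.nbr i, (Z i j).PosDef) (hE : (S.bE Z i t).PosDef) (v : Fin (S.q i) → ℝ)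
    (vc : ∀ j, Fin (S.qc i j) → ℝ) (δ : Fin N → Fin n → ℝ) :
    -((S.bC1 i t *ᵥ δ i) ⬝ᵥ ((S.bE Z i t)⁻¹ *ᵥ (S.bC1 i t *ᵥ δ i)))
        - 2 * (((S.bE Z i t)⁻¹ *ᵥ (S.bC1 i t *ᵥ δ i)) ⬝ᵥ S.outputDist i t v vc δ)
      ≤ v ⬝ᵥ v + ∑ j ∈ S.nbr i, vc j ⬝ᵥ vc j - δ i ⬝ᵥ (S.Δ Z i *ᵥ δ i)
        + 2 * ∑ j ∈ S.nbr i, δ i ⬝ᵥ (((S.W i j)ᵀ * (S.U Z i j)⁻¹ * S.W i j) *ᵥ δ j) := by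
  set c := S.bC1 i t *ᵥ δ i with hc
  set g := (S.bE Z i t)⁻¹ *ᵥ c with hg
  set g₀ : Fin (S.p i) → ℝ := fun a => g (Sum.inl a) with hg₀
  set g₁ : ∀ j : S.nbr i, Fin (S.pc i j) → ℝ := fun j b => g (Sum.inr ⟨j, b⟩) with hg₁
  have hEg : S.bE Z i t *ᵥ g = c := by
    rw [hg, Matrix.mulVec_mulVec, Matrix.mul_nonsing_inv _ (isUnit_iff_ne_zero.2 hE.det_pos.ne'),
      Matrix.one_mulVec]
  rw [S.bE_eq_fromBlocks hZ] at hEg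
  have hc0 : (fun a => c (Sum.inl a)) = S.C i t *ᵥ δ i := rfl
  have hc1 : ∀ j : S.nbr i, (fun b => c (Sum.inr ⟨j, b⟩)) = S.W i j *ᵥ δ i := fun j => rfl
  have h0 : (S.D i t * (S.D i t)ᵀ) *ᵥ g₀ = S.C i t *ᵥ δ i := by
    rw [← hc0]
    funext a
    rw [← hEg, Matrix.fromBlocks_mulVec, Sum.elim_inl, Matrix.zero_mulVec, add_zero]
    rfl
  have h1 : ∀ j : S.nbr i, S.U Z i j *ᵥ g₁ j = S.W i j *ᵥ δ i := fun j => by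
    rw [← hc1]
    funext b
    rw [← hEg, Matrix.fromBlocks_mulVec, Sum.elim_inr, Matrix.zero_mulVec, zero_add]
    simp only [Matrix.mulVec, dotProduct, Fintype.sum_sigma]
    rw [Finset.sum_eq_single j (fun k _ hk => Finset.sum_eq_zero fun d _ => by
      rw [Matrix.blockDiagonal'_apply_ne _ _ _ hk.symm, zero_mul]) (by simp)]
    simp only [Matrix.blockDiagonal'_apply_eq]
    rfl
  have h1' : ∀ j : S.nbr i, g₁ j = (S.U Z i j)⁻¹ *ᵥ (S.W i j *ᵥ δ i) := fun j => by
    rw [← h1 j, Matrix.mulVec_mulVec, Matrix.nonsing_inv_mul _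
      (isUnit_iff_ne_zero.2 (S.U_posDef (hZ j j.2)).det_pos.ne'), Matrix.one_mulVec]
  have hUs : ∀ j : S.nbr i, ((S.U Z i j)⁻¹)ᵀ = (S.U Z i j)⁻¹ := fun j =>
    (S.U_posDef (hZ j j.2)).inv.1
  have k0 : -((S.C i t *ᵥ δ i) ⬝ᵥ g₀) - 2 * (g₀ ⬝ᵥ (S.D i t *ᵥ v)) ≤ v ⬝ᵥ v := by
    have e1 : (S.C i t *ᵥ δ i) ⬝ᵥ g₀ = ((S.D i t)ᵀ *ᵥ g₀) ⬝ᵥ ((S.D i t)ᵀ *ᵥ g₀) := by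
      rw [← h0, dotProduct_comm, ← Matrix.mulVec_mulVec, dotProduct_mulVec_transpose]
    have e2 := two_mul_dotProduct_le (-((S.D i t)ᵀ *ᵥ g₀)) v
    rw [neg_dotProduct_neg, neg_dotProduct] at e2
    rw [e1, dotProduct_mulVec_transpose (S.D i t) g₀ v]
    linarith
  have k1 : ∀ j : S.nbr i,
      -((S.W i j *ᵥ δ i) ⬝ᵥ g₁ j) - 2 * (g₁ j ⬝ᵥ (S.H i j *ᵥ vc j - S.W i j *ᵥ δ j))
      ≤ vc j ⬝ᵥ vc j
        - δ i ⬝ᵥ (((S.W i j)ᵀ * (S.U Z i j)⁻¹ * Z i j * (S.U Z i j)⁻¹ * S.W i j) *ᵥ δ i)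
        + 2 * (δ i ⬝ᵥ (((S.W i j)ᵀ * (S.U Z i j)⁻¹ * S.W i j) *ᵥ δ j)) := fun j => by
    have e1 : (S.W i j *ᵥ δ i) ⬝ᵥ g₁ j
        = ((S.H i j)ᵀ *ᵥ g₁ j) ⬝ᵥ ((S.H i j)ᵀ *ᵥ g₁ j) + g₁ j ⬝ᵥ (Z i j *ᵥ g₁ j) := by
      rw [← h1 j, dotProduct_comm, U, Matrix.add_mulVec, dotProduct_add, ← Matrix.mulVec_mulVec,
        dotProduct_mulVec_transpose]
    have e2 := two_mul_dotProduct_le (-((S.H i j)ᵀ *ᵥ g₁ j)) (vc j)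
    rw [neg_dotProduct_neg, neg_dotProduct] at e2
    have e3 : δ i ⬝ᵥ (((S.W i j)ᵀ * (S.U Z i j)⁻¹ * Z i j * (S.U Z i j)⁻¹ * S.W i j) *ᵥ δ i)
        = g₁ j ⬝ᵥ (Z i j *ᵥ g₁ j) := by
      simp only [← Matrix.mulVec_mulVec]
      rw [dotProduct_mulVec_transpose, Matrix.transpose_transpose, dotProduct_mulVec_transpose,
        hUs, ← h1' j]
    have e4 : δ i ⬝ᵥ (((S.W i j)ᵀ * (S.U Z i j)⁻¹ * S.W i j) *ᵥ δ j)
        = g₁ j ⬝ᵥ (S.W i j *ᵥ δ j) := by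
      simp only [← Matrix.mulVec_mulVec]
      rw [dotProduct_mulVec_transpose, Matrix.transpose_transpose, dotProduct_mulVec_transpose,
        hUs, ← h1' j]
    rw [e1, e3, e4, dotProduct_sub, dotProduct_mulVec_transpose (S.H i j)]
    linarith
  have hsum := Finset.sum_le_sum fun (j : S.nbr i) (_ : j ∈ Finset.univ) => k1 j
  rw [Finset.sum_add_distrib, Finset.sum_sub_distrib, Finset.sum_sub_distrib,
    Finset.sum_neg_distrib, ← Finset.mul_sum, ← Finset.mul_sum] at hsum
  have s1 : ∑ j : S.nbr i, vc j ⬝ᵥ vc j = ∑ j ∈ S.nbr i, vc j ⬝ᵥ vc j :=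
    Finset.sum_coe_sort (S.nbr i) fun j => vc j ⬝ᵥ vc j
  have s2 : ∑ j : S.nbr i,
      δ i ⬝ᵥ (((S.W i j)ᵀ * (S.U Z i j)⁻¹ * Z i j * (S.U Z i j)⁻¹ * S.W i j) *ᵥ δ i)
      = δ i ⬝ᵥ (S.Δ Z i *ᵥ δ i) := by
    rw [Δ, Matrix.sum_mulVec, dotProduct_sum]
    exact Finset.sum_coe_sort (S.nbr i) fun j =>
      δ i ⬝ᵥ (((S.W i j)ᵀ * (S.U Z i j)⁻¹ * Z i j * (S.U Z i j)⁻¹ * S.W i j) *ᵥ δ i)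
  have s3 : ∑ j : S.nbr i, δ i ⬝ᵥ (((S.W i j)ᵀ * (S.U Z i j)⁻¹ * S.W i j) *ᵥ δ j)
      = ∑ j ∈ S.nbr i, δ i ⬝ᵥ (((S.W i j)ᵀ * (S.U Z i j)⁻¹ * S.W i j) *ᵥ δ j) :=
    Finset.sum_coe_sort (S.nbr i) fun j =>
      δ i ⬝ᵥ (((S.W i j)ᵀ * (S.U Z i j)⁻¹ * S.W i j) *ᵥ δ j)
  rw [s1, s2, s3] at hsum
  have d1 : c ⬝ᵥ g = (S.C i t *ᵥ δ i) ⬝ᵥ g₀ + ∑ j : S.nbr i, (S.W i j *ᵥ δ i) ⬝ᵥ g₁ j :=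
    S.dotProduct_out c g
  have d2 : g ⬝ᵥ S.outputDist i t v vc δ = g₀ ⬝ᵥ (S.D i t *ᵥ v)
      + ∑ j : S.nbr i, g₁ j ⬝ᵥ (S.H i j *ᵥ vc j - S.W i j *ᵥ δ j) :=
    S.dotProduct_out g _
  rw [d1, d2]
  linarith

theorem ofBlocks_quadForm (M : Matrix (Fin N) (Fin N) (Matrix (Fin n) (Fin n) ℝ))
    (δ : Fin N → Fin n → ℝ) :
    (fun a : Fin N × Fin n => δ a.1 a.2) ⬝ᵥ (ofBlocks M *ᵥ fun a => δ a.1 a.2)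
      = ∑ i, ∑ j, δ i ⬝ᵥ (M i j *ᵥ δ j) := by
  simp only [dotProduct, Matrix.mulVec, Fintype.sum_prod_type, ofBlocks, Matrix.of_apply,
    Finset.mul_sum]
  refine Finset.sum_congr rfl fun i _ => ?_
  rw [Finset.sum_comm]

theorem ofBlocks_diagonal_quadForm (M : Fin N → Matrix (Fin n) (Fin n) ℝ)
    (δ : Fin N → Fin n → ℝ) :
    (fun a : Fin N × Fin n => δ a.1 a.2) ⬝ᵥ
        (ofBlocks (Matrix.diagonal M) *ᵥ fun a => δ a.1 a.2)
      = ∑ i, δ i ⬝ᵥ (M i *ᵥ δ i) := by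
  rw [ofBlocks_quadForm]
  refine Finset.sum_congr rfl fun i _ => ?_
  rw [Finset.sum_eq_single i (fun j _ hj => by
    rw [Matrix.diagonal_apply_ne _ hj.symm]; simp) (by simp), Matrix.diagonal_apply_eq]

theorem lmi_quadForm (Z : S.EdgeWeights) (γ : ℝ) (R : Fin N → Matrix (Fin n) (Fin n) ℝ)
    (δ : Fin N → Fin n → ℝ) :
    (fun a : Fin N × Fin n => δ a.1 a.2) ⬝ᵥ (S.lmi Z γ R *ᵥ fun a => δ a.1 a.2)
      = ∑ i, δ i ⬝ᵥ (R i *ᵥ δ i) + γ ^ 2 * ∑ i, (δ i ⬝ᵥ (S.Δ Z i *ᵥ δ i)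
        - 2 * ∑ j ∈ S.nbr i, δ i ⬝ᵥ (((S.W i j)ᵀ * (S.U Z i j)⁻¹ * S.W i j) *ᵥ δ j)) := by
  have hΦ : (fun a : Fin N × Fin n => δ a.1 a.2) ⬝ᵥ (S.Φ Z *ᵥ fun a => δ a.1 a.2)
      = ∑ i, (δ i ⬝ᵥ (S.Δ Z i *ᵥ δ i)
        - ∑ j ∈ S.nbr i, δ i ⬝ᵥ (((S.W i j)ᵀ * (S.U Z i j)⁻¹ * S.W i j) *ᵥ δ j)) := by
    rw [Φ, ofBlocks_quadForm]
    refine Finset.sum_congr rfl fun i _ => ?_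
    -- The nested cases separate into two independent ones because a node is not its own neighbour.
    have h1 : ∀ j, δ i ⬝ᵥ ((if i = j then S.Δ Z i
        else if j ∈ S.nbr i then -((S.W i j)ᵀ * (S.U Z i j)⁻¹ * S.W i j) else 0) *ᵥ δ j)
        = (if i = j then δ i ⬝ᵥ (S.Δ Z i *ᵥ δ i) else 0)
          - if j ∈ S.nbr i then
              δ i ⬝ᵥ (((S.W i j)ᵀ * (S.U Z i j)⁻¹ * S.W i j) *ᵥ δ j) else 0 := fun j => by
      by_cases hij : i = j
      · subst hij
        simp [S.not_mem_nbr i]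
      · by_cases hj : j ∈ S.nbr i
        · simp [hij, hj, Matrix.neg_mulVec]
        · simp [hij, hj]
    simp only [Matrix.of_apply, h1, Finset.sum_sub_distrib, Finset.sum_ite_eq, Finset.mem_univ,
      if_true, Finset.sum_ite_mem, Finset.univ_inter]
  have hΦt : (fun a : Fin N × Fin n => δ a.1 a.2) ⬝ᵥ ((S.Φ Z)ᵀ *ᵥ fun a => δ a.1 a.2)
      = (fun a : Fin N × Fin n => δ a.1 a.2) ⬝ᵥ (S.Φ Z *ᵥ fun a => δ a.1 a.2) := by
    rw [dotProduct_mulVec_transpose, Matrix.transpose_transpose, dotProduct_comm]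
  rw [lmi, Matrix.add_mulVec, dotProduct_add, ofBlocks_diagonal_quadForm, Matrix.smul_mulVec,
    dotProduct_smul, Matrix.sub_mulVec, Matrix.add_mulVec, dotProduct_sub, dotProduct_add, hΦt,
    hΦ, ofBlocks_diagonal_quadForm, smul_eq_mul]
  congr 2
  simp only [Finset.sum_sub_distrib, ← Finset.mul_sum]
  ring

end Network

end ResilientObserver

namespace ResilientObserver

/-! ### Error dynamics -/

section

variable {ι J : Type*} [Fintype ι] [Fintype J]

theorem observer_error_algebra {α φ : Type*} [Fintype α] [Fintype φ] {β : J → Type*}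
    [∀ j, Fintype (β j)] (A : Matrix ι ι ℝ) (F : Matrix ι φ ℝ) (L : Matrix ι α ℝ)
    (K : ∀ j, Matrix ι (β j) ℝ) (x xh b : ι → ℝ) (f p : φ → ℝ) (s : α → ℝ) (r : ∀ j, β j → ℝ) :
    A *ᵥ x + b - (A *ᵥ xh + L *ᵥ s + ∑ j, K j *ᵥ r j + F *ᵥ f - F *ᵥ p)
      = A *ᵥ (x - xh) + (b + F *ᵥ (p - f)) - (L *ᵥ s + ∑ j, K j *ᵥ r j) := by
  simp only [Matrix.mulVec_sub]
  abel

/-- Subtracting the detector state adds `L̄` to `L` and `K̄` to `K`, both acting on the residual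
innovations. This is why the detector gains are differences `L̂ - L`, `K̂ - K`: the error sees
exactly the Riccati gain. -/
theorem detector_error_algebra {α φ : Type*} [Fintype α] [Fintype φ] {β : J → Type*}
    [∀ j, Fintype (β j)] (A : Matrix ι ι ℝ) (F : Matrix ι φ ℝ) (C : Matrix α ι ℝ)
    (L Lb : Matrix ι α ℝ) (K Kb : ∀ j, Matrix ι (β j) ℝ) (W : ∀ j, Matrix (β j) ι ℝ)
    (x xh eh b : ι → ℝ) (ej : J → ι → ℝ) (f p : φ → ℝ) (s : α → ℝ) (r : ∀ j, β j → ℝ) :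
    A *ᵥ x + b - (A *ᵥ xh + L *ᵥ s + ∑ j, K j *ᵥ r j + F *ᵥ f - F *ᵥ p)
      - ((A - L * C - ∑ j, K j * W j) *ᵥ eh + ∑ j, (K j * W j) *ᵥ ej j
        + Lb *ᵥ (s - C *ᵥ eh) + ∑ j, Kb j *ᵥ (r j - W j *ᵥ (eh - ej j)))
      = A *ᵥ (x - xh - eh) + (b + F *ᵥ (p - f))
        - ((L + Lb) *ᵥ (s - C *ᵥ eh) + ∑ j, (K j + Kb j) *ᵥ (r j - W j *ᵥ (eh - ej j))) := by
  simp only [Matrix.mulVec_sub, Matrix.sub_mulVec, Matrix.add_mulVec, Matrix.sum_mulVec,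
    Finset.sum_add_distrib, Finset.sum_sub_distrib, ← Matrix.mulVec_mulVec]
  abel

end

namespace Network

variable {N n m : ℕ} {S : Network N n m}

/-- Splits the stacked gain into its measurement and channel columns; the map `g` selects all rows,
or the rows of one component of the extended state. -/
theorem submatrix_mulVec_out {κ κ' : Type*} {i : Fin N} (M : Matrix κ (S.Out i) ℝ)
    (g : κ' → κ) (x : S.Out i → ℝ) (a : κ') :
    (M *ᵥ x) (g a) = ((Matrix.of fun a b => M (g a) (Sum.inl b)) *ᵥ fun b => x (Sum.inl b)) a
      + ∑ j : S.nbr i, ((Matrix.of fun a b => M (g a) (Sum.inr ⟨j, b⟩))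
          *ᵥ fun b => x (Sum.inr ⟨j, b⟩)) a :=
  S.dotProduct_out _ _

/-- Error `δ_i = e_i - ê_i` of the detector at node `i`. -/
def States.detErr (σ : S.States) (i : Fin N) (t : ℝ) : Fin n → ℝ :=
  σ.x t - σ.xhat i t - σ.ehat i t

/-- Error `ε_i - ε̂_i` of the detector at node `i`. -/
def States.epsErr (σ : S.States) (i : Fin N) (t : ℝ) : Fin (S.ne i) → ℝ :=
  σ.eps i t - σ.epshat i t

/-- Stacked detector error of node `i`. -/
def States.extErr (σ : S.States) (i : Fin N) (t : ℝ) : S.Ext i → ℝ :=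
  Sum.elim (σ.detErr i t) (σ.epsErr i t)

theorem States.φ_sub_eq (σ : S.States) (u : S.Inputs) (i : Fin N) (t : ℝ) :
    σ.φ i t - u.f i t = σ.ν u i t - S.Υ i *ᵥ σ.epsErr i t := by
  simp only [States.φ, States.ν, States.epsErr, Matrix.mulVec_sub]
  abel

theorem innovation_eq (σ : S.States) (u : S.Inputs) (i : Fin N) (t : ℝ) :
    (fun b => (S.bC1 i t *ᵥ σ.err i t
      + S.outputDist i t (u.v i t) (fun j => u.vc i j t) (fun j => σ.err j t)) (Sum.inl b))
      = σ.ζ u i t ∧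
    ∀ j : S.nbr i, (fun b => (S.bC1 i t *ᵥ σ.err i t
      + S.outputDist i t (u.v i t) (fun j => u.vc i j t) (fun j => σ.err j t)) (Sum.inr ⟨j, b⟩))
      = σ.ζc u i j t := by
  constructor
  · change S.C i t *ᵥ σ.err i t + S.D i t *ᵥ u.v i t = _
    simp only [States.ζ, States.err, Matrix.mulVec_sub]
    abel
  · intro j
    change S.W i j *ᵥ σ.err i t + (S.H i j *ᵥ u.vc i j t - S.W i j *ᵥ σ.err j t) = _
    simp only [States.ζc, States.err, Matrix.mulVec_sub]
    abel

theorem detector_innovation_eq (σ : S.States) (u : S.Inputs) (i : Fin N) (t : ℝ) :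
    (fun b => (S.bC i t *ᵥ σ.extErr i t
      + S.outputDist i t (u.v i t) (fun j => u.vc i j t) (fun j => σ.detErr j t)) (Sum.inl b))
      = σ.ζ u i t - S.C i t *ᵥ σ.ehat i t ∧
    ∀ j : S.nbr i, (fun b => (S.bC i t *ᵥ σ.extErr i t
      + S.outputDist i t (u.v i t) (fun j => u.vc i j t) (fun j => σ.detErr j t))
        (Sum.inr ⟨j, b⟩))
      = σ.ζc u i j t - S.W i j *ᵥ (σ.ehat i t - σ.ehat j t) := by
  have h : S.bC i t *ᵥ σ.extErr i t = S.bC1 i t *ᵥ σ.detErr i t := by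
    rw [bC, States.extErr, Matrix.fromCols_mulVec_sumElim, Matrix.zero_mulVec, add_zero]
  rw [h]
  constructor
  · change S.C i t *ᵥ σ.detErr i t + S.D i t *ᵥ u.v i t = _
    simp only [States.ζ, States.detErr, Matrix.mulVec_sub]
    abel
  · intro j
    change S.W i j *ᵥ σ.detErr i t + (S.H i j *ᵥ u.vc i j t - S.W i j *ᵥ σ.detErr j t) = _
    simp only [States.ζc, States.detErr, Matrix.mulVec_sub]
    abel

variable {Z Zb : S.EdgeWeights} {Y : ∀ i, ℝ → Matrix (S.Ext i) (S.Ext i) ℝ}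
  {Yb : Fin N → ℝ → Matrix (Fin n) (Fin n) ℝ} {u : S.Inputs} {x₀ : Fin n → ℝ}
  {ξ : Fin N → Fin n → ℝ} {σ : S.States}

theorem IsTrajectory.solves_err (h : IsTrajectory (S.designGains Z Zb Y Yb) u x₀ ξ σ)
    (i : Fin N) :
    SolvesVec (σ.err i) (x₀ - ξ i) fun t =>
      S.A t *ᵥ σ.err i t + S.bB1 i t *ᵥ Sum.elim (u.w t) (σ.φ i t - u.f i t)
        - (Yb i t * (S.bC1 i t)ᵀ * (S.bE Zb i t)⁻¹) *ᵥ (S.bC1 i t *ᵥ σ.err i t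
          + S.outputDist i t (u.v i t) (fun j => u.vc i j t) (fun j => σ.err j t)) := by
  refine (h.plant.sub (h.observer i)).congr fun t _ => ?_
  rw [observer_error_algebra, bB1, Matrix.fromCols_mulVec_sumElim]
  funext a
  obtain ⟨h1, h2⟩ := innovation_eq σ u i t
  rw [Pi.sub_apply, Pi.sub_apply, submatrix_mulVec_out _ fun a => a, h1]
  simp only [h2]
  simp only [Pi.add_apply, Finset.sum_apply]
  rfl

theorem IsTrajectory.solves_extErr (h : IsTrajectory (S.designGains Z Zb Y Yb) u x₀ ξ σ)
    (i : Fin N) :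
    SolvesVec (σ.extErr i) (Sum.elim (x₀ - ξ i) 0) fun t =>
      S.bA i t *ᵥ σ.extErr i t + S.bB i t *ᵥ Sum.elim (u.w t) (σ.ν u i t)
        - (Y i t * (S.bC i t)ᵀ * (S.bE Z i t)⁻¹) *ᵥ (S.bC i t *ᵥ σ.extErr i t
          + S.outputDist i t (u.v i t) (fun j => u.vc i j t) (fun j => σ.detErr j t)) := by
  have e1 := (h.plant.sub (h.observer i)).sub (h.detector i)
  have e2 := (h.attackModel i).sub (h.detector' i)
  rw [sub_zero] at e1 e2
  intro a
  rcases a with a | a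
  · have e3 := (e1 a).congr (k := fun t =>
      (S.bA i t *ᵥ σ.extErr i t + S.bB i t *ᵥ Sum.elim (u.w t) (σ.ν u i t)
        - (Y i t * (S.bC i t)ᵀ * (S.bE Z i t)⁻¹) *ᵥ (S.bC i t *ᵥ σ.extErr i t
          + S.outputDist i t (u.v i t) (fun j => u.vc i j t) (fun j => σ.detErr j t)))
        (Sum.inl a)) fun t _ => by
      obtain ⟨h1, h2⟩ := detector_innovation_eq σ u i t
      have hL : (S.designGains Z Zb Y Yb).L i t + (S.designGains Z Zb Y Yb).barL i t
          = Matrix.of fun a b => S.detectorGain Z Y i t (Sum.inl a) (Sum.inl b) := by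
        ext a b
        simp [designGains]
      have hK : ∀ j, (S.designGains Z Zb Y Yb).K i j t + (S.designGains Z Zb Y Yb).barK i j t
          = Matrix.of fun a b => S.detectorGain Z Y i t (Sum.inl a) (Sum.inr ⟨j, b⟩) := fun j => by
        ext a b
        simp [designGains]
      -- The residual attack splits into the exogenous mismatch and a state-dependent part, the
      -- latter being the off-diagonal block of `bA`.
      have hF : S.F i *ᵥ (σ.φ i t - u.f i t)
          = S.F i *ᵥ σ.ν u i t + (-(S.F i * S.Υ i)) *ᵥ σ.epsErr i t := by
        rw [States.φ_sub_eq, Matrix.mulVec_sub, Matrix.mulVec_mulVec, Matrix.neg_mulVec,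
          sub_eq_add_neg]
      have := detector_error_algebra (S.A t) (S.F i) (S.C i t)
        ((S.designGains Z Zb Y Yb).L i t) ((S.designGains Z Zb Y Yb).barL i t)
        (fun j => (S.designGains Z Zb Y Yb).K i j t)
        (fun j => (S.designGains Z Zb Y Yb).barK i j t) (fun j : S.nbr i => S.W i j) (σ.x t)
        (σ.xhat i t) (σ.ehat i t) (S.B t *ᵥ u.w t) (fun j => σ.ehat j t) (u.f i t) (σ.φ i t)
        (σ.ζ u i t) (fun j => σ.ζc u i j t)
      refine (congrFun this a).trans ?_
      rw [hF]
      simp only [hL, hK]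
      rw [Pi.sub_apply, Pi.sub_apply, submatrix_mulVec_out _ Sum.inl, h1]
      simp only [h2]
      simp only [States.extErr, bA, bB, Matrix.fromBlocks_mulVec, Pi.add_apply,
        Finset.sum_apply, Sum.elim_inl, Sum.elim_comp_inl, Sum.elim_comp_inr]
      change _ = (S.A t *ᵥ σ.detErr i t) a + _ + _ - _
      simp only [detectorGain, States.detErr]
      ring
    exact e3
  · have e3 := (e2 a).congr (k := fun t =>
      (S.bA i t *ᵥ σ.extErr i t + S.bB i t *ᵥ Sum.elim (u.w t) (σ.ν u i t)
        - (Y i t * (S.bC i t)ᵀ * (S.bE Z i t)⁻¹) *ᵥ (S.bC i t *ᵥ σ.extErr i t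
          + S.outputDist i t (u.v i t) (fun j => u.vc i j t) (fun j => σ.detErr j t)))
        (Sum.inr a)) fun t _ => by
      obtain ⟨h1, h2⟩ := detector_innovation_eq σ u i t
      beta_reduce
      rw [Pi.sub_apply, Pi.sub_apply, submatrix_mulVec_out _ Sum.inr, h1]
      simp only [h2]
      simp only [States.extErr, bA, bB, Matrix.fromBlocks_mulVec, Pi.add_apply,
        Finset.sum_apply, Sum.elim_inr, Sum.elim_comp_inl, Sum.elim_comp_inr, Matrix.zero_mulVec,
        zero_add, States.epsErr, Matrix.mulVec_sub, Pi.sub_apply, designGains, detectorGain]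
      ring
    exact e3

end Network

end ResilientObserver

namespace ResilientObserver

/-! ### Bounds for quadratic forms -/

section

theorem exists_pos_forall_le {ι : Type*} [Fintype ι] {f : ι → ℝ} (hf : ∀ i, 0 < f i) :
    ∃ c : ℝ, 0 < c ∧ ∀ i, c ≤ f i := by
  have h0 : ∀ i, 0 ≤ (f i)⁻¹ := fun i => (inv_pos.2 (hf i)).le
  have h1 : 0 ≤ ∑ i, (f i)⁻¹ := Finset.sum_nonneg fun i _ => h0 i
  -- The inverse of a sum of inverses lies below every `f i`; the added `1` covers an empty index
  -- type.
  refine ⟨(1 + ∑ i, (f i)⁻¹)⁻¹, by positivity, fun i => ?_⟩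
  rw [inv_le_comm₀ (by positivity) (hf i)]
  linarith [Finset.single_le_sum (fun j _ => h0 j) (Finset.mem_univ i)]

theorem exists_pos_forall_ge {ι : Type*} [Fintype ι] {f : ι → ℝ} (hf : ∀ i, 0 < f i) :
    ∃ c : ℝ, 0 < c ∧ ∀ i, f i ≤ c := by
  have h1 : 0 ≤ ∑ i, f i := Finset.sum_nonneg fun i _ => (hf i).le
  exact ⟨1 + ∑ i, f i, by positivity, fun i => by
    linarith [Finset.single_le_sum (fun j _ => (hf j).le) (Finset.mem_univ i)]⟩

variable {ι : Type*} [Fintype ι]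

theorem _root_.Matrix.PosSemidef.quadForm_nonneg {M : Matrix ι ι ℝ} (hM : M.PosSemidef)
    (x : ι → ℝ) : 0 ≤ x ⬝ᵥ (M *ᵥ x) :=
  hM.dotProduct_mulVec_nonneg x

theorem sumElim_dotProduct_self {κ : Type*} [Fintype κ] (x : ι → ℝ) (y : κ → ℝ) :
    Sum.elim x y ⬝ᵥ Sum.elim x y = x ⬝ᵥ x + y ⬝ᵥ y :=
  sumElim_dotProduct_sumElim _ _ _ _

theorem fromBlocks_diagonal_quadForm {κ : Type*} [Fintype κ] (M : Matrix ι ι ℝ) (M' : Matrix κ κ ℝ)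
    (x : ι → ℝ) (y : κ → ℝ) :
    Sum.elim x y ⬝ᵥ (Matrix.fromBlocks M 0 0 M' *ᵥ Sum.elim x y)
      = x ⬝ᵥ (M *ᵥ x) + y ⬝ᵥ (M' *ᵥ y) := by
  rw [Matrix.fromBlocks_mulVec, Sum.elim_comp_inl, Sum.elim_comp_inr,
    sumElim_dotProduct_sumElim, Matrix.zero_mulVec, Matrix.zero_mulVec, add_zero, zero_add]

variable [DecidableEq ι]

theorem _root_.Matrix.PosDef.mulVec_inv_mulVec {M : Matrix ι ι ℝ} (hM : M.PosDef) (x : ι → ℝ) :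
    M *ᵥ (M⁻¹ *ᵥ x) = x := by
  rw [Matrix.mulVec_mulVec, Matrix.mul_nonsing_inv _ (isUnit_iff_ne_zero.2 hM.det_pos.ne'),
    Matrix.one_mulVec]

/-- `s (2 x'x - s x'Mx) ≤ x'M⁻¹x`. -/
theorem _root_.Matrix.PosDef.le_inv_quadForm {M : Matrix ι ι ℝ} (hM : M.PosDef) (s : ℝ)
    (x : ι → ℝ) : s * (2 * (x ⬝ᵥ x) - s * (x ⬝ᵥ (M *ᵥ x))) ≤ x ⬝ᵥ (M⁻¹ *ᵥ x) := by
  -- Expanding `(M⁻¹x - s x)'M(M⁻¹x - s x) ≥ 0` gives the bound without spectral theory.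
  have h := hM.posSemidef.quadForm_nonneg (M⁻¹ *ᵥ x - s • x)
  rw [Matrix.mulVec_sub, hM.mulVec_inv_mulVec, Matrix.mulVec_smul, sub_dotProduct, dotProduct_sub,
    dotProduct_sub, dotProduct_smul, dotProduct_smul, smul_dotProduct, smul_dotProduct,
    dotProduct_mulVec_transpose M, show Mᵀ = M from hM.1, hM.mulVec_inv_mulVec,
    dotProduct_comm _ x] at h
  simp only [smul_eq_mul] at h
  linarith

/-- An upper bound `K` for the form of `M⁻¹` becomes the lower bound `K⁻¹` for that of `M`, through
the preceding inequality applied to `M⁻¹` with `s = K⁻¹`. -/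
theorem _root_.Matrix.PosDef.exists_le_quadForm {M : Matrix ι ι ℝ} (hM : M.PosDef) :
    ∃ c : ℝ, 0 < c ∧ ∀ x : ι → ℝ, c * (x ⬝ᵥ x) ≤ x ⬝ᵥ (M *ᵥ x) := by
  obtain ⟨K, hK, h⟩ := exists_quadForm_le M⁻¹
  refine ⟨K⁻¹, by positivity, fun x => ?_⟩
  have h1 := hM.inv.le_inv_quadForm K⁻¹ x
  rw [Matrix.nonsing_inv_nonsing_inv _ (isUnit_iff_ne_zero.2 hM.det_pos.ne')] at h1
  have h2 : K⁻¹ * (x ⬝ᵥ (M⁻¹ *ᵥ x)) ≤ x ⬝ᵥ x := by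
    rw [inv_mul_le_iff₀ hK]
    exact h x
  have h3 := mul_le_mul_of_nonneg_left h2 (inv_pos.2 hK).le
  linarith

theorem UniformlyPosDef.posDef {Y : ℝ → Matrix ι ι ℝ} (h : UniformlyPosDef Y) {t : ℝ}
    (ht : 0 ≤ t) : (Y t).PosDef := by
  obtain ⟨α₁, _, h1, _, h⟩ := h
  have := (h t ht).1.add (Matrix.PosDef.one.smul h1)
  rwa [sub_add_cancel] at this

theorem UniformlyPosDef.inv_quadForm_bounds {Y : ℝ → Matrix ι ι ℝ} (h : UniformlyPosDef Y) :
    ∃ b c : ℝ, 0 < b ∧ 0 < c ∧ ∀ t, 0 ≤ t → ∀ x : ι → ℝ,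
      b * (x ⬝ᵥ x) ≤ x ⬝ᵥ ((Y t)⁻¹ *ᵥ x) ∧ x ⬝ᵥ ((Y t)⁻¹ *ᵥ x) ≤ c * (x ⬝ᵥ x) := by
  have hpos := fun t (ht : 0 ≤ t) => h.posDef ht
  obtain ⟨α₁, α₂, h1, h2, h⟩ := h
  refine ⟨α₂⁻¹, α₁⁻¹, by positivity, by positivity, fun t ht x => ⟨?_, ?_⟩⟩
  · have e1 := (hpos t ht).le_inv_quadForm α₂⁻¹ x
    have e2 := (h t ht).2.posSemidef.quadForm_nonneg x
    rw [Matrix.sub_mulVec, Matrix.smul_mulVec, Matrix.one_mulVec, dotProduct_sub, dotProduct_smul,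
      smul_eq_mul, sub_nonneg] at e2
    rw [← inv_mul_le_iff₀ h2] at e2
    have e3 := mul_le_mul_of_nonneg_left e2 (inv_pos.2 h2).le
    linarith
  · set p := (Y t)⁻¹ *ᵥ x with hp
    have hz : Y t *ᵥ p = x := (hpos t ht).mulVec_inv_mulVec x
    have e2 := (h t ht).1.posSemidef.quadForm_nonneg p
    rw [Matrix.sub_mulVec, hz, Matrix.smul_mulVec, Matrix.one_mulVec, dotProduct_sub,
      dotProduct_smul, smul_eq_mul, dotProduct_comm p x] at e2
    -- Combining `|α₁p - x|² ≥ 0` with `α₁|p|² ≤ p'x` yields `α₁ x'p ≤ |x|²`.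
    have e3 := dotProduct_self_nonneg_real (α₁ • p - x)
    rw [sub_dotProduct, dotProduct_sub, dotProduct_sub, dotProduct_smul, dotProduct_smul,
      smul_dotProduct, smul_dotProduct, dotProduct_comm p x] at e3
    simp only [smul_eq_mul] at e3
    rw [le_inv_mul_iff₀ h1]
    nlinarith [mul_nonneg h1.le e2]

theorem inv_fromBlocks_diagonal {κ : Type*} [Fintype κ] [DecidableEq κ] {X : Matrix ι ι ℝ}
    {X' : Matrix κ κ ℝ} (hX : X.PosDef) (hX' : X'.PosDef) :
    (Matrix.fromBlocks X 0 0 X')⁻¹ = Matrix.fromBlocks X⁻¹ 0 0 X'⁻¹ := by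
  refine Matrix.inv_eq_right_inv ?_
  rw [Matrix.fromBlocks_multiply, Matrix.mul_nonsing_inv _ (isUnit_iff_ne_zero.2 hX.det_pos.ne'),
    Matrix.mul_nonsing_inv _ (isUnit_iff_ne_zero.2 hX'.det_pos.ne')]
  simp

end

namespace Network

variable {N n m : ℕ} {S : Network N n m}

/-! ### Storage functions -/

/-- Stacked detector error. -/
def States.stackedDetErr (σ : S.States) (t : ℝ) : Fin N × Fin n → ℝ := fun a => σ.detErr a.1 t a.2

theorem dotProduct_stacked (δ : Fin N → Fin n → ℝ) :
    (fun a : Fin N × Fin n => δ a.1 a.2) ⬝ᵥ (fun a => δ a.1 a.2) = ∑ i, δ i ⬝ᵥ δ i := by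
  simp only [dotProduct, Fintype.sum_prod_type]

variable {Z Zb : S.EdgeWeights} {γ γb : ℝ} {R X : Fin N → Matrix (Fin n) (Fin n) ℝ}
  {Rc Xc : ∀ i, Matrix (Fin (S.ne i)) (Fin (S.ne i)) ℝ}
  {Y : ∀ i, ℝ → Matrix (S.Ext i) (S.Ext i) ℝ}
  {P : Matrix (Fin N × Fin n) (Fin N × Fin n) ℝ}
  {Rb Xb : Fin N → Matrix (Fin n) (Fin n) ℝ} {Yb : Fin N → ℝ → Matrix (Fin n) (Fin n) ℝ}
  {u : S.Inputs} {x₀ : Fin n → ℝ} {ξ : Fin N → Fin n → ℝ} {σ : S.States}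

/-- `‖w‖² + ‖v_i‖² + ∑_j ‖v_ij‖²`. -/
def Inputs.power (u : S.Inputs) (i : Fin N) (t : ℝ) : ℝ :=
  u.w t ⬝ᵥ u.w t + u.v i t ⬝ᵥ u.v i t + ∑ j ∈ S.nbr i, u.vc i j t ⬝ᵥ u.vc i j t

/-- The nodewise estimates are added so that the neighbour couplings assemble into the network LMI.
The states `εᵢ` and `ε̂ᵢ` both start at zero, so `X̌ᵢ` does not appear in the initial value. -/
theorem DetectorConditions.dissipation (hdet : S.DetectorConditions Z γ R Rc X Xc Y)
    (h : IsTrajectory (S.designGains Z Zb Y Yb) u x₀ ξ σ) :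
    ∃ g, Solves (fun t => ∑ i, σ.extErr i t ⬝ᵥ ((Y i t)⁻¹ *ᵥ σ.extErr i t))
        (∑ i, (x₀ - ξ i) ⬝ᵥ ((X i)⁻¹ *ᵥ (x₀ - ξ i))) g ∧
      ∀ t, 0 ≤ t → g t ≤ ∑ i, (u.power i t + σ.ν u i t ⬝ᵥ σ.ν u i t)
        - 1 / γ ^ 2 * (σ.stackedDetErr t ⬝ᵥ (S.lmi Z γ R *ᵥ σ.stackedDetErr t)
          + ∑ i, σ.epsErr i t ⬝ᵥ (Rc i *ᵥ σ.epsErr i t)) := by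
  have hV := fun i => (h.solves_extErr i).quadForm_inv (hdet.riccati i)
    fun t ht => (hdet.bounded i).posDef ht
  have hV0 : ∀ i, (Sum.elim (x₀ - ξ i) (0 : Fin (S.ne i) → ℝ))
      ⬝ᵥ ((Matrix.fromBlocks (X i) 0 0 (Xc i))⁻¹ *ᵥ Sum.elim (x₀ - ξ i) 0)
      = (x₀ - ξ i) ⬝ᵥ ((X i)⁻¹ *ᵥ (x₀ - ξ i)) := fun i => by
    rw [inv_fromBlocks_diagonal (hdet.X_pos i) (hdet.Xc_pos i), fromBlocks_diagonal_quadForm,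
      zero_dotProduct, add_zero]
  simp only [hV0] at hV
  refine ⟨_, Solves.sum (s := Finset.univ) fun i _ => hV i, fun t ht => ?_⟩
  have key : ∀ i, 2 * (((Y i t)⁻¹ *ᵥ σ.extErr i t) ⬝ᵥ
        (S.bA i t *ᵥ σ.extErr i t + S.bB i t *ᵥ Sum.elim (u.w t) (σ.ν u i t)
        - (Y i t * (S.bC i t)ᵀ * (S.bE Z i t)⁻¹) *ᵥ (S.bC i t *ᵥ σ.extErr i t
          + S.outputDist i t (u.v i t) (fun j => u.vc i j t) (fun j => σ.detErr j t))))
      - ((Y i t)⁻¹ *ᵥ σ.extErr i t) ⬝ᵥ ((S.bA i t * Y i t + Y i t * (S.bA i t)ᵀ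
        - Y i t * ((S.bC i t)ᵀ * (S.bE Z i t)⁻¹ * S.bC i t
          - (1 / γ ^ 2) • Matrix.fromBlocks (R i) 0 0 (Rc i)) * Y i t
        + S.bB i t * (S.bB i t)ᵀ) *ᵥ ((Y i t)⁻¹ *ᵥ σ.extErr i t))
      ≤ (u.power i t + σ.ν u i t ⬝ᵥ σ.ν u i t)
        - 1 / γ ^ 2 * (σ.detErr i t ⬝ᵥ (R i *ᵥ σ.detErr i t)
          + σ.epsErr i t ⬝ᵥ (Rc i *ᵥ σ.epsErr i t))
        - (σ.detErr i t ⬝ᵥ (S.Δ Z i *ᵥ σ.detErr i t) - 2 * ∑ j ∈ S.nbr i,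
          σ.detErr i t ⬝ᵥ (((S.W i j)ᵀ * (S.U Z i j)⁻¹ * S.W i j) *ᵥ σ.detErr j t)) := fun i => by
    have h1 := riccati_dissipation (S.bA i t) (Matrix.fromBlocks (R i) 0 0 (Rc i)) (Y i t)
      (S.bB i t) (S.bC i t) (S.bE Z i t) (1 / γ ^ 2) (σ.extErr i t)
      (Sum.elim (u.w t) (σ.ν u i t))
      (S.outputDist i t (u.v i t) (fun j => u.vc i j t) (fun j => σ.detErr j t))
      ((hdet.bounded i).posDef ht) (hdet.E_pos i t ht)
    have h2 := S.output_dissipation (hdet.Z_pos i) (hdet.E_pos i t ht) (u.v i t)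
      (fun j => u.vc i j t) (fun j => σ.detErr j t)
    have h3 : S.bC i t *ᵥ σ.extErr i t = S.bC1 i t *ᵥ σ.detErr i t := by
      rw [bC, States.extErr, Matrix.fromCols_mulVec_sumElim, Matrix.zero_mulVec, add_zero]
    have h4 : σ.extErr i t ⬝ᵥ (Matrix.fromBlocks (R i) 0 0 (Rc i) *ᵥ σ.extErr i t)
        = σ.detErr i t ⬝ᵥ (R i *ᵥ σ.detErr i t) + σ.epsErr i t ⬝ᵥ (Rc i *ᵥ σ.epsErr i t) :=
      fromBlocks_diagonal_quadForm _ _ _ _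
    rw [h4, sumElim_dotProduct_self] at h1
    refine h1.trans ?_
    rw [h3, Inputs.power]
    linarith
  refine (Finset.sum_le_sum fun i _ => key i).trans (le_of_eq ?_)
  have hl := S.lmi_quadForm Z γ R (fun i => σ.detErr i t)
  have hγ : γ ≠ 0 := hdet.gamma_pos.ne'
  rw [show σ.stackedDetErr t = fun a => σ.detErr a.1 t a.2 from rfl, hl]
  simp only [Finset.sum_sub_distrib, Finset.sum_add_distrib, ← Finset.mul_sum]
  field_simp
  ring

/-- The same summation as for the detectors, with the residual attack `φᵢ - fᵢ` in the role of the
mismatch. -/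
theorem ObserverConditions.dissipation (hobs : S.ObserverConditions P Zb γb Rb Xb Yb)
    (h : IsTrajectory (S.designGains Z Zb Y Yb) u x₀ ξ σ) :
    ∃ g, Solves (fun t => ∑ i, σ.err i t ⬝ᵥ ((Yb i t)⁻¹ *ᵥ σ.err i t))
        (∑ i, (x₀ - ξ i) ⬝ᵥ ((Xb i)⁻¹ *ᵥ (x₀ - ξ i))) g ∧
      ∀ t, 0 ≤ t → g t ≤
        ∑ i, (u.power i t + (σ.φ i t - u.f i t) ⬝ᵥ (σ.φ i t - u.f i t))
        - 1 / γb ^ 2 * (σ.stackedErr t ⬝ᵥ (S.lmi Zb γb Rb *ᵥ σ.stackedErr t)) := by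
  refine ⟨_, Solves.sum (s := Finset.univ) fun i _ => (h.solves_err i).quadForm_inv
    (hobs.riccati i) fun t ht => (hobs.bounded i).posDef ht, fun t ht => ?_⟩
  have key : ∀ i, 2 * (((Yb i t)⁻¹ *ᵥ σ.err i t) ⬝ᵥ
        (S.A t *ᵥ σ.err i t + S.bB1 i t *ᵥ Sum.elim (u.w t) (σ.φ i t - u.f i t)
        - (Yb i t * (S.bC1 i t)ᵀ * (S.bE Zb i t)⁻¹) *ᵥ (S.bC1 i t *ᵥ σ.err i t
          + S.outputDist i t (u.v i t) (fun j => u.vc i j t) (fun j => σ.err j t))))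
      - ((Yb i t)⁻¹ *ᵥ σ.err i t) ⬝ᵥ ((S.A t * Yb i t + Yb i t * (S.A t)ᵀ
        - Yb i t * ((S.bC1 i t)ᵀ * (S.bE Zb i t)⁻¹ * S.bC1 i t
          - (1 / γb ^ 2) • Rb i) * Yb i t
        + S.bB1 i t * (S.bB1 i t)ᵀ) *ᵥ ((Yb i t)⁻¹ *ᵥ σ.err i t))
      ≤ (u.power i t + (σ.φ i t - u.f i t) ⬝ᵥ (σ.φ i t - u.f i t))
        - 1 / γb ^ 2 * (σ.err i t ⬝ᵥ (Rb i *ᵥ σ.err i t))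
        - (σ.err i t ⬝ᵥ (S.Δ Zb i *ᵥ σ.err i t) - 2 * ∑ j ∈ S.nbr i,
          σ.err i t ⬝ᵥ (((S.W i j)ᵀ * (S.U Zb i j)⁻¹ * S.W i j) *ᵥ σ.err j t)) := fun i => by
    have h1 := riccati_dissipation (S.A t) (Rb i) (Yb i t)
      (S.bB1 i t) (S.bC1 i t) (S.bE Zb i t) (1 / γb ^ 2) (σ.err i t)
      (Sum.elim (u.w t) (σ.φ i t - u.f i t))
      (S.outputDist i t (u.v i t) (fun j => u.vc i j t) (fun j => σ.err j t))
      ((hobs.bounded i).posDef ht) (hobs.E_pos i t ht)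
    have h2 := S.output_dissipation (hobs.Z_pos i) (hobs.E_pos i t ht) (u.v i t)
      (fun j => u.vc i j t) (fun j => σ.err j t)
    rw [sumElim_dotProduct_self] at h1
    refine h1.trans ?_
    rw [Inputs.power]
    linarith
  refine (Finset.sum_le_sum fun i _ => key i).trans (le_of_eq ?_)
  have hl := S.lmi_quadForm Zb γb Rb (fun i => σ.err i t)
  have hγ : γb ≠ 0 := hobs.gamma_pos.ne'
  rw [show σ.stackedErr t = fun a => σ.err a.1 t a.2 from rfl, hl]
  simp only [Finset.sum_sub_distrib, Finset.sum_add_distrib, ← Finset.mul_sum]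
  field_simp
  ring

end Network

end ResilientObserver

namespace ResilientObserver

namespace Network

variable {N n m : ℕ} {S : Network N n m} {Z Zb : S.EdgeWeights} {γ γb : ℝ}
  {R X : Fin N → Matrix (Fin n) (Fin n) ℝ}
  {Rc Xc : ∀ i, Matrix (Fin (S.ne i)) (Fin (S.ne i)) ℝ}
  {Y : ∀ i, ℝ → Matrix (S.Ext i) (S.Ext i) ℝ}
  {P : Matrix (Fin N × Fin n) (Fin N × Fin n) ℝ}
  {Rb Xb : Fin N → Matrix (Fin n) (Fin n) ℝ} {Yb : Fin N → ℝ → Matrix (Fin n) (Fin n) ℝ}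

/-! ### Exponential convergence -/

theorem Inputs.IsZero.ν_eq_zero {u : S.Inputs} {x₀ : Fin n → ℝ} {ξ : Fin N → Fin n → ℝ}
    {σ : S.States} {g : S.Gains} (hu : u.IsZero) (h : IsTrajectory g u x₀ ξ σ) (i : Fin N) {t : ℝ}
    (ht : 0 ≤ t) : σ.ν u i t = 0 := by
  have h1 : ∀ t, 0 ≤ t → σ.ν u i t = S.Υ i *ᵥ σ.eps i t := fun t ht => by
    rw [States.ν, (hu t ht).2.2.2 i, sub_zero]
  have h2 : SolvesVec (σ.eps i) 0 fun t => (S.Ω i + S.Γ i * S.Υ i) *ᵥ σ.eps i t :=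
    (h.attackModel i).congr fun t ht => by
      rw [h1 t ht, Matrix.add_mulVec, Matrix.mulVec_mulVec]
  rw [h1 t ht, h2.eq_zero ht, Matrix.mulVec_zero]

theorem Inputs.IsZero.power_eq_zero {u : S.Inputs} (hu : u.IsZero) (i : Fin N) {t : ℝ}
    (ht : 0 ≤ t) : u.power i t = 0 := by
  obtain ⟨h1, h2, h3, -⟩ := hu t ht
  rw [Inputs.power, h1, h2 i, Finset.sum_eq_zero fun j hj => by rw [h3 i j hj, zero_dotProduct]]
  simp

theorem States.extErr_dotProduct_self (σ : S.States) (i : Fin N) (t : ℝ) :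
    σ.extErr i t ⬝ᵥ σ.extErr i t
      = σ.detErr i t ⬝ᵥ σ.detErr i t + σ.epsErr i t ⬝ᵥ σ.epsErr i t :=
  sumElim_dotProduct_self _ _

/-- Makes the dissipation rate coercive in the whole extended error: the LMI controls `eᵢ - êᵢ`, and
`Řᵢ > Υᵢ'Υᵢ ≥ 0` controls `εᵢ - ε̂ᵢ`. -/
theorem DetectorConditions.exists_le_quadForm (hdet : S.DetectorConditions Z γ R Rc X Xc Y) :
    ∃ c : ℝ, 0 < c ∧ ∀ (σ : S.States) (t : ℝ),
      c * ∑ i, σ.extErr i t ⬝ᵥ σ.extErr i t ≤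
        σ.stackedDetErr t ⬝ᵥ (S.lmi Z γ R *ᵥ σ.stackedDetErr t)
          + ∑ i, σ.epsErr i t ⬝ᵥ (Rc i *ᵥ σ.epsErr i t) := by
  obtain ⟨c₁, hc₁, h₁⟩ := hdet.lmi_pos.exists_le_quadForm
  have hRc : ∀ i, (Rc i).PosDef := fun i => by
    have := (hdet.lmi_pos' i).add_posSemidef (Matrix.posSemidef_conjTranspose_mul_self (S.Υ i))
    rwa [Matrix.conjTranspose_eq_transpose_of_trivial, sub_add_cancel] at this
  choose c hc hcle using fun i => (hRc i).exists_le_quadForm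
  obtain ⟨c₂, hc₂, h₂⟩ := exists_pos_forall_le hc
  refine ⟨min c₁ c₂, lt_min hc₁ hc₂, fun σ t => ?_⟩
  simp only [States.extErr_dotProduct_self]
  rw [Finset.sum_add_distrib, mul_add]
  refine add_le_add ?_ ?_
  · have e1 := h₁ (σ.stackedDetErr t)
    have e2 : σ.stackedDetErr t ⬝ᵥ σ.stackedDetErr t = ∑ i, σ.detErr i t ⬝ᵥ σ.detErr i t :=
      dotProduct_stacked fun i => σ.detErr i t
    rw [e2] at e1
    exact (mul_le_mul_of_nonneg_right (min_le_left _ _)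
      (Finset.sum_nonneg fun i _ => dotProduct_self_nonneg_real _)).trans e1
  · rw [Finset.mul_sum]
    exact Finset.sum_le_sum fun i _ => (mul_le_mul_of_nonneg_right
      ((min_le_right _ _).trans (h₂ i)) (dotProduct_self_nonneg_real _)).trans (hcle i _)

theorem ObserverConditions.exists_le_quadForm (hobs : S.ObserverConditions P Zb γb Rb Xb Yb)
    (hP : P.PosSemidef) :
    ∃ c : ℝ, 0 < c ∧ ∀ (σ : S.States) (t : ℝ),
      c * ∑ i, σ.err i t ⬝ᵥ σ.err i t ≤
        σ.stackedErr t ⬝ᵥ (S.lmi Zb γb Rb *ᵥ σ.stackedErr t) := by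
  have h := hobs.lmi_pos.add_posSemidef hP
  rw [sub_add_cancel] at h
  obtain ⟨c, hc, h⟩ := h.exists_le_quadForm
  refine ⟨c, hc, fun σ t => ?_⟩
  have e2 : σ.stackedErr t ⬝ᵥ σ.stackedErr t = ∑ i, σ.err i t ⬝ᵥ σ.err i t :=
    dotProduct_stacked fun i => σ.err i t
  rw [← e2]
  exact h _

theorem exists_sum_quadForm_le {κ : Fin N → Type*} [∀ i, Fintype (κ i)]
    (M : ∀ i, Matrix (κ i) (κ i) ℝ) :
    ∃ K : ℝ, 0 < K ∧ ∀ x : ∀ i, κ i → ℝ,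
      ∑ i, x i ⬝ᵥ (M i *ᵥ x i) ≤ K * ∑ i, x i ⬝ᵥ x i := by
  choose k hk hkle using fun i => exists_quadForm_le (M i)
  obtain ⟨K, hK, hle⟩ := exists_pos_forall_ge hk
  refine ⟨K, hK, fun x => ?_⟩
  rw [Finset.mul_sum]
  exact Finset.sum_le_sum fun i _ => (hkle i _).trans
    (mul_le_mul_of_nonneg_right (hle i) (dotProduct_self_nonneg_real _))

theorem sum_inv_quadForm_bounds {κ : Fin N → Type*} [∀ i, Fintype (κ i)] [∀ i, DecidableEq (κ i)]
    {Y : ∀ i, ℝ → Matrix (κ i) (κ i) ℝ} (h : ∀ i, UniformlyPosDef (Y i)) :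
    ∃ b c : ℝ, 0 < b ∧ 0 < c ∧ ∀ t, 0 ≤ t → ∀ x : ∀ i, κ i → ℝ,
      b * ∑ i, x i ⬝ᵥ x i ≤ ∑ i, x i ⬝ᵥ ((Y i t)⁻¹ *ᵥ x i) ∧
      ∑ i, x i ⬝ᵥ ((Y i t)⁻¹ *ᵥ x i) ≤ c * ∑ i, x i ⬝ᵥ x i := by
  choose b c hb hc h using fun i => (h i).inv_quadForm_bounds
  obtain ⟨b', hb', hbl⟩ := exists_pos_forall_le hb
  obtain ⟨c', hc', hcl⟩ := exists_pos_forall_ge hc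
  refine ⟨b', c', hb', hc', fun t ht x => ⟨?_, ?_⟩⟩
  · rw [Finset.mul_sum]
    exact Finset.sum_le_sum fun i _ => (mul_le_mul_of_nonneg_right (hbl i)
      (dotProduct_self_nonneg_real _)).trans (h i t ht _).1
  · rw [Finset.mul_sum]
    exact Finset.sum_le_sum fun i _ => (h i t ht _).2.trans (mul_le_mul_of_nonneg_right (hcl i)
      (dotProduct_self_nonneg_real _))

/-- Turns a coercive dissipation rate into a decay rate for the storage function. -/
theorem mul_div_mul_le_mul {a c B V E Q : ℝ} (ha : 0 ≤ a) (hc : 0 ≤ c) (hB : 0 < B)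
    (hV : V ≤ B * E) (hQ : c * E ≤ Q) : a * c / B * V ≤ a * Q := by
  have h1 : V / B ≤ E := by
    rw [div_le_iff₀ hB]
    linarith
  have h2 := mul_le_mul_of_nonneg_left ((mul_le_mul_of_nonneg_left h1 hc).trans hQ) ha
  refine le_trans (le_of_eq ?_) h2
  ring

/-- Without disturbances and attacks the corrections `φ_i` decay exponentially. -/
theorem DetectorConditions.exp_decay (hdet : S.DetectorConditions Z γ R Rc X Xc Y) :
    ∃ K c : ℝ, 0 < K ∧ 0 < c ∧
      ∀ (u : S.Inputs) (x₀ : Fin n → ℝ) (ξ : Fin N → Fin n → ℝ) (σ : S.States), u.IsZero →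
        IsTrajectory (S.designGains Z Zb Y Yb) u x₀ ξ σ → ∀ t, 0 ≤ t →
        ∑ i, (σ.φ i t - u.f i t) ⬝ᵥ (σ.φ i t - u.f i t)
          ≤ K * (∑ i, (x₀ - ξ i) ⬝ᵥ (x₀ - ξ i)) * Real.exp (-c * t) := by
  obtain ⟨c, hc, hq⟩ := hdet.exists_le_quadForm
  obtain ⟨b, B, hb, hB, hYb⟩ := sum_inv_quadForm_bounds hdet.bounded
  obtain ⟨k, hk, hX⟩ := exists_sum_quadForm_le fun i => (X i)⁻¹
  obtain ⟨l, hl, hΥ⟩ := exists_sum_quadForm_le fun i => (S.Υ i)ᵀ * S.Υ i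
  have hγ := hdet.gamma_pos
  have hr : 0 < 1 / γ ^ 2 * c / B := by positivity
  -- The rate is halved because `Solves.gronwall` asks for strict inequality between the two rates.
  refine ⟨l * (b⁻¹ * k), 1 / γ ^ 2 * c / B / 2, by positivity, by positivity,
    fun u x₀ ξ σ hu h t ht => ?_⟩
  obtain ⟨g, hV, hg⟩ := hdet.dissipation h
  have hV0 : 0 ≤ ∑ i, (x₀ - ξ i) ⬝ᵥ ((X i)⁻¹ *ᵥ (x₀ - ξ i)) :=
    Finset.sum_nonneg fun i _ => (hdet.X_pos i).inv.posSemidef.quadForm_nonneg _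
  have h1 := hV.gronwall (c := 1 / γ ^ 2 * c / B) (a := 1 / γ ^ 2 * c / B / 2) (K := 0)
    (by linarith) le_rfl hV0 (fun t ht => by
      refine (hg t ht).trans ?_
      have e1 : ∑ i, (u.power i t + σ.ν u i t ⬝ᵥ σ.ν u i t) = 0 :=
        Finset.sum_eq_zero fun i _ => by
          rw [hu.power_eq_zero i ht, hu.ν_eq_zero h i ht, zero_dotProduct, add_zero]
      have e2 := (hYb t ht fun i => σ.extErr i t).2
      have e3 := hq σ t
      rw [e1, zero_sub, zero_mul, add_zero, neg_mul, neg_le_neg_iff]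
      exact mul_div_mul_le_mul (by positivity) hc.le hB e2 e3) ht
  rw [zero_div, add_zero] at h1
  have h2 := (hYb t ht fun i => σ.extErr i t).1
  have h3 := hX fun i => x₀ - ξ i
  have h4 : ∑ i, σ.epsErr i t ⬝ᵥ σ.epsErr i t ≤ ∑ i, σ.extErr i t ⬝ᵥ σ.extErr i t :=
    Finset.sum_le_sum fun i _ => by
      rw [States.extErr_dotProduct_self]
      linarith [dotProduct_self_nonneg_real (σ.detErr i t)]
  have h5 : ∀ i, (σ.φ i t - u.f i t) ⬝ᵥ (σ.φ i t - u.f i t)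
      = σ.epsErr i t ⬝ᵥ (((S.Υ i)ᵀ * S.Υ i) *ᵥ σ.epsErr i t) := fun i => by
    rw [States.φ_sub_eq, hu.ν_eq_zero h i ht, zero_sub, neg_dotProduct_neg,
      ← Matrix.mulVec_mulVec, dotProduct_mulVec_transpose (S.Υ i)ᵀ,
      Matrix.transpose_transpose]
  simp only [h5]
  refine (hΥ fun i => σ.epsErr i t).trans ?_
  rw [mul_assoc, mul_assoc, mul_assoc]
  refine mul_le_mul_of_nonneg_left (h4.trans ?_) hl.le
  rw [le_inv_mul_iff₀ hb, ← mul_assoc]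
  exact h2.trans (h1.trans (mul_le_mul_of_nonneg_right h3 (Real.exp_pos _).le))

theorem exponential_convergence (hP : P.PosSemidef)
    (hdet : S.DetectorConditions Z γ R Rc X Xc Y)
    (hobs : S.ObserverConditions P Zb γb Rb Xb Yb) :
    ∃ M r : ℝ, 0 < M ∧ 0 < r ∧
      ∀ (u : S.Inputs) (x₀ : Fin n → ℝ) (ξ : Fin N → Fin n → ℝ) (σ : S.States),
        u.IsZero → IsTrajectory (S.designGains Z Zb Y Yb) u x₀ ξ σ →
        ∀ i t, 0 ≤ t → eNorm (σ.err i t) ≤ M * Real.exp (-r * t) * ∑ j, eNorm (x₀ - ξ j) := by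
  obtain ⟨K, a, hK, ha, hφ⟩ := hdet.exp_decay (Zb := Zb) (Yb := Yb)
  obtain ⟨c, hc, hq⟩ := hobs.exists_le_quadForm hP
  obtain ⟨b, B, hb, hB, hYb⟩ := sum_inv_quadForm_bounds hobs.bounded
  obtain ⟨k, hk, hX⟩ := exists_sum_quadForm_le fun i => (Xb i)⁻¹
  have hγ := hobs.gamma_pos
  set s := 1 / γb ^ 2 * c / B with hs
  have hspos : 0 < s := by positivity
  -- The rate must not exceed that of the corrections `φᵢ` and must stay strictly below the
  -- observers' own rate `s`.
  set r := min a (s / 2) with hr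
  have hrpos : 0 < r := lt_min ha (by positivity)
  have hrs : r < s := (min_le_right _ _).trans_lt (by linarith)
  have hsr : 0 < s - r := sub_pos.2 hrs
  -- The storage function is quadratic in the error: the square root of the constant and half the
  -- rate remain for the norm.
  refine ⟨Real.sqrt (b⁻¹ * (k + K / (s - r))), r / 2, by positivity, by positivity,
    fun u x₀ ξ σ hu h i t ht => ?_⟩
  obtain ⟨g, hV, hg⟩ := hobs.dissipation h
  set q := ∑ i, (x₀ - ξ i) ⬝ᵥ (x₀ - ξ i) with hq0
  have hqnn : 0 ≤ q := Finset.sum_nonneg fun i _ => dotProduct_self_nonneg_real _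
  have hV0 : 0 ≤ ∑ i, (x₀ - ξ i) ⬝ᵥ ((Xb i)⁻¹ *ᵥ (x₀ - ξ i)) :=
    Finset.sum_nonneg fun i _ => (hobs.X_pos i).inv.posSemidef.quadForm_nonneg _
  have h1 := hV.gronwall (c := s) (a := r) (K := K * q) hrs (by positivity) hV0
    (fun t ht => by
      refine (hg t ht).trans ?_
      have e1 : ∑ i, (u.power i t + (σ.φ i t - u.f i t) ⬝ᵥ (σ.φ i t - u.f i t))
          ≤ K * q * Real.exp (-r * t) := by
        have : ∀ i, u.power i t = 0 := fun i => hu.power_eq_zero i ht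
        simp only [this, zero_add]
        refine (hφ u x₀ ξ σ hu h t ht).trans (mul_le_mul_of_nonneg_left ?_ (by positivity))
        rw [Real.exp_le_exp]
        nlinarith [min_le_left a (s / 2)]
      have e2 := (hYb t ht fun i => σ.err i t).2
      have e3 := hq σ t
      have e4 : s * ∑ i, σ.err i t ⬝ᵥ ((Yb i t)⁻¹ *ᵥ σ.err i t)
          ≤ 1 / γb ^ 2 * (σ.stackedErr t ⬝ᵥ (S.lmi Zb γb Rb *ᵥ σ.stackedErr t)) :=
        mul_div_mul_le_mul (by positivity) hc.le hB e2 e3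
      linarith) ht
  have h2 := (hYb t ht fun i => σ.err i t).1
  have h3 : σ.err i t ⬝ᵥ σ.err i t ≤ ∑ i, σ.err i t ⬝ᵥ σ.err i t :=
    Finset.single_le_sum (f := fun i => σ.err i t ⬝ᵥ σ.err i t)
      (fun i _ => dotProduct_self_nonneg_real _) (Finset.mem_univ i)
  have h4 : σ.err i t ⬝ᵥ σ.err i t
      ≤ b⁻¹ * (k + K / (s - r)) * (Real.exp (-(r / 2) * t) ^ 2 * q) := by
    have e1 : Real.exp (-(r / 2) * t) ^ 2 = Real.exp (-r * t) := by
      rw [← Real.exp_nat_mul]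
      congr 1
      push_cast
      ring
    rw [e1, mul_assoc]
    refine h3.trans ?_
    rw [le_inv_mul_iff₀ hb]
    refine h2.trans (h1.trans ?_)
    have e2 := mul_le_mul_of_nonneg_right (hX fun i => x₀ - ξ i) (Real.exp_pos (-r * t)).le
    have e3 : (k + K / (s - r)) * (Real.exp (-r * t) * q)
        = k * q * Real.exp (-r * t) + K * q / (s - r) * Real.exp (-r * t) := by ring
    rw [e3, add_mul]
    linarith
  have h5 : q ≤ (∑ j, eNorm (x₀ - ξ j)) ^ 2 := by
    have e1 : q = ∑ j, eNorm (x₀ - ξ j) ^ 2 := Finset.sum_congr rfl fun j _ =>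
      (Real.sq_sqrt (dotProduct_self_nonneg_real _)).symm
    rw [e1]
    exact Finset.sum_sq_le_sq_sum_of_nonneg fun j _ => Real.sqrt_nonneg _
  have h6 : 0 ≤ ∑ j, eNorm (x₀ - ξ j) := Finset.sum_nonneg fun j _ => Real.sqrt_nonneg _
  refine Real.sqrt_le_iff.2 ⟨by positivity, h4.trans ?_⟩
  rw [mul_pow, mul_pow, Real.sq_sqrt (by positivity), mul_assoc _ (Real.exp _ ^ 2)]
  gcongr

end Network

end ResilientObserver

namespace ResilientObserver

namespace Network

variable {N n m : ℕ} {S : Network N n m} {Z Zb : S.EdgeWeights} {γ γb : ℝ}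
  {R X : Fin N → Matrix (Fin n) (Fin n) ℝ}
  {Rc Xc : ∀ i, Matrix (Fin (S.ne i)) (Fin (S.ne i)) ℝ}
  {Y : ∀ i, ℝ → Matrix (S.Ext i) (S.Ext i) ℝ}
  {P : Matrix (Fin N × Fin n) (Fin N × Fin n) ℝ}
  {Rb Xb : Fin N → Matrix (Fin n) (Fin n) ℝ} {Yb : Fin N → ℝ → Matrix (Fin n) (Fin n) ℝ}
  {u : S.Inputs} {x₀ : Fin n → ℝ} {ξ : Fin N → Fin n → ℝ} {σ : S.States}

/-! ### Attenuation of disturbances -/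

theorem Inputs.IsAdmissible.integrableOn_power (hu : u.IsAdmissible) (i : Fin N) :
    IntegrableOn (u.power i) (Ici (0 : ℝ)) :=
  (hu.w.2.add (hu.v i).2).add (integrable_finsetSum _ fun j hj => (hu.vc i j hj).2)

theorem _root_.ResilientObserver.continuousOn_quadForm {ι : Type*} [Fintype ι] {z : ℝ → ι → ℝ}
    {s : Set ℝ} (hz : ContinuousOn z s) (M : Matrix ι ι ℝ) :
    ContinuousOn (fun t => z t ⬝ᵥ (M *ᵥ z t)) s := by
  have : Continuous fun x : ι → ℝ => x ⬝ᵥ (M *ᵥ x) := by fun_prop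
  exact this.comp_continuousOn hz

theorem _root_.ResilientObserver.integrableOn_of_le {f g : ℝ → ℝ}
    (hf : ContinuousOn f (Ici (0 : ℝ))) (hg : IntegrableOn g (Ici (0 : ℝ)))
    (h : ∀ t, 0 ≤ t → 0 ≤ f t ∧ f t ≤ g t) : IntegrableOn f (Ici (0 : ℝ)) := by
  refine Integrable.mono' hg (hf.aestronglyMeasurable measurableSet_Ici)
    (ae_restrict_of_forall_mem measurableSet_Ici fun t ht => ?_)
  rw [Real.norm_of_nonneg (h t ht).1]
  exact (h t ht).2

theorem _root_.ResilientObserver.sum_integral_add {ι : Type*} [Fintype ι] {f g : ι → ℝ → ℝ}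
    (hf : ∀ i, IntegrableOn (f i) (Ici (0 : ℝ))) (hg : ∀ i, IntegrableOn (g i) (Ici (0 : ℝ))) :
    ∑ i, ((∫ t in Ici (0 : ℝ), f i t) + ∫ t in Ici (0 : ℝ), g i t)
      = ∫ t in Ici (0 : ℝ), ∑ i, (f i t + g i t) := by
  simp only [← integral_add (hf _) (hg _)]
  exact (integral_finsetSum _ fun i _ => (hf i).add (hg i)).symm

theorem IsTrajectory.continuousOn_extErr (h : IsTrajectory (S.designGains Z Zb Y Yb) u x₀ ξ σ)
    (i : Fin N) : ContinuousOn (σ.extErr i) (Ici 0) :=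
  (h.solves_extErr i).continuousOn

theorem IsTrajectory.continuousOn_epsErr (h : IsTrajectory (S.designGains Z Zb Y Yb) u x₀ ξ σ)
    (i : Fin N) : ContinuousOn (σ.epsErr i) (Ici 0) :=
  continuousOn_pi.2 fun a => continuousOn_pi.1 (h.continuousOn_extErr i) (Sum.inr a)

theorem IsTrajectory.continuousOn_stackedDetErr
    (h : IsTrajectory (S.designGains Z Zb Y Yb) u x₀ ξ σ) :
    ContinuousOn σ.stackedDetErr (Ici 0) :=
  continuousOn_pi.2 fun a => continuousOn_pi.1 (h.continuousOn_extErr a.1) (Sum.inl a.2)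

theorem IsTrajectory.continuousOn_err (h : IsTrajectory (S.designGains Z Zb Y Yb) u x₀ ξ σ)
    (i : Fin N) : ContinuousOn (σ.err i) (Ici 0) :=
  (h.solves_err i).continuousOn

theorem IsTrajectory.continuousOn_stackedErr
    (h : IsTrajectory (S.designGains Z Zb Y Yb) u x₀ ξ σ) :
    ContinuousOn σ.stackedErr (Ici 0) :=
  continuousOn_pi.2 fun a => continuousOn_pi.1 (h.continuousOn_err a.1) a.2

/-- The detectors attenuate the disturbances and the mismatch of the attack models. -/
theorem DetectorConditions.attenuation (hdet : S.DetectorConditions Z γ R Rc X Xc Y)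
    (h : IsTrajectory (S.designGains Z Zb Y Yb) u x₀ ξ σ) (hu : u.IsAdmissible)
    (hν : ∀ i, IsL2 (σ.ν u i)) :
    (∀ i, IsL2 fun t => S.Υ i *ᵥ σ.epsErr i t) ∧
    ∑ i, ∫ t in Ici (0 : ℝ), (S.Υ i *ᵥ σ.epsErr i t) ⬝ᵥ (S.Υ i *ᵥ σ.epsErr i t)
      ≤ γ ^ 2 * (∑ i, (x₀ - ξ i) ⬝ᵥ ((X i)⁻¹ *ᵥ (x₀ - ξ i))
        + ∑ i, ((∫ t in Ici (0 : ℝ), u.power i t)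
          + ∫ t in Ici (0 : ℝ), σ.ν u i t ⬝ᵥ σ.ν u i t)) := by
  obtain ⟨g, hV, hg⟩ := hdet.dissipation h
  have hγ := hdet.gamma_pos
  have hδ : ∀ t, 0 ≤ σ.stackedDetErr t ⬝ᵥ (S.lmi Z γ R *ᵥ σ.stackedDetErr t) := fun t =>
    hdet.lmi_pos.posSemidef.quadForm_nonneg _
  -- Here `Řᵢ > Υᵢ'Υᵢ` makes the dissipation dominate the output error of the detector.
  have hμ : ∀ i t, (S.Υ i *ᵥ σ.epsErr i t) ⬝ᵥ (S.Υ i *ᵥ σ.epsErr i t)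
      ≤ σ.epsErr i t ⬝ᵥ (Rc i *ᵥ σ.epsErr i t) := fun i t => by
    have := (hdet.lmi_pos' i).posSemidef.quadForm_nonneg (σ.epsErr i t)
    rwa [Matrix.sub_mulVec, dotProduct_sub, ← Matrix.mulVec_mulVec,
      dotProduct_mulVec_transpose (S.Υ i)ᵀ, Matrix.transpose_transpose, sub_nonneg] at this
  have hμ0 : ∀ i t, 0 ≤ (S.Υ i *ᵥ σ.epsErr i t) ⬝ᵥ (S.Υ i *ᵥ σ.epsErr i t) := fun i t =>
    dotProduct_self_nonneg_real _
  have hsum : ∀ t, ∑ i, (S.Υ i *ᵥ σ.epsErr i t) ⬝ᵥ (S.Υ i *ᵥ σ.epsErr i t)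
      ≤ γ ^ 2 * (1 / γ ^ 2 * (σ.stackedDetErr t ⬝ᵥ (S.lmi Z γ R *ᵥ σ.stackedDetErr t)
          + ∑ i, σ.epsErr i t ⬝ᵥ (Rc i *ᵥ σ.epsErr i t))) := fun t => by
    rw [← mul_assoc, mul_one_div_cancel (by positivity), one_mul]
    linarith [hδ t, Finset.sum_le_sum fun i (_ : i ∈ Finset.univ) => hμ i t]
  have hh : IntegrableOn (fun t => ∑ i, (u.power i t + σ.ν u i t ⬝ᵥ σ.ν u i t)) (Ici (0 : ℝ)) :=
    integrable_finsetSum _ fun i _ => (hu.integrableOn_power i).add (hν i).2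
  obtain ⟨hq, hle⟩ := hV.dissipation (h := fun t => ∑ i, (u.power i t + σ.ν u i t ⬝ᵥ σ.ν u i t))
    (q := fun t => 1 / γ ^ 2 * (σ.stackedDetErr t ⬝ᵥ (S.lmi Z γ R *ᵥ σ.stackedDetErr t)
          + ∑ i, σ.epsErr i t ⬝ᵥ (Rc i *ᵥ σ.epsErr i t)))
    (fun t ht => Finset.sum_nonneg fun i _ =>
      ((hdet.bounded i).posDef ht).inv.posSemidef.quadForm_nonneg _)
    (((continuousOn_quadForm h.continuousOn_stackedDetErr _).add
      (continuousOn_finsetSum _ fun i _ =>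
        continuousOn_quadForm (h.continuousOn_epsErr i) _)).const_mul _)
    (fun t _ => mul_nonneg (by positivity) (add_nonneg (hδ t)
      (Finset.sum_nonneg fun i _ => (hμ0 i t).trans (hμ i t)))) hh hg
  have hc : ∀ i, ContinuousOn (fun t => S.Υ i *ᵥ σ.epsErr i t) (Ici 0) := fun i =>
    ((Continuous.matrix_mulVec continuous_const continuous_id :
      Continuous fun x => S.Υ i *ᵥ x)).comp_continuousOn (h.continuousOn_epsErr i)
  have hL2 : ∀ i, IsL2 fun t => S.Υ i *ᵥ σ.epsErr i t := fun i => by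
    refine ⟨(hc i).aestronglyMeasurable measurableSet_Ici,
      integrableOn_of_le ?_ (hq.const_mul (γ ^ 2)) fun t _ => ⟨hμ0 i t, ?_⟩⟩
    · exact ((by fun_prop : Continuous fun x : Fin (S.nf i) → ℝ => x ⬝ᵥ x)).comp_continuousOn
        (hc i)
    · exact (Finset.single_le_sum
        (f := fun i => (S.Υ i *ᵥ σ.epsErr i t) ⬝ᵥ (S.Υ i *ᵥ σ.epsErr i t))
        (fun i _ => hμ0 i t) (Finset.mem_univ i)).trans (hsum t)
  refine ⟨hL2, ?_⟩
  have e1 : ∑ i, ∫ t in Ici (0 : ℝ), (S.Υ i *ᵥ σ.epsErr i t) ⬝ᵥ (S.Υ i *ᵥ σ.epsErr i t)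
      = ∫ t in Ici (0 : ℝ), ∑ i, (S.Υ i *ᵥ σ.epsErr i t) ⬝ᵥ (S.Υ i *ᵥ σ.epsErr i t) :=
    (integral_finsetSum _ fun i _ => (hL2 i).2).symm
  have e2 : ∑ i, ((∫ t in Ici (0 : ℝ), u.power i t)
        + ∫ t in Ici (0 : ℝ), σ.ν u i t ⬝ᵥ σ.ν u i t)
      = ∫ t in Ici (0 : ℝ), ∑ i, (u.power i t + σ.ν u i t ⬝ᵥ σ.ν u i t) :=
    sum_integral_add hu.integrableOn_power fun i => (hν i).2
  rw [e1, e2]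
  refine (integral_mono (integrable_finsetSum _ fun i _ => (hL2 i).2) (hq.const_mul (γ ^ 2))
    hsum).trans ?_
  rw [integral_const_mul]
  exact mul_le_mul_of_nonneg_left hle (by positivity)

/-- The controlled observers attenuate the disturbances and the residual attacks. -/
theorem ObserverConditions.attenuation (hobs : S.ObserverConditions P Zb γb Rb Xb Yb)
    (hP : P.PosSemidef) (h : IsTrajectory (S.designGains Z Zb Y Yb) u x₀ ξ σ)
    (hu : u.IsAdmissible) (hφ : ∀ i, IsL2 fun t => σ.φ i t - u.f i t) :
    (∀ i, IsL2 (σ.err i)) ∧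
    IntegrableOn (fun t => σ.stackedErr t ⬝ᵥ (P *ᵥ σ.stackedErr t)) (Ici (0 : ℝ)) ∧
    ∫ t in Ici (0 : ℝ), σ.stackedErr t ⬝ᵥ (P *ᵥ σ.stackedErr t)
      ≤ γb ^ 2 * (∑ i, (x₀ - ξ i) ⬝ᵥ ((Xb i)⁻¹ *ᵥ (x₀ - ξ i))
        + ∑ i, ((∫ t in Ici (0 : ℝ), u.power i t)
          + ∫ t in Ici (0 : ℝ), (σ.φ i t - u.f i t) ⬝ᵥ (σ.φ i t - u.f i t))) := by
  obtain ⟨g, hV, hg⟩ := hobs.dissipation h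
  have hγ := hobs.gamma_pos
  obtain ⟨c, hc, hce⟩ := hobs.exists_le_quadForm hP
  -- The performance weight `P` is dominated by the LMI matrix; dividing the dissipation by `1/γb²`
  -- produces the factor `γb²` of the estimate.
  have hPle : ∀ t, σ.stackedErr t ⬝ᵥ (P *ᵥ σ.stackedErr t)
      ≤ σ.stackedErr t ⬝ᵥ (S.lmi Zb γb Rb *ᵥ σ.stackedErr t) := fun t => by
    have := hobs.lmi_pos.posSemidef.quadForm_nonneg (σ.stackedErr t)
    rwa [Matrix.sub_mulVec, dotProduct_sub, sub_nonneg] at this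
  have hP0 : ∀ t, 0 ≤ σ.stackedErr t ⬝ᵥ (P *ᵥ σ.stackedErr t) := fun t => hP.quadForm_nonneg _
  have hγ1 : γb ^ 2 * (1 / γb ^ 2) = 1 := mul_one_div_cancel (by positivity)
  have hh : IntegrableOn (fun t => ∑ i, (u.power i t
      + (σ.φ i t - u.f i t) ⬝ᵥ (σ.φ i t - u.f i t))) (Ici (0 : ℝ)) :=
    integrable_finsetSum _ fun i _ => (hu.integrableOn_power i).add (hφ i).2
  obtain ⟨hq, hle⟩ := hV.dissipation
    (h := fun t => ∑ i, (u.power i t + (σ.φ i t - u.f i t) ⬝ᵥ (σ.φ i t - u.f i t)))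
    (q := fun t => 1 / γb ^ 2 * (σ.stackedErr t ⬝ᵥ (S.lmi Zb γb Rb *ᵥ σ.stackedErr t)))
    (fun t ht => Finset.sum_nonneg fun i _ =>
      ((hobs.bounded i).posDef ht).inv.posSemidef.quadForm_nonneg _)
    ((continuousOn_quadForm h.continuousOn_stackedErr _).const_mul _)
    (fun t _ => mul_nonneg (by positivity) ((hP0 t).trans (hPle t))) hh hg
  have hPi : IntegrableOn (fun t => σ.stackedErr t ⬝ᵥ (P *ᵥ σ.stackedErr t)) (Ici (0 : ℝ)) :=
    integrableOn_of_le (continuousOn_quadForm h.continuousOn_stackedErr _)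
      (hq.const_mul (γb ^ 2)) fun t _ => ⟨hP0 t, by
        rw [← mul_assoc, hγ1, one_mul]
        exact hPle t⟩
  refine ⟨fun i => ⟨(h.continuousOn_err i).aestronglyMeasurable measurableSet_Ici,
    integrableOn_of_le ?_ (hq.const_mul (c⁻¹ * γb ^ 2)) fun t _ =>
      ⟨dotProduct_self_nonneg_real _, ?_⟩⟩, hPi, ?_⟩
  · exact ((by fun_prop : Continuous fun x : Fin n → ℝ => x ⬝ᵥ x)).comp_continuousOn
      (h.continuousOn_err i)
  · rw [mul_assoc, ← mul_assoc (γb ^ 2), hγ1, one_mul, le_inv_mul_iff₀ hc]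
    exact (mul_le_mul_of_nonneg_left (Finset.single_le_sum (f := fun i => σ.err i t ⬝ᵥ σ.err i t)
      (fun i _ => dotProduct_self_nonneg_real _) (Finset.mem_univ i)) hc.le).trans (hce σ t)
  · have e2 : ∑ i, ((∫ t in Ici (0 : ℝ), u.power i t)
          + ∫ t in Ici (0 : ℝ), (σ.φ i t - u.f i t) ⬝ᵥ (σ.φ i t - u.f i t))
        = ∫ t in Ici (0 : ℝ), ∑ i, (u.power i t
          + (σ.φ i t - u.f i t) ⬝ᵥ (σ.φ i t - u.f i t)) :=
      sum_integral_add hu.integrableOn_power fun i => (hφ i).2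
    rw [e2]
    refine (integral_mono hPi (hq.const_mul (γb ^ 2)) fun t => ?_).trans ?_
    · beta_reduce
      rw [← mul_assoc, hγ1, one_mul]
      exact hPle t
    · rw [integral_const_mul]
      exact mul_le_mul_of_nonneg_left hle (by positivity)

/-- From `|p - q|² ≤ 2|p|² + 2|q|²`; this is the origin of the factors `2` in the final bound. -/
theorem integral_sub_dotProduct_self_le {ι : Type*} [Fintype ι] {p q : ℝ → ι → ℝ} (hp : IsL2 p)
    (hq : IsL2 q) :
    ∫ t in Ici (0 : ℝ), (p t - q t) ⬝ᵥ (p t - q t)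
      ≤ 2 * (∫ t in Ici (0 : ℝ), p t ⬝ᵥ p t) + 2 * ∫ t in Ici (0 : ℝ), q t ⬝ᵥ q t := by
  rw [← integral_const_mul, ← integral_const_mul,
    ← integral_add (hp.2.const_mul 2) (hq.2.const_mul 2)]
  refine integral_mono (hp.sub hq).2 ((hp.2.const_mul 2).add (hq.2.const_mul 2)) fun t => ?_
  have h := dotProduct_self_nonneg_real (p t + q t)
  rw [add_dotProduct, dotProduct_add, dotProduct_add] at h
  simp only [sub_dotProduct, dotProduct_sub]
  linarith

end Network

end ResilientObserver

/-! ### Combination of the detector and observer estimates -/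

theorem theorem1 {N n m : ℕ} (S : ResilientObserver.Network N n m)
    (G : ∀ i, ResilientObserver.ProperTransfer (S.nf i))
    (hGstable : ∀ i, (G i).LoopStable)
    (hGreal : ∀ i, ResilientObserver.IsTrackerRealization (G i) (S.Ω i) (S.Γ i) (S.Υ i))
    (P : Matrix (Fin N × Fin n) (Fin N × Fin n) ℝ) (hP : P.PosSemidef)
    (Z Zb : S.EdgeWeights) (γ γb : ℝ)
    (R X : Fin N → Matrix (Fin n) (Fin n) ℝ)
    (Rc Xc : ∀ i, Matrix (Fin (S.ne i)) (Fin (S.ne i)) ℝ)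
    (Y : ∀ i, ℝ → Matrix (S.Ext i) (S.Ext i) ℝ)
    (hdet : S.DetectorConditions Z γ R Rc X Xc Y)
    (Rb Xb : Fin N → Matrix (Fin n) (Fin n) ℝ)
    (Yb : Fin N → ℝ → Matrix (Fin n) (Fin n) ℝ)
    (hobs : S.ObserverConditions P Zb γb Rb Xb Yb) :
    (∃ M r : ℝ, 0 < M ∧ 0 < r ∧
      ∀ (u : S.Inputs) (x₀ : Fin n → ℝ) (ξ : Fin N → Fin n → ℝ) (σ : S.States),
        u.IsZero → ResilientObserver.Network.IsTrajectory (S.designGains Z Zb Y Yb) u x₀ ξ σ →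
        ∀ i t, 0 ≤ t →
          ResilientObserver.eNorm (σ.err i t) ≤
            M * Real.exp (-r * t) * ∑ j, ResilientObserver.eNorm (x₀ - ξ j)) ∧
    (∀ (u : S.Inputs) (x₀ : Fin n → ℝ) (ξ : Fin N → Fin n → ℝ) (σ : S.States),
        u.IsAdmissible →
        ResilientObserver.Network.IsTrajectory (S.designGains Z Zb Y Yb) u x₀ ξ σ →
        (∀ i, ResilientObserver.IsL2 (σ.err i)) ∧
        (∀ i, ResilientObserver.IsL2 (σ.ν u i)) ∧
        IntegrableOn (fun t => σ.stackedErr t ⬝ᵥ (P *ᵥ σ.stackedErr t)) (Ici (0 : ℝ)) ∧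
        (∫ t in Ici (0 : ℝ), σ.stackedErr t ⬝ᵥ (P *ᵥ σ.stackedErr t)) ≤
          γb ^ 2 * ∑ i, ((x₀ - ξ i) ⬝ᵥ
                (((Xb i)⁻¹ + (2 * γ ^ 2) • (X i)⁻¹) *ᵥ (x₀ - ξ i))
              + (1 + 2 * γ ^ 2) * ∫ t in Ici (0 : ℝ),
                  (u.w t ⬝ᵥ u.w t + u.v i t ⬝ᵥ u.v i t
                    + ∑ j ∈ S.nbr i, u.vc i j t ⬝ᵥ u.vc i j t))
            + 2 * γb ^ 2 * (1 + γ ^ 2) *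
              ∑ i, ∫ t in Ici (0 : ℝ), σ.ν u i t ⬝ᵥ σ.ν u i t ∧
        (∀ i, ResilientObserver.IsL2 (fun t => σ.φ i t - u.f i t))) := by
  refine ⟨ResilientObserver.Network.exponential_convergence hP hdet hobs,
    fun u x₀ ξ σ hu h => ?_⟩
  have hν : ∀ i, ResilientObserver.IsL2 (σ.ν u i) := fun i =>
    (hGreal i).isL2_mismatch (hGstable i) (hu.f i) (h.attackModel i)
  obtain ⟨hΥ, hdle⟩ := hdet.attenuation h hu hν
  have hφ : ∀ i, ResilientObserver.IsL2 fun t => σ.φ i t - u.f i t := fun i => by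
    simp only [ResilientObserver.Network.States.φ_sub_eq]
    exact (hν i).sub (hΥ i)
  obtain ⟨herr, hint, hole⟩ := hobs.attenuation hP h hu hφ
  refine ⟨herr, hν, hint, ?_, hφ⟩
  have hφle : ∑ i, ∫ t in Ici (0 : ℝ), (σ.φ i t - u.f i t) ⬝ᵥ (σ.φ i t - u.f i t)
      ≤ 2 * (∑ i, ∫ t in Ici (0 : ℝ), σ.ν u i t ⬝ᵥ σ.ν u i t)
        + 2 * ∑ i, ∫ t in Ici (0 : ℝ), (S.Υ i *ᵥ σ.epsErr i t) ⬝ᵥ (S.Υ i *ᵥ σ.epsErr i t) := by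
    rw [Finset.mul_sum, Finset.mul_sum, ← Finset.sum_add_distrib]
    refine Finset.sum_le_sum fun i _ => ?_
    simp only [ResilientObserver.Network.States.φ_sub_eq]
    exact ResilientObserver.Network.integral_sub_dotProduct_self_le (hν i) (hΥ i)
  have hX : ∀ i, (x₀ - ξ i) ⬝ᵥ (((Xb i)⁻¹ + (2 * γ ^ 2) • (X i)⁻¹) *ᵥ (x₀ - ξ i))
      = (x₀ - ξ i) ⬝ᵥ ((Xb i)⁻¹ *ᵥ (x₀ - ξ i))
        + 2 * γ ^ 2 * ((x₀ - ξ i) ⬝ᵥ ((X i)⁻¹ *ᵥ (x₀ - ξ i))) := fun i => by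
    rw [Matrix.add_mulVec, dotProduct_add, Matrix.smul_mulVec, dotProduct_smul, smul_eq_mul]
  change _ ≤ γb ^ 2 * ∑ i, (_ + (1 + 2 * γ ^ 2) * ∫ t in Ici (0 : ℝ), u.power i t) + _
  simp only [hX]
  rw [Finset.sum_add_distrib] at hdle hole
  rw [Finset.sum_add_distrib, Finset.sum_add_distrib, ← Finset.mul_sum, ← Finset.mul_sum]
  refine hole.trans ?_
  have hγb := hobs.gamma_pos
  -- Inserting the detector bound into the observer bound multiplies the detector's initial term and
  -- disturbance energy by `2γ²`, and gives the mismatch the total weight `2 + 2γ²`.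
  have key := mul_le_mul_of_nonneg_left (add_le_add hφle
    (mul_le_mul_of_nonneg_left hdle (zero_le_two (α := ℝ)))) (sq_nonneg γb)
  nlinarith
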